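/- **Model.** Let $G=(V,E)$ be a finite undirected graph with $n=|V|$ nodes and maximum degree $d_{\max}$. Time proceeds in synchronous rounds $0,1,2,\dots$. An oblivious adversary fixes in advance, for each node, the round in which it is woken up (possibly never) and the round from which on it has crashed permanently (possibly never); $G_t$ denotes the subgraph induced by the nodes that participate in round $t$ (awake and not crashed). All nodes run the same randomized algorithm, starting in the same initial state when they are woken up. In each round a participating node either beeps or listens; a listening node learns only whether at least one of its neighbours in $G_t$ beeps, and a beeping node receives no feedback. At any time a node is *inactive*, *competing* or *in the MIS*. A participating node is *stable* in round $t$ if it is in the MIS and all its neighbours in $G_t$ are inactive, or if it has a neighbour in $G_t$ that is in the MIS and all of whose neighbours in $G_t$ are inactive. **Simple wake-up dynamics with parameter $\delta$.** A node is *old* at time $t$ if it was woken up at or before round $t-\delta$. Any set of nodes may be awake in round $0$; each node woken up in a round $t>0$ has a neighbour in $G_t$ that is old at time $t$; and a node participating in round $t$ may crash at the transition to round $t+1$ only if all its neighbours in $G_t$ are old at time $t+1$. **Theorem.** There are an algorithm $A$ (a single algorithm, which is given no information about $G$, $n$, $d_{\max}$, $\delta$, the current time or the adversary) and a constant $a>0$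 such that the following holds for every finite graph $G$, every integer $\delta\ge a\log(d_{\max}+2)$ and every adversary that obeys the simple wake-up dynamics with parameter $\delta$. 1. With probability one there is a round from which on all participating nodes are stable. A stable node remains stable as long as it participates and none of its neighbours in the MIS crashes. 2. For every constant $c\ge 1$ there is a constant $K>0$, depending only on $c$, such that if no wake-ups and no crashes happen from round $t$ to round $t+T$, where $T\ge K\log^2 n$, then with probability at least $1-n^{-c}$ all participating nodes are stable in round $t+T$. In other words, $A$ solves the MIS problem in $O(\log^2 n)$ time under simple wake-up dynamics with $\delta=O(\log d_{\max})$. -/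

import Mathlib

open MeasureTheory

namespace Beeping

/-- The three externally visible states of a process. -/
inductive Status where
  | inactive
  | competing
  | mis

/-- A randomized distributed algorithm in the discrete beeping model, run identically by all
(anonymous) processes. The data do not refer to a network, a clock or a wake-up pattern.
In every round a process draws `coins` fresh fair coins; from its state and these coins it decides
whether to beep (otherwise it listens); its next state is computed from the old state, the coins
and the bit telling whether it heard a beep (this bit is `false` when the process beeps itself).
All maps are computable. -/
structure Algorithm where
  State : Type
  [code : Primcodable State]
  coins : ℕ
  init : State
  beep : State → (Fin coins → Bool) → Bool
  next : State → (Fin coins → Bool) → Bool → State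
  status : State → Status
  beep_computable : Computable fun p : State × (Fin coins → Bool) => beep p.1 p.2
  next_computable :
    Computable fun p : State × (Fin coins → Bool) × Bool => next p.1 p.2.1 p.2.2
  status_computable : ∀ x : Status, ComputablePred fun s : State => status s = x

/-- The decisions of an oblivious adversary: the round in which a node is woken up and the first
round from which on it is gone; the value `⊤` means that the event never happens. -/
structure Schedule (V : Type) where
  wake : V → ℕ∞
  crash : V → ℕ∞

namespace Schedule

variable {V : Type} (S : Schedule V)

/-- The process at `v` participates in round `t`. -/
def Active (t : ℕ) (v : V) : Prop :=
  S.wake v ≤ (t : ℕ∞) ∧ (t : ℕ∞) < S.crash v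

/-- At the beginning of round `t`, `v` has been around for at least `δ` rounds. -/
def Old (δ t : ℕ) (v : V) : Prop :=
  S.wake v + (δ : ℕ∞) ≤ (t : ℕ∞)

/-- Simple wake-up dynamics. The nodes woken up in round `0` are arbitrary; a node woken up in a
later round has, in that round, at least one participating old neighbour; and a node may crash at
the transition to round `t + 1` only if all nodes it is connected to are old at that moment. -/
structure IsSimple (G : SimpleGraph V) (δ : ℕ) : Prop where
  wake_near_old : ∀ (t : ℕ) (v : V), 0 < t → S.wake v = (t : ℕ∞) → S.Active t v →
    ∃ u, G.Adj v u ∧ S.Active t u ∧ S.Old δ t u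
  crash_among_old : ∀ (t : ℕ) (v : V), S.Active t v → ¬ S.Active (t + 1) v →
    ∀ u, G.Adj v u → S.Active t u → S.Old δ (t + 1) u

/-- No wake-ups and no crashes happen during the `T` rounds from `t` to `t + T`. -/
def Quiet (t T : ℕ) : Prop :=
  ∀ s, t ≤ s → s ≤ t + T → ∀ v, S.Active s v ↔ S.Active t v

end Schedule

namespace Algorithm

variable (A : Algorithm) {V : Type} (G : SimpleGraph V) (S : Schedule V)

/-- The coins drawn by every node in every round. -/
abbrev Sample (V : Type) : Type := ℕ × V → Fin A.coins → Bool

/-- All coins are fair and independent. -/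
noncomputable def coinMeasure (V : Type) : Measure (A.Sample V) :=
  Measure.infinitePi fun _ => (PMF.uniformOfFintype (Fin A.coins → Bool)).toMeasure

/-- Given the states `x` at the beginning of round `t`, the node `v` participates and beeps in
round `t`. -/
def Beeps (ω : A.Sample V) (t : ℕ) (x : V → A.State) (v : V) : Prop :=
  S.Active t v ∧ A.beep (x v) (ω (t, v)) = true

/-- The node `v` listens in round `t` and at least one of its participating neighbours beeps. -/
def Hears (ω : A.Sample V) (t : ℕ) (x : V → A.State) (v : V) : Prop :=
  ¬ A.Beeps S ω t x v ∧ ∃ u, G.Adj v u ∧ A.Beeps S ω t x u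

open Classical in
/-- The states at the beginning of round `t`. A node that wakes up starts in the state `init`
(the states of nodes that do not participate are irrelevant and are set to `init`). -/
noncomputable def run (ω : A.Sample V) : ℕ → V → A.State
  | 0 => fun _ => A.init
  | t + 1 => fun v =>
      if S.Active t v then
        A.next (run ω t v) (ω (t, v)) (decide (A.Hears G S ω t (run ω t) v))
      else A.init

/-- The participating node `v` has the status `x` at the beginning of round `t`. -/
def HasStatus (ω : A.Sample V) (t : ℕ) (v : V) (x : Status) : Prop :=
  S.Active t v ∧ A.status (A.run G S ω t v) = x

/-- `v` is in the MIS and all its participating neighbours are inactive. -/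
def StableMIS (ω : A.Sample V) (t : ℕ) (v : V) : Prop :=
  A.HasStatus G S ω t v Status.mis ∧
    ∀ u, G.Adj v u → S.Active t u → A.HasStatus G S ω t u Status.inactive

/-- `v` is in the MIS with all its neighbours inactive, or has a stable neighbour in the MIS. -/
def Stable (ω : A.Sample V) (t : ℕ) (v : V) : Prop :=
  A.StableMIS G S ω t v ∨ ∃ u, G.Adj v u ∧ A.StableMIS G S ω t u

/-- All participating nodes are stable at the beginning of round `t`. -/
def AllStable (ω : A.Sample V) (t : ℕ) : Prop :=
  ∀ v, S.Active t v → A.Stable G S ω t v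

/-- A stable node stays stable as long as it participates and none of its neighbours in the MIS
crashes. -/
def StabilityPersists : Prop :=
  ∀ (ω : A.Sample V) (t : ℕ) (v : V), S.Active t v → A.Stable G S ω t v → S.Active (t + 1) v →
    (∀ u, G.Adj v u → A.HasStatus G S ω t u Status.mis → S.Active (t + 1) u) →
    A.Stable G S ω (t + 1) v

/-- Almost surely, all participating nodes are stable from some round on, and stability can be
lost only through a crash of a node in the MIS. -/
def IsLasVegas : Prop :=
  (∀ᵐ ω ∂(A.coinMeasure V), ∃ t₀, ∀ t, t₀ ≤ t → A.AllStable G S ω t) ∧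
    A.StabilityPersists G S

end Algorithm

end Beeping

/-! Clock. Rounds are grouped into frames of 36 on a common clock. The processes woken in round 0
start it. Any later process has an old neighbour: it hears two beeps in consecutive rounds, which
happens only in the header of an even frame, and afterwards learns further binary digits of the
frame number from announcements (`sInv`, `le_modulus`). A process of age `matureAge J` knows the
frame number modulo `2 ^ J`. With `2 ^ J` of order log(d_max), the parameter δ exceeds this age
(`exists_scale`). The algorithm never needs `J` or the degrees; they occur in the analysis only.

Membership. In each frame the members toss twelve coins; a member that tosses tails and hears a
neighbouring member resigns. A process without member neighbours starts, i.e. becomes a member, at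
the end of the frame unless somebody within distance two objects. Each process also tosses one coin
per frame for objections, and in frame `k` it objects if its last `g` of these were heads, where `g`
is the power of two `gcd(k, 2 ^ J)` as long as `2 ^ J` does not divide `k`. These thresholds form
the ruler sequence 1, 2, 1, 4, 1, 2, 1, 8, and so on. If the closed neighbourhood of `v` has `A`
participating nodes, the expected number of starts in it is at most `A * (1 - 2 ^ (-g)) ^ A ≤ 2 ^
g`, whatever `A` is (`conf_sum_le`).

Since `g` is at most the distance to the next multiple of `2 ^ J`, and the bouts of one frame reduce
the expected number of conflicts by the factor `(3/4) ^ 12`, only a bounded expected number of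
conflicts near `v` is left when that multiple is reached (`conf_iter`). There the threshold is at
least `2 ^ J`, objections are improbable, and a node ends that frame unstable without being a member
with probability at most 1/4 (`not_mem_le`).

Progress. The potential `pot` counts ordered pairs of unstable nodes that are equal or adjacent. For
an unstable member `v` and an unstable `w` in its closed neighbourhood, `v` beats all other members
near `v` or `w` with probability of order `1 / (deg v + deg w)` (`le_win`); then `w` is stable, and
for each `w` at most one such `v` succeeds (`pot_step`). Symmetrizing over pairs, the expected loss
is a constant fraction of `pot / 2 - lag`, where `lag` accounts for non-members (`pot_half_le`). So
`pot` contracts in expectation within `2 * 2 ^ J` frames (`Ex_pot_le`). It is at most `n ^ 2`, and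
at least 1 while some node is unstable; hence O(log n) contractions, O(log n log d_max) rounds,
suffice.

Persistence of stability is deterministic (`stableMIS_succ`). Since the graph is finite, every
schedule is eventually quiet, and letting the number of contractions grow gives almost sure
stabilization. -/

namespace Beeping

/-! ### The state machine of the algorithm. -/

namespace RulerMIS

/-- The state of a process. Time is divided into frames of `36` rounds; `phase` is the position in
the current frame, `clock` the number of the frame modulo `modulus`, and `streak` the length of the
current run of heads. While a process is not yet `synced`, `clock` counts the rounds since it was
woken up. -/
structure State where
  synced : Bool
  root : Bool
  member : Bool
  blocked : Bool
  supported : Bool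
  heard : Bool
  phase : ℕ
  modulus : ℕ
  clock : ℕ
  streak : ℕ

/-- States as nested tuples. -/
def State.equiv :
    State ≃ Bool × Bool × Bool × Bool × Bool × Bool × ℕ × ℕ × ℕ × ℕ where
  toFun s := (s.synced, s.root, s.member, s.blocked, s.supported, s.heard, s.phase, s.modulus,
    s.clock, s.streak)
  invFun p := ⟨p.1, p.2.1, p.2.2.1, p.2.2.2.1, p.2.2.2.2.1, p.2.2.2.2.2.1, p.2.2.2.2.2.2.1,
    p.2.2.2.2.2.2.2.1, p.2.2.2.2.2.2.2.2.1, p.2.2.2.2.2.2.2.2.2⟩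
  left_inv _ := rfl
  right_inv _ := rfl

instance : Primcodable State := Primcodable.ofEquiv _ State.equiv

/-- The state of a process that was just woken up. -/
def init : State := ⟨false, false, false, false, false, false, 0, 0, 0, 0⟩

/-- The rounds of a frame in which members toss coins to resolve conflicts. -/
def isBout (φ : ℕ) : Bool := decide (4 ≤ φ) && decide (φ ≤ 26) && decide (φ % 2 = 0)

/-- The process has seen enough heads in a row to object to a start in the current frame. -/
def draws (s : State) : Bool := decide (s.clock.gcd s.modulus ≤ s.streak)

/-- The process knows that the next binary digit of the frame number is `1`. -/
def announces (s : State) : Bool :=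
  decide (4 * s.clock.gcd s.modulus ≤ s.modulus) &&
    decide (s.clock % (4 * s.clock.gcd s.modulus) = 3 * s.clock.gcd s.modulus)

/-- The beeping rule. -/
def beep (s : State) (coin : Bool) : Bool :=
  s.synced &&
    ((decide (s.phase ≤ 1) && decide (s.clock % 2 = 0)) ||
      (isBout s.phase && s.member && coin) ||
      (decide (s.phase = 28) && s.member) ||
      (decide (s.phase = 30) && draws s) ||
      (decide (s.phase = 32) && s.supported) ||
      (decide (s.phase = 34) && announces s))

/-- The state after the two beeps of a header have been heard. -/
def joined : State := ⟨true, false, false, false, false, false, 2, 2, 0, 0⟩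

/-- The state of a process that starts the global clock. -/
def started : State := ⟨true, true, false, false, false, false, 0, 2, 0, 0⟩

/-- The transition of a process that does not know the global clock yet. -/
def nextUnsynced (s : State) (hear : Bool) : State :=
  bif s.heard && hear then joined
  else bif decide (s.clock = 73) then started
  else ⟨false, false, false, false, false, hear, 0, 0, s.clock + 1, 0⟩

/-- The process learns a digit of the frame number. -/
def learns (s : State) (hear : Bool) : Bool :=
  decide (s.phase = 34) && hear && decide (2 * s.clock = s.modulus)

/-- The frame ends and the clock overflows. -/
def overflows (s : State) : Bool := decide (s.phase = 35) && decide (s.clock + 1 = s.modulus)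

/-- The transition of a process that knows the phase. -/
def nextSynced (s : State) (coin hear : Bool) : State where
  synced := true
  root := s.root
  member :=
    bif decide (s.phase = 35) then s.member || (!s.blocked && !s.supported)
    else s.member && (!isBout s.phase || coin || !hear)
  blocked := bif decide (s.phase = 28) then hear else s.blocked
  supported :=
    bif decide (s.phase = 30) then draws s || hear
    else s.supported || (decide (s.phase = 32) && hear)
  heard := false
  phase := bif decide (s.phase = 35) then 0 else s.phase + 1
  modulus := bif learns s hear || (overflows s && s.root) then 2 * s.modulus else s.modulus
  clock :=
    bif learns s hear then s.clock + s.modulus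
    else bif overflows s && !s.root then 0
    else bif decide (s.phase = 35) then s.clock + 1 else s.clock
  streak := bif decide (s.phase = 0) then (bif coin then s.streak + 1 else 0) else s.streak

/-- The transition function. -/
def next (s : State) (coin hear : Bool) : State :=
  bif s.synced then nextSynced s coin hear else nextUnsynced s hear

/-- Members are in the MIS, all other processes are inactive. -/
def status (s : State) : Status := bif s.member then Status.mis else Status.inactive

/-! ### Computability of the transition maps. -/

section Computability

variable {α : Type} [Primcodable α]

theorem primrec_tuple : Primrec State.equiv := Primrec.of_equiv

theorem primrec_synced : Primrec State.synced := Primrec.fst.comp primrec_tuple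
theorem primrec_root : Primrec State.root := (Primrec.fst.comp Primrec.snd).comp primrec_tuple
theorem primrec_member : Primrec State.member :=
  (Primrec.fst.comp (Primrec.snd.comp Primrec.snd)).comp primrec_tuple
theorem primrec_blocked : Primrec State.blocked :=
  (Primrec.fst.comp (Primrec.snd.comp (Primrec.snd.comp Primrec.snd))).comp primrec_tuple
theorem primrec_supported : Primrec State.supported :=
  (Primrec.fst.comp (Primrec.snd.comp (Primrec.snd.comp
    (Primrec.snd.comp Primrec.snd)))).comp primrec_tuple
theorem primrec_heard : Primrec State.heard :=
  (Primrec.fst.comp (Primrec.snd.comp (Primrec.snd.comp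
    (Primrec.snd.comp (Primrec.snd.comp Primrec.snd))))).comp primrec_tuple

theorem primrec_numbers :
    Primrec fun s : State => (s.phase, s.modulus, s.clock, s.streak) :=
  (Primrec.snd.comp (Primrec.snd.comp (Primrec.snd.comp
    (Primrec.snd.comp (Primrec.snd.comp Primrec.snd))))).comp primrec_tuple

theorem primrec_phase : Primrec State.phase := Primrec.fst.comp primrec_numbers
theorem primrec_modulus : Primrec State.modulus :=
  (Primrec.fst.comp Primrec.snd).comp primrec_numbers
theorem primrec_clock : Primrec State.clock :=
  (Primrec.fst.comp (Primrec.snd.comp Primrec.snd)).comp primrec_numbers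
theorem primrec_streak : Primrec State.streak :=
  (Primrec.snd.comp (Primrec.snd.comp Primrec.snd)).comp primrec_numbers

theorem primrec_mk {f₁ f₂ f₃ f₄ f₅ f₆ : α → Bool} {g₁ g₂ g₃ g₄ : α → ℕ}
    (h₁ : Primrec f₁) (h₂ : Primrec f₂) (h₃ : Primrec f₃) (h₄ : Primrec f₄) (h₅ : Primrec f₅)
    (h₆ : Primrec f₆) (k₁ : Primrec g₁) (k₂ : Primrec g₂) (k₃ : Primrec g₃) (k₄ : Primrec g₄) :
    Primrec fun a => State.mk (f₁ a) (f₂ a) (f₃ a) (f₄ a) (f₅ a) (f₆ a) (g₁ a) (g₂ a) (g₃ a)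
      (g₄ a) :=
  (Primrec.of_equiv_symm (e := State.equiv)).comp
    (h₁.pair (h₂.pair (h₃.pair (h₄.pair (h₅.pair (h₆.pair (k₁.pair (k₂.pair (k₃.pair k₄)))))))))

theorem primrec_add {f g : α → ℕ} (hf : Primrec f) (hg : Primrec g) :
    Primrec fun a => f a + g a := Primrec.nat_add.comp hf hg
theorem primrec_mul {f g : α → ℕ} (hf : Primrec f) (hg : Primrec g) :
    Primrec fun a => f a * g a := Primrec.nat_mul.comp hf hg
theorem primrec_mod {f g : α → ℕ} (hf : Primrec f) (hg : Primrec g) :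
    Primrec fun a => f a % g a := Primrec.nat_mod.comp hf hg
theorem primrec_and {f g : α → Bool} (hf : Primrec f) (hg : Primrec g) :
    Primrec fun a => (f a && g a) := Primrec.and.comp hf hg
theorem primrec_or {f g : α → Bool} (hf : Primrec f) (hg : Primrec g) :
    Primrec fun a => (f a || g a) := Primrec.or.comp hf hg
theorem primrec_not {f : α → Bool} (hf : Primrec f) :
    Primrec fun a => !f a := Primrec.not.comp hf
theorem primrec_decide_eq {f g : α → ℕ} (hf : Primrec f) (hg : Primrec g) :
    Primrec fun a => decide (f a = g a) := (Primrec.eq.comp hf hg).decide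
theorem primrec_decide_le {f g : α → ℕ} (hf : Primrec f) (hg : Primrec g) :
    Primrec fun a => decide (f a ≤ g a) := (Primrec.nat_le.comp hf hg).decide

/-- Writing the gcd as a bounded search makes it visibly primitive recursive. The search bound `m +
n` also covers the case in which one argument is zero. -/
theorem findGreatest_eq_gcd (m n : ℕ) :
    Nat.findGreatest (fun k => m % k = 0 ∧ n % k = 0) (m + n) = m.gcd n := by
  rcases Nat.eq_zero_or_pos (m + n) with h | h
  · obtain ⟨rfl, rfl⟩ : m = 0 ∧ n = 0 := by omega
    simp
  · rw [Nat.findGreatest_eq_iff]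
    have hpos : 0 < m.gcd n := Nat.gcd_pos_iff.2 (by omega)
    refine ⟨?_, fun _ => ⟨Nat.mod_eq_zero_of_dvd (Nat.gcd_dvd_left m n),
      Nat.mod_eq_zero_of_dvd (Nat.gcd_dvd_right m n)⟩, fun k hk _ hd => ?_⟩
    · exact Nat.le_of_dvd h (Nat.dvd_add (Nat.gcd_dvd_left m n) (Nat.gcd_dvd_right m n))
    · exact absurd (Nat.le_of_dvd hpos (Nat.dvd_gcd (Nat.dvd_of_mod_eq_zero hd.1)
        (Nat.dvd_of_mod_eq_zero hd.2))) (by omega)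

theorem primrec_gcd {f g : α → ℕ} (hf : Primrec f) (hg : Primrec g) :
    Primrec fun a => (f a).gcd (g a) := by
  have h : Primrec fun p : ℕ × ℕ =>
      Nat.findGreatest (fun k => p.1 % k = 0 ∧ p.2 % k = 0) (p.1 + p.2) := by
    refine Primrec.nat_findGreatest (primrec_add Primrec.fst Primrec.snd)
      (p := fun (p : ℕ × ℕ) k => p.1 % k = 0 ∧ p.2 % k = 0) ?_
    exact PrimrecPred.and
      (Primrec.eq.comp (primrec_mod (Primrec.fst.comp Primrec.fst) Primrec.snd)
        (Primrec.const 0))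
      (Primrec.eq.comp (primrec_mod (Primrec.snd.comp Primrec.fst) Primrec.snd)
        (Primrec.const 0))
  exact (h.comp (hf.pair hg)).of_eq fun a => findGreatest_eq_gcd _ _

theorem primrec_isBout {f : α → ℕ} (hf : Primrec f) : Primrec fun a => isBout (f a) := by
  unfold isBout
  exact primrec_and (primrec_and (primrec_decide_le (Primrec.const 4) hf)
    (primrec_decide_le hf (Primrec.const 26)))
    (primrec_decide_eq (primrec_mod hf (Primrec.const 2)) (Primrec.const 0))

theorem primrec_draws {f : α → State} (hf : Primrec f) : Primrec fun a => draws (f a) :=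
  primrec_decide_le (primrec_gcd (primrec_clock.comp hf) (primrec_modulus.comp hf))
    (primrec_streak.comp hf)

theorem primrec_announces {f : α → State} (hf : Primrec f) :
    Primrec fun a => announces (f a) := by
  have hg := primrec_gcd (primrec_clock.comp hf) (primrec_modulus.comp hf)
  exact primrec_and
    (primrec_decide_le (primrec_mul (Primrec.const 4) hg) (primrec_modulus.comp hf))
    (primrec_decide_eq (primrec_mod (primrec_clock.comp hf) (primrec_mul (Primrec.const 4) hg))
      (primrec_mul (Primrec.const 3) hg))

theorem primrec_beep {s : α → State} {c : α → Bool} (hs : Primrec s) (hc : Primrec c) :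
    Primrec fun a => beep (s a) (c a) := by
  have hp := primrec_phase.comp hs
  have hm := primrec_member.comp hs
  exact primrec_and (primrec_synced.comp hs)
    (primrec_or (primrec_or (primrec_or (primrec_or (primrec_or
      (primrec_and (primrec_decide_le hp (Primrec.const 1))
        (primrec_decide_eq (primrec_mod (primrec_clock.comp hs) (Primrec.const 2))
          (Primrec.const 0)))
      (primrec_and (primrec_and (primrec_isBout hp) hm) hc))
      (primrec_and (primrec_decide_eq hp (Primrec.const 28)) hm))
      (primrec_and (primrec_decide_eq hp (Primrec.const 30)) (primrec_draws hs)))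
      (primrec_and (primrec_decide_eq hp (Primrec.const 32)) (primrec_supported.comp hs)))
      (primrec_and (primrec_decide_eq hp (Primrec.const 34)) (primrec_announces hs)))

theorem primrec_nextUnsynced {s : α → State} {h : α → Bool} (hs : Primrec s) (hh : Primrec h) :
    Primrec fun a => nextUnsynced (s a) (h a) := by
  refine Primrec.cond (primrec_and (primrec_heard.comp hs) hh) (Primrec.const _)
    (Primrec.cond (primrec_decide_eq (primrec_clock.comp hs) (Primrec.const _)) (Primrec.const _)
      (primrec_mk (Primrec.const _) (Primrec.const _) (Primrec.const _) (Primrec.const _)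
        (Primrec.const _) hh (Primrec.const _) (Primrec.const _)
        (primrec_add (primrec_clock.comp hs) (Primrec.const _)) (Primrec.const _)))

theorem primrec_nextSynced {s : α → State} {c h : α → Bool} (hs : Primrec s) (hc : Primrec c)
    (hh : Primrec h) : Primrec fun a => nextSynced (s a) (c a) (h a) := by
  have hp := primrec_phase.comp hs
  have hm := primrec_member.comp hs
  have hr := primrec_root.comp hs
  have hM := primrec_modulus.comp hs
  have hC := primrec_clock.comp hs
  have hend := primrec_decide_eq hp (Primrec.const 35)
  have hl : Primrec fun a => learns (s a) (h a) :=
    primrec_and (primrec_and (primrec_decide_eq hp (Primrec.const 34)) hh)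
      (primrec_decide_eq (primrec_mul (Primrec.const 2) hC) hM)
  have ho : Primrec fun a => overflows (s a) :=
    primrec_and hend (primrec_decide_eq (primrec_add hC (Primrec.const 1)) hM)
  refine primrec_mk (Primrec.const _) hr ?_ ?_ ?_ (Primrec.const _) ?_ ?_ ?_ ?_
  · exact Primrec.cond hend
      (primrec_or hm (primrec_and (primrec_not (primrec_blocked.comp hs))
        (primrec_not (primrec_supported.comp hs))))
      (primrec_and hm (primrec_or (primrec_or (primrec_not (primrec_isBout hp)) hc)
        (primrec_not hh)))
  · exact Primrec.cond (primrec_decide_eq hp (Primrec.const 28)) hh (primrec_blocked.comp hs)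
  · exact Primrec.cond (primrec_decide_eq hp (Primrec.const 30)) (primrec_or (primrec_draws hs) hh)
      (primrec_or (primrec_supported.comp hs)
        (primrec_and (primrec_decide_eq hp (Primrec.const 32)) hh))
  · exact Primrec.cond hend (Primrec.const 0) (primrec_add hp (Primrec.const 1))
  · exact Primrec.cond (primrec_or hl (primrec_and ho hr)) (primrec_mul (Primrec.const 2) hM) hM
  · exact Primrec.cond hl (primrec_add hC hM)
      (Primrec.cond (primrec_and ho (primrec_not hr)) (Primrec.const 0)
        (Primrec.cond hend (primrec_add hC (Primrec.const 1)) hC))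
  · exact Primrec.cond (primrec_decide_eq hp (Primrec.const 0))
      (Primrec.cond hc (primrec_add (primrec_streak.comp hs) (Primrec.const 1))
        (Primrec.const 0)) (primrec_streak.comp hs)

theorem primrec_next {s : α → State} {c h : α → Bool} (hs : Primrec s) (hc : Primrec c)
    (hh : Primrec h) : Primrec fun a => next (s a) (c a) (h a) :=
  Primrec.cond (primrec_synced.comp hs) (primrec_nextSynced hs hc hh)
    (primrec_nextUnsynced hs hh)

theorem primrec_coin {f : α → Fin 1 → Bool} (hf : Primrec f) : Primrec fun a => f a 0 :=
  Primrec.fin_app.comp hf (Primrec.const 0)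

theorem computablePred_status (x : Status) : ComputablePred fun s => status s = x := by
  have key : ∀ b : Bool, ComputablePred fun s : State => s.member = b := fun b =>
    (PrimrecPred.computablePred (Primrec.eq.comp primrec_member (Primrec.const b)))
  cases x with
  | inactive => exact (key false).of_eq fun s => by cases h : s.member <;> simp [status, h]
  | competing =>
    refine ((PrimrecPred.computablePred
      (Primrec.eq.comp (Primrec.const false) (Primrec.const true) :
        PrimrecPred fun _ : State => false = true))).of_eq fun s => ?_
    cases h : s.member <;> simp [status, h]
  | mis => exact (key true).of_eq fun s => by cases h : s.member <;> simp [status, h]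

end Computability

end RulerMIS

/-- Members of the tentative independent set toss coins against each other in every frame; other
processes start in frames in which no neighbour is a member and no process within distance two
objects. -/
def rulerMIS : Algorithm where
  State := RulerMIS.State
  coins := 1
  init := RulerMIS.init
  beep s c := RulerMIS.beep s (c 0)
  next s c h := RulerMIS.next s (c 0) h
  status := RulerMIS.status
  beep_computable :=
    (RulerMIS.primrec_beep Primrec.fst (RulerMIS.primrec_coin Primrec.snd)).to_comp
  next_computable :=
    (RulerMIS.primrec_next Primrec.fst (RulerMIS.primrec_coin (Primrec.fst.comp Primrec.snd))
      (Primrec.snd.comp Primrec.snd)).to_comp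
  status_computable := RulerMIS.computablePred_status

/-! ### The global clock and the announcement of its digits. -/

namespace RulerMIS

/-- The position of round `t` in its frame. -/
def ph (t : ℕ) : ℕ := (t - 74) % 36

/-- The number of the frame containing round `t`. -/
def tau (t : ℕ) : ℕ := (t - 74) / 36

/-- The first round of frame `k`. -/
def fs (k : ℕ) : ℕ := 74 + 36 * k

theorem ph_lt (t : ℕ) : ph t < 36 := Nat.mod_lt _ (by norm_num)

theorem ph_fs (k i : ℕ) (hi : i < 36) : ph (fs k + i) = i := by unfold ph fs; omega

theorem tau_fs (k i : ℕ) (hi : i < 36) : tau (fs k + i) = k := by unfold tau fs; omega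

theorem clock_succ {t : ℕ} (ht : 74 ≤ t) :
    (ph t = 35 ∧ ph (t + 1) = 0 ∧ tau (t + 1) = tau t + 1) ∨
      (ph t ≠ 35 ∧ ph (t + 1) = ph t + 1 ∧ tau (t + 1) = tau t) := by
  unfold ph tau; omega

/-- The synchronized state `s` agrees with the global clock in round `t`. -/
structure Good (s : State) (t : ℕ) : Prop where
  ge : 74 ≤ t
  phase : s.phase = ph t
  modulus : ∃ j, s.modulus = 2 ^ (j + 1)
  clock : s.clock = tau t % s.modulus
  root : s.root = true → s.clock = tau t

/-- The rounds in which synchronized processes may beep. -/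
def Loud (t : ℕ) : Prop :=
  74 ≤ t ∧ ((ph t ≤ 1 ∧ tau t % 2 = 0) ∨ (ph t % 2 = 0 ∧ 4 ≤ ph t))

theorem Good.clock_mod_two {s : State} {t : ℕ} (h : Good s t) : s.clock % 2 = tau t % 2 := by
  obtain ⟨j, hj⟩ := h.modulus
  rw [h.clock, Nat.mod_mod_of_dvd]
  rw [hj]; exact Dvd.intro_left _ rfl

/-- The threshold for objections can be computed from the local clock, yet depends only on the true
frame number and the modulus. This lets processes with different moduli agree on it. -/
theorem Good.gcd_eq {s : State} {t : ℕ} (h : Good s t) :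
    s.clock.gcd s.modulus = (tau t).gcd s.modulus := by
  rw [h.clock, ← Nat.gcd_rec, Nat.gcd_comm]

theorem Good.loud {s : State} {t : ℕ} (h : Good s t) {c : Bool} (hb : beep s c = true) :
    Loud t := by
  have h1 := h.clock_mod_two
  have h2 := h.phase
  refine ⟨h.ge, ?_⟩
  simp only [beep, isBout, Bool.and_eq_true, Bool.or_eq_true, decide_eq_true_eq] at hb
  omega

/-- The residue says that `x` has exactly `i` trailing binary zeros and that the digit after its
lowest 1 is again 1. -/
theorem eq_of_mod_eq_three {x i : ℕ} (h : x % 2 ^ (i + 2) = 3 * 2 ^ i) :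
    x = 2 ^ i * (4 * (x / 2 ^ (i + 2)) + 3) := by
  have h1 := Nat.div_add_mod x (2 ^ (i + 2))
  rw [h] at h1
  have e : 2 ^ (i + 2) = 2 ^ i * 4 := by rw [pow_add]; norm_num
  conv_lhs => rw [← h1]
  generalize x / 2 ^ (i + 2) = y
  rw [e]
  ring

/-- An announcement fixes the next binary digit of the frame number. -/
theorem Good.announces_iff {s : State} {t : ℕ} (h : Good s t) :
    announces s = true ↔
      ∃ i, 2 ^ (i + 2) ≤ s.modulus ∧ tau t % 2 ^ (i + 2) = 3 * 2 ^ i := by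
  obtain ⟨j, hj⟩ := h.modulus
  simp only [announces, Bool.and_eq_true, decide_eq_true_eq]
  constructor
  · rintro ⟨h1, h2⟩
    obtain ⟨i, -, hi⟩ := (Nat.dvd_prime_pow Nat.prime_two).1
      ((Nat.gcd_dvd_right s.clock s.modulus).trans (dvd_of_eq hj))
    rw [hi] at h1 h2
    have e : 4 * 2 ^ i = 2 ^ (i + 2) := by ring
    rw [e] at h1 h2
    refine ⟨i, h1, ?_⟩
    rw [← h2, h.clock, Nat.mod_mod_of_dvd]
    rw [hj] at h1 ⊢
    exact pow_dvd_pow 2 ((Nat.pow_le_pow_iff_right (by norm_num)).1 h1)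
  · rintro ⟨i, h1, h2⟩
    have hd : 2 ^ (i + 2) ∣ s.modulus := by
      rw [hj] at h1 ⊢
      exact pow_dvd_pow 2 ((Nat.pow_le_pow_iff_right (by norm_num)).1 h1)
    have hc : s.clock % 2 ^ (i + 2) = 3 * 2 ^ i := by
      rw [h.clock, Nat.mod_mod_of_dvd _ hd, h2]
    have hg : s.clock.gcd s.modulus = 2 ^ i := by
      obtain ⟨l, -, hl⟩ := (Nat.dvd_prime_pow Nat.prime_two).1
        ((Nat.gcd_dvd_right s.clock s.modulus).trans (dvd_of_eq hj))
      have e : s.clock = 2 ^ i * (4 * (s.clock / 2 ^ (i + 2)) + 3) := eq_of_mod_eq_three hc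
      have d1 : 2 ^ i ∣ s.clock.gcd s.modulus :=
        Nat.dvd_gcd (Dvd.intro _ e.symm) ((pow_dvd_pow 2 (by omega)).trans hd)
      rw [hl] at d1 ⊢
      have h3 : i ≤ l := (Nat.pow_dvd_pow_iff_le_right (by norm_num)).1 d1
      have h4 : ¬ i + 1 ≤ l := by
        intro h4
        have d2 : 2 ^ (i + 1) ∣ s.clock :=
          (pow_dvd_pow 2 h4).trans (hl ▸ Nat.gcd_dvd_left _ _)
        rw [e, pow_succ] at d2
        have := (Nat.mul_dvd_mul_iff_left (by positivity)).1 d2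
        omega
      have : l = i := by omega
      rw [this]
    rw [hg]
    have e : 4 * 2 ^ i = 2 ^ (i + 2) := by ring
    rw [e]
    exact ⟨h1, hc⟩

/-- A synchronized process that hears only correct processes stays synchronized. -/
theorem Good.next {s : State} {t : ℕ} (h : Good s t) {c hear : Bool}
    (hh : hear = true → ∃ s' c', Good s' t ∧ beep s' c' = true) :
    Good (nextSynced s c hear) (t + 1) := by
  obtain ⟨j, hj⟩ := h.modulus
  have hpos : 0 < s.modulus := by rw [hj]; positivity
  have hcl := h.clock
  have hlt : s.clock < s.modulus := lt_of_eq_of_lt hcl (Nat.mod_lt _ hpos)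
  have hdiv := Nat.div_add_mod (tau t) s.modulus
  rw [← hcl] at hdiv
  have hdig : learns s hear = true → tau t % (2 * s.modulus) = s.clock + s.modulus := by
    intro hl
    simp only [learns, Bool.and_eq_true, decide_eq_true_eq] at hl
    obtain ⟨⟨h34, hhear⟩, h2⟩ := hl
    obtain ⟨s', c', hs', hb⟩ := hh hhear
    have h34' : s'.phase = 34 := by rw [hs'.phase, ← h.phase, h34]
    have ha : announces s' = true := by
      simp only [beep, isBout, h34', Bool.and_eq_true, Bool.or_eq_true, decide_eq_true_eq] at hb
      simpa using hb.2
    obtain ⟨i, -, hi⟩ := hs'.announces_iff.1 ha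
    have h2j : s.clock = 2 ^ j := by
      rw [hj, pow_succ] at h2; omega
    have e1 : tau t = 2 ^ j * (2 * (tau t / s.modulus) + 1) := by
      rw [h2j] at hdiv
      rw [hj] at hdiv ⊢
      rw [pow_succ] at hdiv ⊢
      linarith
    have e2 : tau t = 2 ^ i * (4 * (tau t / 2 ^ (i + 2)) + 3) := eq_of_mod_eq_three hi
    have hij : i = j := by
      -- `e1` and `e2` both write the frame number as a power of two times an odd number, so the
      -- exponents agree: the digit announced is the one that the listener is missing.
      rcases lt_trichotomy i j with hlt | heq | hgt
      · exfalso
        have d : 2 ^ (i + 1) ∣ tau t := (pow_dvd_pow 2 hlt).trans (Dvd.intro _ e1.symm)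
        rw [e2, pow_succ] at d
        have := (Nat.mul_dvd_mul_iff_left (by positivity)).1 d
        omega
      · exact heq
      · exfalso
        have d : 2 ^ (j + 1) ∣ tau t := (pow_dvd_pow 2 hgt).trans (Dvd.intro _ e2.symm)
        rw [e1, pow_succ] at d
        have := (Nat.mul_dvd_mul_iff_left (by positivity)).1 d
        omega
    rw [hij] at hi
    rw [hj, h2j]
    have e : 2 * 2 ^ (j + 1) = 2 ^ (j + 2) := by ring
    rw [e, hi]
    ring
  have hph := h.phase
  have hge := h.ge
  have hcs := clock_succ hge
  refine ⟨by omega, ?_, ?_, ?_, ?_⟩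
  · rcases hcs with ⟨a, b, -⟩ | ⟨a, b, -⟩ <;> simp [nextSynced, hph, a, b]
  · simp only [nextSynced]
    cases learns s hear || (overflows s && s.root)
    · exact ⟨j, hj⟩
    · exact ⟨j + 1, by simp [hj, pow_succ]; ring⟩
  · cases hl : learns s hear
    · cases ho : overflows s
      · simp only [nextSynced, hl, ho, Bool.false_or, Bool.false_and, cond_false]
        rcases hcs with ⟨a, -, b⟩ | ⟨a, -, b⟩
        · have h35 : s.phase = 35 := by omega
          simp only [overflows, h35, decide_true, Bool.true_and, decide_eq_false_iff_not] at ho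
          simp only [h35, decide_true, cond_true, b]
          rw [Nat.add_mod, ← hcl]
          have h1 : 1 % s.modulus = 1 := by
            rw [hj]; exact Nat.mod_eq_of_lt (Nat.one_lt_two_pow (by omega))
          rw [h1]
          exact (Nat.mod_eq_of_lt (by omega)).symm
        · have h35 : s.phase ≠ 35 := by omega
          simp [h35, b, hcl]
      · have ho' := ho
        simp only [overflows, Bool.and_eq_true, decide_eq_true_eq] at ho'
        have b : tau (t + 1) = tau t + 1 := by omega
        cases hr : s.root
        · simp only [nextSynced, hl, ho, hr, Bool.false_or, Bool.and_false, cond_false,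
            Bool.not_false, Bool.and_true, cond_true, b]
          rw [Nat.add_mod, ← hcl]
          have h1 : 1 % s.modulus = 1 := by
            rw [hj]; exact Nat.mod_eq_of_lt (Nat.one_lt_two_pow (by omega))
          rw [h1, ho'.2, Nat.mod_self]
        · have hroot := h.root hr
          simp only [nextSynced, hl, ho, hr, Bool.false_or, Bool.and_true, cond_false,
            Bool.not_true, Bool.and_false, cond_true, b, ho'.1, decide_true]
          rw [← hroot]
          exact (Nat.mod_eq_of_lt (by omega)).symm
    · have := hdig hl
      simp only [learns, Bool.and_eq_true, decide_eq_true_eq] at hl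
      have b : tau (t + 1) = tau t := by omega
      have hl' : learns s hear = true := by simp [learns, hl]
      simp only [nextSynced, hl', Bool.true_or, cond_true, b]
      exact this.symm
  · intro hr
    have hr' : s.root = true := hr
    have hroot := h.root hr'
    cases hl : learns s hear
    · cases ho : overflows s
      · simp only [nextSynced, hl, ho, Bool.false_and, cond_false]
        rcases hcs with ⟨a, -, b⟩ | ⟨a, -, b⟩
        · have h35 : s.phase = 35 := by omega
          simp [h35, b, hroot]
        · have h35 : s.phase ≠ 35 := by omega
          simp [h35, b, hroot]
      · have ho' := ho
        simp only [overflows, Bool.and_eq_true, decide_eq_true_eq] at ho'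
        simp [nextSynced, hl, hr', ho'.1, hroot]
        omega
    -- A root never learns a digit: its clock is the frame number itself, which is below its
    -- modulus, so the next digit is 0.
    · exfalso
      have := hdig hl
      have h3 : tau t % (2 * s.modulus) = tau t := Nat.mod_eq_of_lt (by omega)
      omega

/-! ### Executions and the guardians of new processes. -/

section Run

variable {V : Type} (G : SimpleGraph V) (S : Schedule V)

/-- The state of `v` at the beginning of round `t`. -/
noncomputable def st (ω : rulerMIS.Sample V) (t : ℕ) (v : V) : State := rulerMIS.run G S ω t v

/-- The coin of `v` in round `t`. -/
def coin {V : Type} (ω : rulerMIS.Sample V) (t : ℕ) (v : V) : Bool := ω (t, v) (0 : Fin 1)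

/-- The participating node `v` beeps in round `t`. -/
def Bps (ω : rulerMIS.Sample V) (t : ℕ) (v : V) : Prop :=
  S.Active t v ∧ beep (st G S ω t v) (coin ω t v) = true

/-- A neighbour of `v` beeps in round `t`, while `v` listens. -/
def Hrs (ω : rulerMIS.Sample V) (t : ℕ) (v : V) : Prop :=
  ¬ Bps G S ω t v ∧ ∃ u, G.Adj v u ∧ Bps G S ω t u

open Classical in
/-- The bit that tells `v` in round `t` whether it heard a beep. -/
noncomputable def ear (ω : rulerMIS.Sample V) (t : ℕ) (v : V) : Bool := decide (Hrs G S ω t v)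

variable {G S}

theorem ear_iff {ω : rulerMIS.Sample V} {t : ℕ} {v : V} :
    ear G S ω t v = true ↔ Hrs G S ω t v := by
  simp [ear]

theorem st_zero (ω : rulerMIS.Sample V) (v : V) : st G S ω 0 v = init := rfl

theorem st_succ {ω : rulerMIS.Sample V} {t : ℕ} {v : V} (h : S.Active t v) :
    st G S ω (t + 1) v = next (st G S ω t v) (coin ω t v) (ear G S ω t v) :=
  if_pos h

theorem st_succ_of_not {ω : rulerMIS.Sample V} {t : ℕ} {v : V} (h : ¬ S.Active t v) :
    st G S ω (t + 1) v = init :=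
  if_neg h

theorem st_of_wake_eq {ω : rulerMIS.Sample V} {t : ℕ} {v : V} (h : S.wake v = t) :
    st G S ω t v = init := by
  cases t with
  | zero => rfl
  | succ t =>
    refine st_succ_of_not fun ha => ?_
    have := ha.1
    rw [h] at this
    exact absurd (Nat.cast_le.1 this) (by omega)

theorem active_of_le {t t' : ℕ} {v : V} (h : S.Active t' v) (hw : S.wake v ≤ (t : ℕ∞))
    (htt : t ≤ t') : S.Active t v :=
  ⟨hw, lt_of_le_of_lt (Nat.cast_le.2 htt) h.2⟩

theorem wake_eq_of_active {t : ℕ} {v : V} (h : S.Active (t + 1) v) (h' : ¬ S.Active t v) :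
    S.wake v = ((t + 1 : ℕ) : ℕ∞) := by
  by_contra hne
  have hlt : S.wake v < ((t + 1 : ℕ) : ℕ∞) := lt_of_le_of_ne h.1 hne
  obtain ⟨w, hw⟩ := ENat.ne_top_iff_exists.1 hlt.ne_top
  refine h' (active_of_le h ?_ (Nat.le_succ t))
  rw [← hw] at hlt ⊢
  exact Nat.cast_le.2 (Nat.lt_succ_iff.1 (Nat.cast_lt.1 hlt))

theorem exists_wake {t : ℕ} {v : V} (h : S.Active t v) : ∃ w : ℕ, S.wake v = w ∧ w ≤ t := by
  obtain ⟨w, hw⟩ := ENat.ne_top_iff_exists.1 (lt_of_le_of_lt h.1 (ENat.natCast_lt_top t)).ne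
  exact ⟨w, hw.symm, Nat.cast_le.1 (hw ▸ h.1)⟩

theorem old_iff {δ t w : ℕ} {v : V} (h : S.wake v = w) : S.Old δ t v ↔ w + δ ≤ t := by
  unfold Schedule.Old
  rw [h]
  norm_cast

/-- An old neighbour of a new process participates until that process is old itself. -/
theorem exists_guardian {δ : ℕ} (hS : S.IsSimple G δ) {v : V} {w t : ℕ} (hw : S.wake v = w)
    (h0 : 0 < w) (ht : w ≤ t) (ha : S.Active t v) (hδ : t < w + δ) :
    ∃ (x : V) (wx : ℕ), G.Adj v x ∧ S.wake x = wx ∧ wx + δ ≤ w ∧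
      ∀ r, w ≤ r → r ≤ t → S.Active r x := by
  have hv : ∀ r, w ≤ r → r ≤ t → S.Active r v := fun r h1 h2 =>
    active_of_le ha (by rw [hw]; exact Nat.cast_le.2 h1) h2
  obtain ⟨x, hx, hxa, hxo⟩ := hS.wake_near_old w v h0 hw (hv w le_rfl ht)
  obtain ⟨wx, hwx, -⟩ := exists_wake hxa
  refine ⟨x, wx, hx, hwx, (old_iff hwx).1 hxo, fun r h1 h2 => ?_⟩
  induction r, h1 using Nat.le_induction with
  | base => exact hxa
  | succ r h1 ih =>
    by_contra hc
    -- If `x` crashed now, its neighbour `v` would have to be old at round `r + 1`, but `r + 1 ≤ t <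
    -- w + δ`.
    have := (old_iff hw).1
      (hS.crash_among_old r x (ih (by omega)) hc v hx.symm (hv r h1 (by omega)))
    omega

end Run

end RulerMIS

/-! ### Synchronization with the clock and learning of its digits. -/

namespace RulerMIS

variable {V : Type} {G : SimpleGraph V} {S : Schedule V}

/-- Invariant of the participating process `v` in round `t`: its view of the global clock is correct,
or it has been listening since it was woken up. -/
def SInv (G : SimpleGraph V) (S : Schedule V) (ω : rulerMIS.Sample V) (t : ℕ) (v : V) : Prop :=
  ((st G S ω t v).synced = true → Good (st G S ω t v) t) ∧
    ((st G S ω t v).synced = false → (st G S ω t v).member = false ∧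
      S.wake v + ((st G S ω t v).clock : ℕ∞) = t ∧ (st G S ω t v).clock ≤ 73 ∧
      ((st G S ω t v).heard = true → 1 ≤ t ∧ Loud (t - 1)))

theorem synced_of_beep {s : State} {c : Bool} (h : beep s c = true) : s.synced = true := by
  simp only [beep, Bool.and_eq_true] at h
  exact h.1

theorem good_of_bps {ω : rulerMIS.Sample V} {t : ℕ} {u : V}
    (hI : ∀ u, S.Active t u → SInv G S ω t u) (h : Bps G S ω t u) :
    Good (st G S ω t u) t :=
  (hI u h.1).1 (synced_of_beep h.2)

theorem loud_of_hrs {ω : rulerMIS.Sample V} {t : ℕ} {v : V}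
    (hI : ∀ u, S.Active t u → SInv G S ω t u) (h : Hrs G S ω t v) : Loud t := by
  obtain ⟨-, u, -, hu⟩ := h
  exact (good_of_bps hI hu).loud hu.2

theorem synced_succ {ω : rulerMIS.Sample V} {t : ℕ} {v : V} (ha : S.Active t v)
    (h : (st G S ω t v).synced = true) : (st G S ω (t + 1) v).synced = true := by
  rw [st_succ ha, next, h]
  rfl

theorem synced_of_le {ω : rulerMIS.Sample V} {r t : ℕ} {v : V} (hr : S.Active r v)
    (ha : S.Active t v) (hrt : r ≤ t) (h : (st G S ω r v).synced = true) :
    (st G S ω t v).synced = true := by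
  induction t, hrt using Nat.le_induction with
  | base => exact h
  | succ t hrt ih =>
    have := active_of_le ha (hr.1.trans (Nat.cast_le.2 hrt)) (Nat.le_succ t)
    exact synced_succ this (ih this)

theorem beep_header {s : State} {t : ℕ} (h : Good s t) (hs : s.synced = true) (hp : ph t ≤ 1)
    (ht : tau t % 2 = 0) (c : Bool) : beep s c = true := by
  have h1 := h.phase
  have h2 := h.clock_mod_two
  simp [beep, hs, h1, hp, h2, ht]

theorem not_beep_of_not_synced {s : State} (h : s.synced = false) (c : Bool) :
    beep s c = false := by
  simp [beep, h]

/-- Headers are sent in every second frame, so any window of this length contains the first two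
rounds of an even frame. -/
theorem exists_header {w : ℕ} (hw : 74 ≤ w) :
    ∃ t, w ≤ t ∧ t + 1 ≤ w + 72 ∧ ph t = 0 ∧ ph (t + 1) = 1 ∧ tau t % 2 = 0 ∧
      tau (t + 1) % 2 = 0 := by
  refine ⟨74 + 72 * ((w - 74 + 71) / 72), ?_⟩
  unfold ph tau
  omega

/-- A process that was woken up after round `0` hears a header before it gives up. -/
theorem clock_lt_of_wake_pos {δ : ℕ} (hS : S.IsSimple G δ) (hδ : 74 ≤ δ) {ω : rulerMIS.Sample V}
    {t : ℕ} {v : V} (hI : ∀ r ≤ t, ∀ u, S.Active r u → SInv G S ω r u) {w : ℕ}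
    (hw : S.wake v = w) (h0 : 0 < w) (ha : S.Active t v)
    (hs : (st G S ω t v).synced = false) : t < w + 73 := by
  by_contra hlt
  push Not at hlt
  have hwt : S.Active (w + 73) v :=
    active_of_le ha (by rw [hw]; exact Nat.cast_le.2 (by omega)) hlt
  obtain ⟨x, wx, hadj, hwx, hxw, hx⟩ :=
    exists_guardian hS hw h0 (by omega : w ≤ w + 73) hwt (by omega)
  have hvact : ∀ r, w ≤ r → r ≤ w + 73 → S.Active r v := fun r h1 h2 =>
    active_of_le hwt (by rw [hw]; exact Nat.cast_le.2 h1) h2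
  have hvs : ∀ r, w ≤ r → r ≤ w + 73 → (st G S ω r v).synced = false := by
    intro r h1 h2
    by_contra hc
    have := synced_of_le (hvact r h1 h2) ha (by omega) (by simpa using hc)
    rw [hs] at this
    exact absurd this (by decide)
  have hxs : ∀ r, w ≤ r → r ≤ w + 73 → (st G S ω r x).synced = true := by
    intro r h1 h2
    by_contra hc
    have h3 := (hI r (by omega) x (hx r h1 h2)).2 (by simpa using hc)
    have h4 := h3.2.1
    rw [hwx] at h4
    norm_cast at h4
    have := h3.2.2.1
    omega
  obtain ⟨t₀, h1, h2, p0, p1, q0, q1⟩ := exists_header (w := w) (by omega)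
  -- The guardian is at least 74 rounds old, hence synchronized, and sends the header, whereas the
  -- unsynchronized `v` listens.
  have hbeep : ∀ r, w ≤ r → r ≤ w + 73 → ph r ≤ 1 → tau r % 2 = 0 → Hrs G S ω r v := by
    intro r h1 h2 hp hq
    refine ⟨fun hb => ?_, x, hadj, hx r h1 h2, ?_⟩
    · have := not_beep_of_not_synced (hvs r h1 h2) (coin ω r v)
      rw [hb.2] at this
      exact absurd this (by decide)
    · exact beep_header ((hI r (by omega) x (hx r h1 h2)).1 (hxs r h1 h2)) (hxs r h1 h2) hp hq _
  have e1 := st_succ (G := G) (ω := ω) (hvact t₀ h1 (by omega))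
  have e2 := st_succ (G := G) (ω := ω) (hvact (t₀ + 1) (by omega) (by omega))
  have f1 := hvs (t₀ + 1) (by omega) (by omega)
  have f2 := hvs (t₀ + 1 + 1) (by omega) (by omega)
  have hh : (st G S ω (t₀ + 1) v).heard = true := by
    have hn := hvs t₀ h1 (by omega)
    have hr := hbeep t₀ h1 (by omega) (by omega) q0
    rw [e1, next, hn] at f1 ⊢
    simp only [nextUnsynced, ear_iff.2 hr, cond_false, Bool.and_true] at f1 ⊢
    cases h3 : (st G S ω t₀ v).heard
    · simp only [h3, cond_false] at f1 ⊢
      cases h4 : decide ((st G S ω t₀ v).clock = 73)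
      · rfl
      · simp [h4, started] at f1
    · simp [h3, joined] at f1
  have hr := hbeep (t₀ + 1) (by omega) (by omega) (by omega) q1
  rw [e2, next, f1] at f2
  simp [nextUnsynced, ear_iff.2 hr, hh, joined] at f2

/-- The clock invariant holds at all times. -/
theorem sInv {δ : ℕ} (hS : S.IsSimple G δ) (hδ : 74 ≤ δ) (ω : rulerMIS.Sample V) (t : ℕ) :
    ∀ v, S.Active t v → SInv G S ω t v := by
  induction t using Nat.strong_induction_on with
  | _ t ih =>
  intro v hv
  by_cases hnew : S.wake v = t
  · rw [SInv, st_of_wake_eq hnew]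
    refine ⟨fun h => absurd h (by decide), fun _ => ⟨rfl, ?_, by decide, fun h => absurd h
      (by decide)⟩⟩
    rw [hnew]
    simp [init]
  obtain ⟨t, rfl⟩ : ∃ r, t = r + 1 := by
    refine ⟨t - 1, ?_⟩
    obtain ⟨w, hw, hwt⟩ := exists_wake hv
    have : w ≠ t := fun h => hnew (by rw [hw, h])
    omega
  have ha : S.Active t v := by
    by_contra hc
    exact hnew (wake_eq_of_active hv hc)
  have hI := ih t (Nat.lt_succ_self t)
  have hIv := hI v ha
  rw [SInv, st_succ ha, next]
  cases hs : (st G S ω t v).synced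
  · obtain ⟨-, h2, h3, h4⟩ := hIv.2 hs
    simp only [cond_false]
    unfold nextUnsynced
    cases h5 : ((st G S ω t v).heard && ear G S ω t v) <;> simp only [cond_false, cond_true]
    · cases h6 : decide ((st G S ω t v).clock = 73) <;> simp only [cond_false, cond_true]
      · refine ⟨fun h => absurd h (by simp), fun _ => ⟨trivial, ?_, ?_, fun h => ?_⟩⟩
        · push_cast
          rw [← add_assoc, h2]
        · simp only [decide_eq_false_iff_not] at h6
          omega
        · exact ⟨by omega, loud_of_hrs hI (ear_iff.1 h)⟩
      · simp only [decide_eq_true_eq] at h6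
        refine ⟨fun _ => ?_, fun h => absurd h (by simp [started])⟩
        obtain ⟨w, hw, hwt⟩ := exists_wake ha
        rw [hw, h6] at h2
        norm_cast at h2
        -- A process woken later would have heard a header before its clock reached 73. Hence only
        -- processes woken in round 0 become roots, all of them in the same round 74.
        have hw0 : w = 0 := by
          by_contra hne
          have := clock_lt_of_wake_pos hS hδ (fun r hr u hu => ih r (by omega) u hu) hw
            (Nat.pos_of_ne_zero hne) ha hs
          omega
        have ht : t = 73 := by omega
        subst ht
        exact ⟨by norm_num, rfl, ⟨0, rfl⟩, rfl, fun _ => rfl⟩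
    · simp only [Bool.and_eq_true, ear_iff] at h5
      obtain ⟨h7, h8⟩ := h4 h5.1
      have h9 := loud_of_hrs hI h5.2
      refine ⟨fun _ => ?_, fun h => absurd h (by simp [joined])⟩
      -- Apart from headers, beeps occur only in even phases from 4 to 34. Two consecutive loud
      -- rounds are therefore phases 0 and 1 of an even frame.
      have key : ph (t + 1) = 2 ∧ tau (t + 1) % 2 = 0 ∧ 74 ≤ t + 1 := by
        unfold Loud ph tau at *
        omega
      exact ⟨key.2.2, key.1.symm, ⟨0, rfl⟩, key.2.1.symm, fun h => absurd h (by decide)⟩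
  · refine ⟨fun _ => ?_, fun h => absurd h (by simp [nextSynced])⟩
    refine (hIv.1 hs).next fun h => ?_
    obtain ⟨-, u, -, hu⟩ := ear_iff.1 h
    exact ⟨_, _, good_of_bps hI hu, hu.2⟩

theorem good_of_synced {δ : ℕ} (hS : S.IsSimple G δ) (hδ : 74 ≤ δ)
    {ω : rulerMIS.Sample V} {t : ℕ} {v : V} (ha : S.Active t v)
    (hs : (st G S ω t v).synced = true) : Good (st G S ω t v) t :=
  (sInv hS hδ ω t v ha).1 hs

theorem synced_of_member {δ : ℕ} (hS : S.IsSimple G δ) (hδ : 74 ≤ δ)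
    {ω : rulerMIS.Sample V} {t : ℕ} {v : V} (ha : S.Active t v)
    (hs : (st G S ω t v).member = true) : (st G S ω t v).synced = true := by
  by_contra hc
  have := ((sInv hS hδ ω t v ha).2 (by simpa using hc)).1
  rw [hs] at this
  exact absurd this (by decide)

theorem synced_of_age {δ : ℕ} (hS : S.IsSimple G δ) (hδ : 74 ≤ δ)
    {ω : rulerMIS.Sample V} {t w : ℕ} {v : V} (ha : S.Active t v) (hw : S.wake v = w)
    (h : w + 74 ≤ t) : (st G S ω t v).synced = true := by
  by_contra hc
  have h1 := (sInv hS hδ ω t v ha).2 (by simpa using hc)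
  have h2 := h1.2.1
  rw [hw] at h2
  norm_cast at h2
  have := h1.2.2.1
  omega

/-- Before round 74 nobody beeps, so a process woken in round 0 cannot join an existing clock and
has to start its own. -/
theorem root_of_wake_zero {δ : ℕ} (hS : S.IsSimple G δ) (hδ : 74 ≤ δ)
    {ω : rulerMIS.Sample V} {v : V} (hw : S.wake v = 0) (t : ℕ) (ha : S.Active t v)
    (hs : (st G S ω t v).synced = true) : (st G S ω t v).root = true := by
  induction t with
  | zero =>
    rw [st_zero] at hs
    exact absurd hs (by decide)
  | succ t ih =>
    have ha' : S.Active t v := active_of_le ha (by rw [hw]; exact zero_le) (Nat.le_succ t)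
    rw [st_succ ha', next] at hs ⊢
    cases hs' : (st G S ω t v).synced
    · rw [hs'] at hs
      simp only [cond_false, nextUnsynced] at hs ⊢
      cases h5 : ((st G S ω t v).heard && ear G S ω t v)
      · cases h6 : decide ((st G S ω t v).clock = 73)
        · simp [h5, h6] at hs
        · rfl
      · exfalso
        simp only [Bool.and_eq_true, ear_iff] at h5
        obtain ⟨-, h2, h3, -⟩ := (sInv hS hδ ω t v ha').2 hs'
        have h9 := (loud_of_hrs (sInv hS hδ ω t) h5.2).1
        rw [hw, zero_add] at h2
        norm_cast at h2
        omega
    · exact ih ha' hs'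

theorem modulus_le_succ {ω : rulerMIS.Sample V} {t : ℕ} {v : V} (ha : S.Active t v)
    (hs : (st G S ω t v).synced = true) :
    (st G S ω t v).modulus ≤ (st G S ω (t + 1) v).modulus := by
  rw [st_succ ha, next, hs]
  simp only [cond_true, nextSynced]
  cases learns (st G S ω t v) (ear G S ω t v) ||
    (overflows (st G S ω t v) && (st G S ω t v).root)
  · simp
  · simp only [cond_true]
    omega

theorem modulus_mono {ω : rulerMIS.Sample V} {r t : ℕ} {v : V}
    (hr : S.Active r v) (ha : S.Active t v) (hrt : r ≤ t)
    (hs : (st G S ω r v).synced = true) :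
    (st G S ω r v).modulus ≤ (st G S ω t v).modulus := by
  induction t, hrt using Nat.le_induction with
  | base => exact le_rfl
  | succ t hrt ih =>
    have := active_of_le ha (hr.1.trans (Nat.cast_le.2 hrt)) (Nat.le_succ t)
    exact (ih this).trans (modulus_le_succ this (synced_of_le hr this hrt hs))

theorem exists_mod_eq (a : ℕ) {M c : ℕ} (hc : c < M) : ∃ k, a ≤ k ∧ k < a + M ∧ k % M = c := by
  refine ⟨a + (c + (M - a % M)) % M, by omega, ?_, ?_⟩
  · have := Nat.mod_lt (c + (M - a % M)) (by omega : 0 < M)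
    omega
  · have h1 := Nat.mod_lt a (by omega : 0 < M)
    have h2 := Nat.div_add_mod a M
    rw [Nat.add_mod_mod]
    have e : a + (c + (M - a % M)) = c + M * (a / M + 1) := by
      rw [mul_add, mul_one]; omega
    rw [e, Nat.add_mul_mod_self_left, Nat.mod_eq_of_lt hc]

/-- The age at which a process knows at least `J` binary digits of the frame number. -/
def matureAge (J : ℕ) : ℕ := 74 + 36 * 2 ^ (J + 2)

/-- Old processes know the frame number modulo `2 ^ J`. -/
theorem le_modulus {δ : ℕ} (hS : S.IsSimple G δ) (hδ : 74 ≤ δ)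
    {ω : rulerMIS.Sample V} {J : ℕ} (hJ : matureAge J ≤ δ) (t : ℕ) :
    ∀ {v : V} {w : ℕ}, S.Active t v → S.wake v = w → w + matureAge J ≤ t →
      2 ^ J ≤ (st G S ω t v).modulus := by
  induction t using Nat.strong_induction_on with
  | _ t ih =>
  intro v w ha hw ht
  rcases Nat.eq_zero_or_pos w with rfl | h0
  · have hs : (st G S ω t v).synced = true :=
      synced_of_age hS hδ ha hw (by unfold matureAge at ht; omega)
    have hg := good_of_synced hS hδ ha hs
    obtain ⟨j, hj⟩ := hg.modulus
    -- A root knows the whole frame number, so its modulus exceeds it, and at this age the frame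
    -- number is at least `2 ^ J`.
    have hlt : (st G S ω t v).clock < (st G S ω t v).modulus := by
      rw [hg.clock]; exact Nat.mod_lt _ (by rw [hj]; positivity)
    rw [hg.root (root_of_wake_zero hS hδ (by simpa using hw) t ha hs)] at hlt
    have : 2 ^ (J + 2) = 4 * 2 ^ J := by ring
    unfold tau matureAge at *
    omega
  · have hvact : ∀ r, w ≤ r → r ≤ t → S.Active r v := fun r h1 h2 =>
      active_of_le ha (by rw [hw]; exact Nat.cast_le.2 h1) h2
    have hvs : ∀ r, w + 74 ≤ r → r ≤ t → (st G S ω r v).synced = true := fun r h1 h2 =>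
      synced_of_age hS hδ (hvact r (by omega) h2) hw h1
    have hvg : ∀ r, w + 74 ≤ r → r ≤ t → Good (st G S ω r v) r := fun r h1 h2 =>
      good_of_synced hS hδ (hvact r (by omega) h2) (hvs r h1 h2)
    have hage : 74 ≤ matureAge J := by unfold matureAge; omega
    obtain ⟨x, wx, hadj, hwx, hxw, hx⟩ := exists_guardian hS hw h0
      (by omega : w ≤ w + matureAge J - 1) (hvact _ (by omega) (by omega)) (by omega)
    have hxM : ∀ r, w ≤ r → r ≤ w + matureAge J - 1 → 2 ^ J ≤ (st G S ω r x).modulus :=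
      fun r h1 h2 => ih r (by omega) (hx r h1 h2) hwx (by omega)
    have hxs : ∀ r, w ≤ r → r ≤ w + matureAge J - 1 → (st G S ω r x).synced = true :=
      fun r h1 h2 => synced_of_age hS hδ (hx r h1 h2) hwx (by omega)
    have main : ∀ i, i ≤ J → 2 ^ i ≤ (st G S ω (w + matureAge i) v).modulus := by
      intro i hi
      have hmono : ∀ i ≤ J, matureAge i ≤ matureAge J := fun i hi => by
        have := Nat.pow_le_pow_right (n := 2) (by norm_num) (by omega : i + 2 ≤ J + 2)
        unfold matureAge; omega
      induction i with
      | zero =>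
        have h74 : 74 ≤ matureAge 0 := by unfold matureAge; omega
        obtain ⟨j, hj⟩ := (hvg (w + matureAge 0) (by omega)
          (by have := hmono 0 (by omega); omega)).modulus
        rw [hj]
        exact Nat.one_le_two_pow
      | succ i hi' =>
        have hb := hmono i (by omega)
        have hb' := hmono (i + 1) hi
        have h74 : 74 ≤ matureAge i := by unfold matureAge; omega
        have hstep : matureAge (i + 1) = matureAge i + 36 * 2 ^ (i + 2) := by
          unfold matureAge
          have : 2 ^ (i + 1 + 2) = 2 ^ (i + 2) + 2 ^ (i + 2) := by ring
          omega
        -- Every modulus is at least 2, so the first digit is free. From here on the modulus `2 ^ (i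
        -- + 1)` has to be doubled; if that failed, it would be constant over the whole interval
        -- (`hmod`).
        rcases i with _ | i
        · obtain ⟨j, hj⟩ := (hvg (w + matureAge (0 + 1)) (by omega) (by omega)).modulus
          rw [hj]
          exact Nat.pow_le_pow_right (by norm_num) (by omega)
        by_contra hlt
        push Not at hlt
        set r₀ := w + matureAge (i + 1) with hr₀
        have hmod : ∀ r, r₀ ≤ r → r ≤ w + matureAge (i + 1 + 1) →
            (st G S ω r v).modulus = 2 ^ (i + 1) := by
          intro r h1 h2
          obtain ⟨j, hj⟩ := (hvg r (by omega) (by omega)).modulus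
          have l1 := modulus_mono (hvact r₀ (by omega) (by omega))
            (hvact r (by omega) (by omega)) h1 (hvs r₀ (by omega) (by omega)) (ω := ω)
          have l2 := modulus_mono (hvact r (by omega) (by omega))
            (hvact (w + matureAge (i + 1 + 1)) (by omega) (by omega)) h2
            (hvs r (by omega) (by omega)) (ω := ω)
          have l3 := (hi' (by omega)).trans l1
          have l4 := lt_of_le_of_lt l2 hlt
          rw [hj] at l3 l4 ⊢
          have a1 := (Nat.pow_le_pow_iff_right (by norm_num : 1 < 2)).1 l3
          have a2 := (Nat.pow_lt_pow_iff_right (by norm_num : 1 < 2)).1 l4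
          congr 1
          omega
        have hp1 : 2 ^ (i + 1) = 2 * 2 ^ i := by ring
        have hp2 : 2 ^ (i + 2) = 4 * 2 ^ i := by ring
        have hp3 : 2 ^ (i + 1 + 2) = 8 * 2 ^ i := by ring
        have hpos : 1 ≤ 2 ^ i := Nat.one_le_two_pow
        -- In such a frame `v` has clock `2 ^ i`, half of its modulus, and the missing digit is 1,
        -- so that the guardian announces it. The interval is long enough to contain one.
        obtain ⟨k, k1, k2, k3⟩ := exists_mod_eq (tau r₀ + 1) (M := 2 ^ (i + 2)) (c := 3 * 2 ^ i)
          (by omega)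
        have hr : r₀ ≤ fs k + 34 ∧ fs k + 35 ≤ w + matureAge (i + 1 + 1) := by
          have h5 : r₀ < 74 + 36 * (tau r₀ + 1) ∧ 74 + 36 * tau r₀ ≤ r₀ := by
            unfold tau; omega
          unfold fs
          constructor
          · omega
          · omega
        have hph := ph_fs k 34 (by norm_num)
        have htau := tau_fs k 34 (by norm_num)
        set r := fs k + 34 with hrdef
        have hgv := hvg r (by omega) (by omega)
        have hMv := hmod r hr.1 (by omega)
        have hgx := good_of_synced hS hδ (hx r (by omega) (by omega))
          (hxs r (by omega) (by omega)) (ω := ω)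
        have hcv : (st G S ω r v).clock = 2 ^ i := by
          rw [hgv.clock, hMv, htau]
          have e : k = 2 ^ (i + 1) * (2 * (k / 2 ^ (i + 2)) + 1) + 2 ^ i := by
            have := eq_of_mod_eq_three k3
            conv_lhs => rw [this]
            rw [hp1]
            ring
          rw [e, Nat.mul_add_mod, Nat.mod_eq_of_lt (by omega)]
        -- A beeping process hears nothing, so `v` must stay silent. It does, as it knows one digit
        -- too few to make this announcement.
        have hnb : announces (st G S ω r v) ≠ true := by
          rw [ne_eq, hgv.announces_iff]
          rintro ⟨l, l1, l2⟩
          rw [hMv] at l1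
          have l3 := (Nat.pow_le_pow_iff_right (by norm_num : 1 < 2)).1 l1
          rw [htau] at l2
          have e1 := eq_of_mod_eq_three l2
          have e2 := eq_of_mod_eq_three k3
          have d : 2 ^ (l + 1) ∣ k := (pow_dvd_pow 2 (by omega)).trans (Dvd.intro _ e2.symm)
          rw [e1, pow_succ] at d
          have := (Nat.mul_dvd_mul_iff_left (by positivity)).1 d
          omega
        have hhear : Hrs G S ω r v := by
          refine ⟨fun hb => hnb ?_, x, hadj, hx r (by omega) (by omega), ?_⟩
          · have := hb.2
            simpa [beep, isBout, hgv.phase, hph, hvs r (by omega) (by omega)] using this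
          · have : announces (st G S ω r x) = true := by
              refine hgx.announces_iff.2 ⟨i, ?_, by rw [htau, k3]⟩
              refine le_trans ?_ (hxM r (by omega) (by omega))
              exact Nat.pow_le_pow_right (by norm_num) (by omega)
            simp [beep, hxs r (by omega) (by omega), hgx.phase, hph, this]
        have hlearn : learns (st G S ω r v) (ear G S ω r v) = true := by
          simp [learns, hgv.phase, hph, ear_iff.2 hhear, hcv, hMv, hp1]
        have hfin := hmod (r + 1) (by omega) (by omega)
        rw [st_succ (hvact r (by omega) (by omega)), next, hvs r (by omega) (by omega)] at hfin
        simp only [cond_true, nextSynced, hlearn, Bool.true_or, hMv] at hfin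
        omega
    exact (main J le_rfl).trans (modulus_mono (hvact _ (by omega) (by omega)) ha ht
      (hvs _ (by omega) ht))

end RulerMIS

/-! ### Membership, blocking and the persistence of stability. -/

namespace RulerMIS

variable {V : Type} {G : SimpleGraph V} {S : Schedule V}

theorem beep_of_isBout {s : State} {c : Bool} (h : isBout s.phase = true) :
    beep s c = (s.synced && s.member && c) := by
  have h1 := h
  simp only [isBout, Bool.and_eq_true, decide_eq_true_eq] at h1
  have h2 : ¬ s.phase ≤ 1 := by omega
  have h3 : s.phase ≠ 28 := by omega
  have h4 : s.phase ≠ 30 := by omega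
  have h5 : s.phase ≠ 32 := by omega
  have h6 : s.phase ≠ 34 := by omega
  simp [beep, h, h2, h3, h4, h5, h6, Bool.and_assoc]

theorem beep_of_phase_28 {s : State} {c : Bool} (h : s.phase = 28) :
    beep s c = (s.synced && s.member) := by
  simp [beep, h, isBout]

theorem beep_of_phase_30 {s : State} {c : Bool} (h : s.phase = 30) :
    beep s c = (s.synced && draws s) := by
  simp [beep, h, isBout]

theorem beep_of_phase_32 {s : State} {c : Bool} (h : s.phase = 32) :
    beep s c = (s.synced && s.supported) := by
  simp [beep, h, isBout]

theorem status_eq_mis {s : State} : status s = Status.mis ↔ s.member = true := by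
  cases h : s.member <;> simp [status, h]

theorem status_eq_inactive {s : State} : status s = Status.inactive ↔ s.member = false := by
  cases h : s.member <;> simp [status, h]

section Step

variable {δ : ℕ} {ω : rulerMIS.Sample V} {t : ℕ} {v : V}

theorem member_succ (ha : S.Active t v) (hg : Good (st G S ω t v) t)
    (hs : (st G S ω t v).synced = true) :
    (st G S ω (t + 1) v).member =
      bif decide (ph t = 35) then (st G S ω t v).member ||
        (!(st G S ω t v).blocked && !(st G S ω t v).supported)
      else (st G S ω t v).member && (!isBout (ph t) || coin ω t v || !ear G S ω t v) := by
  rw [st_succ ha, next, hs, ← hg.phase]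
  rfl

theorem blocked_succ (ha : S.Active t v) (hg : Good (st G S ω t v) t)
    (hs : (st G S ω t v).synced = true) :
    (st G S ω (t + 1) v).blocked =
      bif decide (ph t = 28) then ear G S ω t v else (st G S ω t v).blocked := by
  rw [st_succ ha, next, hs, ← hg.phase]
  rfl

theorem supported_succ (ha : S.Active t v) (hg : Good (st G S ω t v) t)
    (hs : (st G S ω t v).synced = true) :
    (st G S ω (t + 1) v).supported =
      bif decide (ph t = 30) then draws (st G S ω t v) || ear G S ω t v
      else (st G S ω t v).supported || (decide (ph t = 32) && ear G S ω t v) := by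
  rw [st_succ ha, next, hs, ← hg.phase]
  rfl

theorem streak_succ (ha : S.Active t v) (hg : Good (st G S ω t v) t)
    (hs : (st G S ω t v).synced = true) :
    (st G S ω (t + 1) v).streak =
      bif decide (ph t = 0) then (bif coin ω t v then (st G S ω t v).streak + 1 else 0)
      else (st G S ω t v).streak := by
  rw [st_succ ha, next, hs, ← hg.phase]
  rfl

theorem member_succ_of_not_synced (ha : S.Active t v) (hs : (st G S ω t v).synced = false) :
    (st G S ω (t + 1) v).member = false := by
  rw [st_succ ha, next, hs, cond_false, nextUnsynced]
  cases (st G S ω t v).heard && ear G S ω t v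
  · cases decide ((st G S ω t v).clock = 73) <;> rfl
  · rfl

/-- A process becomes synchronized only by entering phase 0 (as a root) or phase 2 (after a header).
Consequently nobody enters between the members' beep in phase 28 and the end of the frame. -/
theorem synced_pred (hS : S.IsSimple G δ) (hδ : 74 ≤ δ) (ha : S.Active (t + 1) v)
    (hs : (st G S ω (t + 1) v).synced = true) (h0 : ph (t + 1) ≠ 0) (h2 : ph (t + 1) ≠ 2) :
    S.Active t v ∧ (st G S ω t v).synced = true := by
  have hp := (good_of_synced hS hδ ha hs).phase
  have ha' : S.Active t v := by
    by_contra hc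
    rw [st_succ_of_not hc] at hs
    simp [init] at hs
  refine ⟨ha', ?_⟩
  by_contra hc
  have hc' : (st G S ω t v).synced = false := by simpa using hc
  rw [st_succ ha', next, hc', cond_false, nextUnsynced] at hp hs
  cases h5 : ((st G S ω t v).heard && ear G S ω t v)
  · rw [h5] at hp hs
    cases h6 : decide ((st G S ω t v).clock = 73)
    · simp [h6] at hs
    · rw [h6] at hp
      exact h0 hp.symm
  · rw [h5] at hp
    exact h2 hp.symm

/-- After the members have beeped, every synchronized neighbour of a member is blocked or a
member itself. -/
theorem member_or_blocked (hS : S.IsSimple G δ) (hδ : 74 ≤ δ) (ω : rulerMIS.Sample V) (t : ℕ)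
    (ht : 29 ≤ ph t) {u x : V} (hux : G.Adj x u) (hu : S.Active t u) (hx : S.Active t x)
    (hm : (st G S ω t u).member = true) (hs : (st G S ω t x).synced = true) :
    (st G S ω t x).member = true ∨ (st G S ω t x).blocked = true := by
  induction t with
  | zero => exact absurd ht (by decide)
  | succ t ih =>
    have hus := synced_of_member hS hδ hu hm
    obtain ⟨hu', hus'⟩ := synced_pred hS hδ hu hus (by omega) (by omega)
    obtain ⟨hx', hxs'⟩ := synced_pred hS hδ hx hs (by omega) (by omega)
    have hgu := good_of_synced hS hδ hu' hus'
    have hgx := good_of_synced hS hδ hx' hxs'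
    have hph : 28 ≤ ph t ∧ ph t < 35 := by
      have := clock_succ hgu.ge
      have := ph_lt (t + 1)
      omega
    have hb : isBout (ph t) = false := by
      simp [isBout]; omega
    have h35 : decide (ph t = 35) = false := by simp; omega
    rw [member_succ hu' hgu hus', h35, hb] at hm
    rw [member_succ hx' hgx hxs', blocked_succ hx' hgx hxs', h35, hb]
    simp only [cond_false, Bool.not_false, Bool.true_or, Bool.and_true] at hm ⊢
    by_cases h28 : ph t = 28
    · by_cases hxm : (st G S ω t x).member = true
      · exact Or.inl hxm
      · right
        simp only [h28, decide_true, cond_true]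
        rw [ear_iff]
        refine ⟨fun hb => hxm ?_, u, hux, hu', ?_⟩
        · have := hb.2
          rw [beep_of_phase_28 (hgx.phase.trans h28)] at this
          exact (Bool.and_eq_true_iff.1 this).2
        · rw [beep_of_phase_28 (hgu.phase.trans h28), hus', hm]
          rfl
    · simp only [h28, decide_false, cond_false]
      exact ih (by omega) hu' hx' hm hxs'

end Step

theorem hasStatus_mis {ω : rulerMIS.Sample V} {t : ℕ} {v : V} :
    rulerMIS.HasStatus G S ω t v Status.mis ↔
      S.Active t v ∧ (st G S ω t v).member = true :=
  and_congr_right fun _ => status_eq_mis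

theorem hasStatus_inactive {ω : rulerMIS.Sample V} {t : ℕ} {v : V} :
    rulerMIS.HasStatus G S ω t v Status.inactive ↔
      S.Active t v ∧ (st G S ω t v).member = false :=
  and_congr_right fun _ => status_eq_inactive

theorem stableMIS_iff {ω : rulerMIS.Sample V} {t : ℕ} {v : V} :
    rulerMIS.StableMIS G S ω t v ↔ S.Active t v ∧ (st G S ω t v).member = true ∧
      ∀ u, G.Adj v u → S.Active t u → (st G S ω t u).member = false := by
  unfold Algorithm.StableMIS
  rw [hasStatus_mis, and_assoc]
  refine and_congr_right fun _ => and_congr_right fun _ => forall_congr' fun u =>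
    forall_congr' fun _ => forall_congr' fun hu => ?_
  rw [hasStatus_inactive]
  exact and_iff_right hu

/-- A stable member stays stable as long as it participates. -/
theorem stableMIS_succ {δ : ℕ} (hS : S.IsSimple G δ) (hδ : 74 ≤ δ) {ω : rulerMIS.Sample V}
    {t : ℕ} {v : V} (h : rulerMIS.StableMIS G S ω t v) (ha : S.Active (t + 1) v) :
    rulerMIS.StableMIS G S ω (t + 1) v := by
  rw [stableMIS_iff] at h ⊢
  obtain ⟨hv, hm, hn⟩ := h
  have hvs := synced_of_member hS hδ hv hm
  have hvg := good_of_synced hS hδ hv hvs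
  refine ⟨ha, ?_, fun u hvu hu => ?_⟩
  · rw [member_succ hv hvg hvs, hm]
    by_cases h35 : ph t = 35
    · simp [h35]
    · simp only [h35, decide_false, cond_false, Bool.true_and]
      by_cases hb : isBout (ph t) = true
      · suffices ear G S ω t v = false by simp [this]
        rw [← Bool.not_eq_true, ear_iff]
        rintro ⟨-, u, hvu, hu, hbeep⟩
        have hug := good_of_synced hS hδ hu (synced_of_beep hbeep)
        rw [beep_of_isBout (by rw [hug.phase, hb]), hn u hvu hu] at hbeep
        simp at hbeep
      · simp [hb]
  · by_cases hu' : S.Active t u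
    · have hum := hn u hvu hu'
      cases hus : (st G S ω t u).synced
      · exact member_succ_of_not_synced hu' hus
      · have hug := good_of_synced hS hδ hu' hus
        rw [member_succ hu' hug hus, hum]
        by_cases h35 : ph t = 35
        -- Only a frame end creates members, and there a synchronized neighbour of the member `v` is
        -- blocked.
        · have := member_or_blocked hS hδ ω t (by omega) hvu.symm hv hu' hm hus
          rw [hum] at this
          simp [h35, this.resolve_left (by decide)]
        · simp [h35]
    · rw [st_succ_of_not hu']
      rfl

theorem stabilityPersists {δ : ℕ} (hS : S.IsSimple G δ) (hδ : 74 ≤ δ) :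
    rulerMIS.StabilityPersists G S := by
  intro ω t v _ h ha hn
  rcases h with h | ⟨u, hvu, h⟩
  · exact Or.inl (stableMIS_succ hS hδ h ha)
  · exact Or.inr ⟨u, hvu, stableMIS_succ hS hδ h (hn u hvu h.1)⟩

/-! ### Eras: the deterministic facts on which the probabilistic analysis is based. -/

/-- From round `a` to round `b`, nothing happens to the set of participating processes, and all of
them know the frame number modulo `2 ^ J`. -/
structure Era (G : SimpleGraph V) (S : Schedule V) (J a b : ℕ) : Prop where
  active : ∀ t, a ≤ t → t ≤ b → ∀ v, S.Active t v ↔ S.Active a v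
  synced : ∀ (ω : rulerMIS.Sample V) (t : ℕ) (v : V), a ≤ t → t ≤ b → S.Active a v →
    (st G S ω t v).synced = true
  good : ∀ (ω : rulerMIS.Sample V) (t : ℕ) (v : V), a ≤ t → t ≤ b → S.Active a v →
    Good (st G S ω t v) t
  modulus : ∀ (ω : rulerMIS.Sample V) (t : ℕ) (v : V), a ≤ t → t ≤ b → S.Active a v →
    2 ^ J ≤ (st G S ω t v).modulus
  blocked : ∀ (ω : rulerMIS.Sample V) (t : ℕ) (u x : V), a ≤ t → t ≤ b → 29 ≤ ph t →
    G.Adj x u → S.Active a u → S.Active a x → (st G S ω t u).member = true →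
    (st G S ω t x).member = true ∨ (st G S ω t x).blocked = true
  stable : ∀ (ω : rulerMIS.Sample V) (t : ℕ) (v : V), a ≤ t → t < b →
    rulerMIS.StableMIS G S ω t v → rulerMIS.StableMIS G S ω (t + 1) v

/-- Quiet periods end with an era. -/
theorem era_of_quiet {δ : ℕ} (hS : S.IsSimple G δ) {J t T : ℕ} (hJ : matureAge J ≤ δ)
    (hq : S.Quiet t T) : Era G S J (t + matureAge J) (t + T) := by
  have h74 : 74 ≤ matureAge J := by unfold matureAge; omega
  have hδ : 74 ≤ δ := by omega
  have hact : ∀ r, t + matureAge J ≤ r → r ≤ t + T → ∀ v,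
      S.Active (t + matureAge J) v → S.Active r v ∧ S.Active t v := by
    intro r h1 h2 v hv
    have := (hq (t + matureAge J) (by omega) (by omega) v).1 hv
    exact ⟨(hq r (by omega) h2 v).2 this, this⟩
  have hsync : ∀ (ω : rulerMIS.Sample V) (r : ℕ) (v : V), t + matureAge J ≤ r → r ≤ t + T →
      S.Active (t + matureAge J) v → (st G S ω r v).synced = true := by
    intro ω r v h1 h2 hv
    obtain ⟨w, hw, hwt⟩ := exists_wake (hact r h1 h2 v hv).2
    exact synced_of_age hS hδ (hact r h1 h2 v hv).1 hw (by omega)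
  refine ⟨fun r h1 h2 v => ⟨fun h => ?_, fun h => (hact r h1 h2 v h).1⟩, hsync,
    fun ω r v h1 h2 hv => good_of_synced hS hδ (hact r h1 h2 v hv).1 (hsync ω r v h1 h2 hv),
    fun ω r v h1 h2 hv => ?_, fun ω r u x h1 h2 hp hxu hu hx hm => ?_,
    fun ω r v h1 h2 h => ?_⟩
  · exact (hq _ (by omega) (by omega) v).2 ((hq r (by omega) h2 v).1 h)
  · obtain ⟨w, hw, hwt⟩ := exists_wake (hact r h1 h2 v hv).2
    exact le_modulus hS hδ hJ r (hact r h1 h2 v hv).1 hw (by omega)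
  · exact member_or_blocked hS hδ ω r hp hxu (hact r h1 h2 u hu).1 (hact r h1 h2 x hx).1 hm
      (hsync ω r x h1 h2 hx)
  · refine stableMIS_succ hS hδ h ?_
    rw [hq (r + 1) (by omega) (by omega), ← hq r (by omega) (by omega)]
    exact h.1.1

end RulerMIS

/-! ### The effect of one frame within an era. -/

namespace RulerMIS

variable {V : Type} {G : SimpleGraph V} {S : Schedule V}

/-- The participating process `v` is a member in round `t`. -/
def Mem (G : SimpleGraph V) (S : Schedule V) (ω : rulerMIS.Sample V) (t : ℕ) (v : V) : Prop :=
  S.Active t v ∧ (st G S ω t v).member = true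

/-- The member `v` has a neighbour that is a member, too. -/
def Conf (G : SimpleGraph V) (S : Schedule V) (ω : rulerMIS.Sample V) (t : ℕ) (v : V) : Prop :=
  Mem G S ω t v ∧ ∃ u, G.Adj v u ∧ Mem G S ω t u

/-- The participating process `v` objects to starts in frame `k`. -/
def Drw (G : SimpleGraph V) (S : Schedule V) (ω : rulerMIS.Sample V) (k : ℕ) (v : V) : Prop :=
  S.Active (fs k + 30) v ∧ draws (st G S ω (fs k + 30) v) = true

theorem stableMIS_iff_mem {ω : rulerMIS.Sample V} {t : ℕ} {v : V} :
    rulerMIS.StableMIS G S ω t v ↔ Mem G S ω t v ∧ ∀ u, G.Adj v u → ¬ Mem G S ω t u := by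
  rw [stableMIS_iff, Mem, and_assoc]
  refine and_congr_right fun _ => and_congr_right fun _ => forall_congr' fun u =>
    forall_congr' fun _ => ?_
  simp [Mem]

/-- Some process at distance at most two from `v` objects to starts in frame `k`. -/
def Obj (G : SimpleGraph V) (S : Schedule V) (ω : rulerMIS.Sample V)
    (k : ℕ) (v : V) : Prop :=
  ∃ u z, (v = u ∨ G.Adj v u) ∧ (u = z ∨ G.Adj u z) ∧ S.Active (fs k + 30) u ∧ Drw G S ω k z

namespace Era

variable {J a b : ℕ} {ω : rulerMIS.Sample V}

theorem active_iff (E : Era G S J a b)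
    {t t' : ℕ} (h1 : a ≤ t) (h2 : t ≤ b) (h1' : a ≤ t') (h2' : t' ≤ b) {v : V} :
    S.Active t v ↔ S.Active t' v := by
  rw [E.active t h1 h2, E.active t' h1' h2']

theorem bps_bout (E : Era G S J a b)
    {t : ℕ} (h1 : a ≤ t) (h2 : t ≤ b) (hp : isBout (ph t) = true) {v : V} :
    Bps G S ω t v ↔ Mem G S ω t v ∧ coin ω t v = true := by
  rw [Bps, Mem, and_assoc]
  refine and_congr_right fun ha => ?_
  have ha' := (E.active t h1 h2 v).1 ha
  rw [beep_of_isBout (by rw [(E.good ω t v h1 h2 ha').phase, hp]), E.synced ω t v h1 h2 ha']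
  simp

theorem bps_28 (E : Era G S J a b) {t : ℕ} (h1 : a ≤ t) (h2 : t ≤ b) (hp : ph t = 28) {v : V} :
    Bps G S ω t v ↔ Mem G S ω t v := by
  rw [Bps, Mem]
  refine and_congr_right fun ha => ?_
  have ha' := (E.active t h1 h2 v).1 ha
  rw [beep_of_phase_28 (by rw [(E.good ω t v h1 h2 ha').phase, hp]), E.synced ω t v h1 h2 ha']
  simp

theorem bps_30 (E : Era G S J a b) {k : ℕ} (h1 : a ≤ fs k) (h2 : fs k + 36 ≤ b) {v : V} :
    Bps G S ω (fs k + 30) v ↔ Drw G S ω k v := by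
  rw [Bps, Drw]
  refine and_congr_right fun ha => ?_
  have ha' := (E.active _ (by omega) (by omega) v).1 ha
  rw [beep_of_phase_30 (by rw [(E.good ω _ v (by omega) (by omega) ha').phase,
    ph_fs k 30 (by norm_num)]), E.synced ω _ v (by omega) (by omega) ha']
  simp

/-- Membership in a round in which conflicts are resolved. -/
theorem mem_bout (E : Era G S J a b)
    {t : ℕ} (h1 : a ≤ t) (h2 : t < b) (hp : isBout (ph t) = true) {v : V} :
    Mem G S ω (t + 1) v ↔ Mem G S ω t v ∧
      (coin ω t v = true ∨ ∀ u, G.Adj v u → Mem G S ω t u → coin ω t u = false) := by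
  have hp' := hp
  simp only [isBout, Bool.and_eq_true, decide_eq_true_eq] at hp'
  have h35 : ph t ≠ 35 := by omega
  rw [Mem, Mem, E.active_iff (t := t + 1) (t' := t) (by omega) (by omega) h1 h2.le, and_assoc]
  refine and_congr_right fun ha => ?_
  have ha' := (E.active t h1 h2.le v).1 ha
  rw [member_succ ha (E.good ω t v h1 h2.le ha') (E.synced ω t v h1 h2.le ha')]
  simp only [h35, decide_false, cond_false, hp, Bool.not_true, Bool.false_or, Bool.and_eq_true,
    Bool.or_eq_true, Bool.not_eq_true', ← Bool.not_eq_true (ear G S ω t v), ear_iff, Hrs,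
    E.bps_bout h1 h2.le hp]
  refine and_congr_right fun hm => ?_
  have hM : Mem G S ω t v := ⟨ha, hm⟩
  cases hc : coin ω t v
  · simp [hM]
  · simp [hM]

/-- Membership in rounds in which nothing happens to it. -/
theorem mem_of_not_bout (E : Era G S J a b)
    {t : ℕ} (h1 : a ≤ t) (h2 : t < b) (hp : isBout (ph t) = false)
    (h35 : ph t ≠ 35) {v : V} : Mem G S ω (t + 1) v ↔ Mem G S ω t v := by
  rw [Mem, Mem, E.active_iff (t := t + 1) (t' := t) (by omega) (by omega) h1 h2.le]
  refine and_congr_right fun ha => ?_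
  have ha' := (E.active t h1 h2.le v).1 ha
  rw [member_succ ha (E.good ω t v h1 h2.le ha') (E.synced ω t v h1 h2.le ha')]
  simp [h35, hp]

theorem mem_of_mem_end (E : Era G S J a b)
    {t : ℕ} (h1 : a ≤ t) (h2 : t < b) (h35 : ph t = 35) {v : V}
    (h : Mem G S ω t v) : Mem G S ω (t + 1) v := by
  refine ⟨(E.active_iff (by omega) (by omega) h1 h2.le).2 h.1, ?_⟩
  have ha' := (E.active t h1 h2.le v).1 h.1
  rw [member_succ h.1 (E.good ω t v h1 h2.le ha') (E.synced ω t v h1 h2.le ha')]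
  simp [h35, h.2]

/-- No bout and no frame end occurs in phases 28 to 34, so the members heard in phase 28 are still
those at the final decision. -/
theorem mem_late (E : Era G S J a b)
    {k i : ℕ} (h1 : a ≤ fs k) (h2 : fs k + 36 ≤ b) (hi : i ≤ 7) {v : V} :
    Mem G S ω (fs k + 28 + i) v ↔ Mem G S ω (fs k + 28) v := by
  induction i with
  | zero => rfl
  | succ i ih =>
    have hp := ph_fs k (28 + i) (by omega)
    rw [← ih (by omega), ← add_assoc]
    refine E.mem_of_not_bout (by omega) (by omega) ?_ ?_
    · rw [show fs k + 28 + i = fs k + (28 + i) by ring, hp]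
      simp [isBout]
      intros
      omega
    · rw [show fs k + 28 + i = fs k + (28 + i) by ring, hp]
      omega

theorem blocked_late (E : Era G S J a b)
    {k i : ℕ} (h1 : a ≤ fs k) (h2 : fs k + 36 ≤ b) (hi : i ≤ 6) {v : V}
    (hv : S.Active a v) (hm : ¬ Mem G S ω (fs k + 28) v) :
    (st G S ω (fs k + 29 + i) v).blocked = true ↔
      ∃ u, G.Adj v u ∧ Mem G S ω (fs k + 28) u := by
  induction i with
  | zero =>
    have hp := ph_fs k 28 (by omega)
    rw [add_zero, show fs k + 29 = fs k + 28 + 1 by ring,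
      blocked_succ ((E.active _ (by omega) (by omega) v).2 hv)
        (E.good ω _ v (by omega) (by omega) hv) (E.synced ω _ v (by omega) (by omega) hv), hp]
    simp only [decide_true, cond_true, ear_iff, Hrs, E.bps_28 (by omega) (by omega) hp]
    exact and_iff_right hm
  | succ i ih =>
    have hp := ph_fs k (29 + i) (by omega)
    rw [← ih (by omega), ← add_assoc,
      blocked_succ ((E.active _ (by omega) (by omega) v).2 hv)
        (E.good ω _ v (by omega) (by omega) hv) (E.synced ω _ v (by omega) (by omega) hv),
      show fs k + 29 + i = fs k + (29 + i) by ring, hp]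
    have : 29 + i ≠ 28 := by omega
    simp [this]

/-- Somebody in the closed neighbourhood of `v` objects. -/
theorem supported_31 (E : Era G S J a b)
    {k : ℕ} (h1 : a ≤ fs k) (h2 : fs k + 36 ≤ b) {v : V} (hv : S.Active a v) :
    (st G S ω (fs k + 31) v).supported = true ↔
      Drw G S ω k v ∨ ∃ u, G.Adj v u ∧ Drw G S ω k u := by
  have hp := ph_fs k 30 (by omega)
  have ha := (E.active (fs k + 30) (by omega) (by omega) v).2 hv
  rw [show fs k + 31 = fs k + 30 + 1 by ring, supported_succ ha
      (E.good ω _ v (by omega) (by omega) hv) (E.synced ω _ v (by omega) (by omega) hv), hp]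
  simp only [decide_true, cond_true, Bool.or_eq_true, ear_iff, Hrs, E.bps_30 h1 h2]
  have : draws (st G S ω (fs k + 30) v) = true ↔ Drw G S ω k v := (and_iff_right ha).symm
  rw [this]
  tauto

/-- The beep in phase 32 relays the objections heard in phase 30, extending their reach from
distance one to distance two. -/
theorem supported_late (E : Era G S J a b)
    {k i : ℕ} (h1 : a ≤ fs k) (h2 : fs k + 36 ≤ b) (hi : i ≤ 2) {v : V}
    (hv : S.Active a v) :
    (st G S ω (fs k + 33 + i) v).supported = true ↔
      (st G S ω (fs k + 31) v).supported = true ∨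
        ∃ u, G.Adj v u ∧ S.Active a u ∧ (st G S ω (fs k + 31) u).supported = true := by
  have h31 : ∀ u, S.Active a u →
      (st G S ω (fs k + 32) u).supported = (st G S ω (fs k + 31) u).supported := by
    intro u hu
    have hp := ph_fs k 31 (by omega)
    rw [show fs k + 32 = fs k + 31 + 1 by ring,
      supported_succ ((E.active _ (by omega) (by omega) u).2 hu)
        (E.good ω _ u (by omega) (by omega) hu) (E.synced ω _ u (by omega) (by omega) hu), hp]
    simp
  induction i with
  | zero =>
    have hp := ph_fs k 32 (by omega)
    have hb : ∀ u, Bps G S ω (fs k + 32) u ↔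
        S.Active a u ∧ (st G S ω (fs k + 31) u).supported = true := by
      intro u
      rw [Bps, E.active (fs k + 32) (by omega) (by omega)]
      refine and_congr_right fun hu => ?_
      rw [beep_of_phase_32 (by rw [(E.good ω _ u (by omega) (by omega) hu).phase, hp]),
        E.synced ω _ u (by omega) (by omega) hu, h31 u hu]
      simp
    rw [add_zero, show fs k + 33 = fs k + 32 + 1 by ring,
      supported_succ ((E.active _ (by omega) (by omega) v).2 hv)
        (E.good ω _ v (by omega) (by omega) hv) (E.synced ω _ v (by omega) (by omega) hv), hp,
      h31 v hv]
    simp only [Nat.reduceEqDiff, decide_false, cond_false, decide_true, Bool.true_and,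
      Bool.or_eq_true, ear_iff, Hrs, hb, hv, true_and]
    tauto
  | succ i ih =>
    have hp := ph_fs k (33 + i) (by omega)
    refine Iff.trans ?_ (ih (by omega))
    rw [← add_assoc,
      supported_succ ((E.active _ (by omega) (by omega) v).2 hv)
        (E.good ω _ v (by omega) (by omega) hv) (E.synced ω _ v (by omega) (by omega) hv),
      show fs k + 33 + i = fs k + (33 + i) by ring, hp]
    have e1 : 33 + i ≠ 30 := by omega
    have e2 : 33 + i ≠ 32 := by omega
    simp [e1, e2]

/-- The rule by which processes become members. -/
theorem mem_end (E : Era G S J a b)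
    {k : ℕ} (h1 : a ≤ fs k) (h2 : fs k + 36 ≤ b) {v : V} (hv : S.Active a v) :
    Mem G S ω (fs (k + 1)) v ↔ Mem G S ω (fs k + 28) v ∨
      ((∀ u, G.Adj v u → ¬ Mem G S ω (fs k + 28) u) ∧ ¬ Obj G S ω k v) := by
  have hp := ph_fs k 35 (by omega)
  have ha := (E.active (fs k + 35) (by omega) (by omega) v).2 hv
  have h35 : Mem G S ω (fs k + 35) v ↔ Mem G S ω (fs k + 28) v := E.mem_late h1 h2 (i := 7) le_rfl
  have hobj : (st G S ω (fs k + 35) v).supported = true ↔ Obj G S ω k v := by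
    rw [show fs k + 35 = fs k + 33 + 2 by ring, E.supported_late h1 h2 le_rfl hv,
      E.supported_31 h1 h2 hv]
    have e : ∀ u, S.Active (fs k + 30) u ↔ S.Active a u := E.active _ (by omega) (by omega)
    constructor
    · rintro ((h | ⟨u, hu, h⟩) | ⟨u, hu, hua, h⟩)
      · exact ⟨v, v, Or.inl rfl, Or.inl rfl, (e v).2 hv, h⟩
      · exact ⟨v, u, Or.inl rfl, Or.inr hu, (e v).2 hv, h⟩
      · rcases (E.supported_31 h1 h2 hua).1 h with h | ⟨z, hz, h⟩
        · exact ⟨u, u, Or.inr hu, Or.inl rfl, (e u).2 hua, h⟩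
        · exact ⟨u, z, Or.inr hu, Or.inr hz, (e u).2 hua, h⟩
    · rintro ⟨u, z, rfl | hu, hz, hua, h⟩
      · rcases hz with rfl | hz
        · exact Or.inl (Or.inl h)
        · exact Or.inl (Or.inr ⟨z, hz, h⟩)
      · refine Or.inr ⟨u, hu, (e u).1 hua, (E.supported_31 h1 h2 ((e u).1 hua)).2 ?_⟩
        rcases hz with rfl | hz
        · exact Or.inl h
        · exact Or.inr ⟨z, hz, h⟩
  have hfs : fs (k + 1) = fs k + 35 + 1 := by unfold fs; ring
  have ha' : S.Active (fs k + 35 + 1) v := (E.active _ (by omega) (by omega) v).2 hv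
  have hM : (st G S ω (fs k + 35) v).member = true ↔ Mem G S ω (fs k + 28) v := by
    rw [← h35, Mem]; simp [ha]
  rw [hfs, Mem, member_succ ha (E.good ω _ v (by omega) (by omega) hv)
    (E.synced ω _ v (by omega) (by omega) hv), hp]
  simp only [ha', true_and, decide_true, cond_true, Bool.or_eq_true, Bool.and_eq_true,
    Bool.not_eq_true', hM]
  by_cases hm : Mem G S ω (fs k + 28) v
  · simp [hm]
  · simp only [hm, false_or]
    rw [← Bool.not_eq_true, ← Bool.not_eq_true, hobj]
    have := E.blocked_late (ω := ω) h1 h2 (i := 6) le_rfl hv hm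
    rw [show fs k + 29 + 6 = fs k + 35 by ring] at this
    rw [this]
    push Not
    rfl

/-- The streak grows or is reset once in every frame. -/
theorem streak_frame (E : Era G S J a b)
    {k i : ℕ} (h1 : a ≤ fs k) (h2 : fs k + 36 ≤ b) (hi : i ≤ 35) {v : V}
    (hv : S.Active a v) :
    (st G S ω (fs k + 1 + i) v).streak =
      if coin ω (fs k) v = true then (st G S ω (fs k) v).streak + 1 else 0 := by
  induction i with
  | zero =>
    have hp := ph_fs k 0 (by omega)
    rw [add_zero] at hp
    rw [add_zero, streak_succ ((E.active _ (by omega) (by omega) v).2 hv)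
        (E.good ω _ v (by omega) (by omega) hv) (E.synced ω _ v (by omega) (by omega) hv), hp]
    cases coin ω (fs k) v <;> simp
  | succ i ih =>
    have hp := ph_fs k (1 + i) (by omega)
    rw [← ih (by omega), ← add_assoc,
      streak_succ ((E.active _ (by omega) (by omega) v).2 hv)
        (E.good ω _ v (by omega) (by omega) hv) (E.synced ω _ v (by omega) (by omega) hv),
      show fs k + 1 + i = fs k + (1 + i) by ring, hp]
    have e1 : 1 + i ≠ 0 := by omega
    simp

/-- The coin of phase 0 is tossed before the objections of phase 30, so the coin of the current
frame counts: the run covers frames `k + 1` to `k + g`. Starting from any streak, `g` heads suffice.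
-/
theorem streak_of_heads (E : Era G S J a b)
    {k g : ℕ} (h1 : a ≤ fs k) (h2 : fs (k + g) + 36 ≤ b) {v : V}
    (hv : S.Active a v) (hc : ∀ i < g, coin ω (fs (k + 1 + i)) v = true) :
    g ≤ (st G S ω (fs (k + g) + 30) v).streak := by
  induction g with
  | zero => exact Nat.zero_le _
  | succ g ih =>
    have e : fs (k + (g + 1)) = fs (k + g) + 36 := by unfold fs; ring
    have hle : fs k ≤ fs (k + g) := by unfold fs; omega
    have h3 := ih (by omega) fun i hi => hc i (by omega)
    have h4 := E.streak_frame (ω := ω) (k := k + g) (i := 29) (by omega) (by omega) (by omega) hv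
    have h5 := E.streak_frame (ω := ω) (k := k + g) (i := 35) (by omega) (by omega) (by omega) hv
    have h6 := E.streak_frame (ω := ω) (k := k + (g + 1)) (i := 29) (by omega) (by omega)
      (by omega) hv
    rw [show fs (k + g) + 1 + 29 = fs (k + g) + 30 by ring] at h4
    rw [show fs (k + g) + 1 + 35 = fs (k + (g + 1)) by omega] at h5
    have h7 := hc g (by omega)
    rw [show k + 1 + g = k + (g + 1) by ring] at h7
    rw [show fs (k + (g + 1)) + 1 + 29 = fs (k + (g + 1)) + 30 by ring, if_pos h7] at h6
    omega

/-- A streak of `g` cannot contain a reset in the last `g` frames; what happened before frame `k +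
1` is irrelevant. -/
theorem heads_of_streak (E : Era G S J a b)
    {k g : ℕ} (h1 : a ≤ fs k) (h2 : fs (k + g) + 36 ≤ b) {v : V}
    (hv : S.Active a v) (hg : g ≤ (st G S ω (fs (k + g) + 30) v).streak) :
    ∀ i < g, coin ω (fs (k + 1 + i)) v = true := by
  induction g with
  | zero => exact fun i hi => absurd hi (Nat.not_lt_zero i)
  | succ g ih =>
    have e : fs (k + (g + 1)) = fs (k + g) + 36 := by unfold fs; ring
    have hle : fs k ≤ fs (k + g) := by unfold fs; omega
    have h4 := E.streak_frame (ω := ω) (k := k + g) (i := 29) (by omega) (by omega) (by omega) hv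
    have h5 := E.streak_frame (ω := ω) (k := k + g) (i := 35) (by omega) (by omega) (by omega) hv
    have h6 := E.streak_frame (ω := ω) (k := k + (g + 1)) (i := 29) (by omega) (by omega)
      (by omega) hv
    rw [show fs (k + g) + 1 + 29 = fs (k + g) + 30 by ring] at h4
    rw [show fs (k + g) + 1 + 35 = fs (k + (g + 1)) by omega] at h5
    rw [show fs (k + (g + 1)) + 1 + 29 = fs (k + (g + 1)) + 30 by ring] at h6
    by_cases h7 : coin ω (fs (k + (g + 1))) v = true
    · rw [if_pos h7] at h6
      intro i hi
      rcases Nat.lt_succ_iff_lt_or_eq.1 hi with hi | rfl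
      · exact ih (by omega) (by omega) i hi
      · rwa [show k + 1 + i = k + (i + 1) by ring]
    · rw [if_neg h7] at h6
      omega

/-- The threshold for objections in frame `k`, when `k` is not a multiple of `2 ^ J`. -/
theorem gcd_eq (E : Era G S J a b)
    {k : ℕ} (h1 : a ≤ fs k) (h2 : fs k + 36 ≤ b) {v : V} (hv : S.Active a v)
    (hk : ¬ 2 ^ J ∣ k) :
    (st G S ω (fs k + 30) v).clock.gcd (st G S ω (fs k + 30) v).modulus = k.gcd (2 ^ J) := by
  have hg := E.good ω (fs k + 30) v (by omega) (by omega) hv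
  have hM := E.modulus ω (fs k + 30) v (by omega) (by omega) hv
  rw [hg.gcd_eq, tau_fs k 30 (by norm_num)]
  obtain ⟨j, hj⟩ := hg.modulus
  rw [hj] at hM ⊢
  have hJj := (Nat.pow_le_pow_iff_right (by norm_num : 1 < 2)).1 hM
  refine Nat.dvd_antisymm (Nat.dvd_gcd (Nat.gcd_dvd_left _ _) ?_)
    (Nat.dvd_gcd (Nat.gcd_dvd_left _ _) ((Nat.gcd_dvd_right _ _).trans (pow_dvd_pow 2 hJj)))
  -- The gcd is a power of two dividing `k`, and `2 ^ J` does not divide `k`; hence digits beyond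
  -- the `J`-th do not matter, and all processes use the same threshold.
  obtain ⟨i, -, hi⟩ := (Nat.dvd_prime_pow Nat.prime_two).1 (Nat.gcd_dvd_right k (2 ^ (j + 1)))
  rw [hi]
  refine pow_dvd_pow 2 ?_
  by_contra hlt
  exact hk ((pow_dvd_pow 2 (by omega)).trans (hi ▸ Nat.gcd_dvd_left k (2 ^ (j + 1))))

/-- At multiples of `2 ^ J` the thresholds may differ from process to process, but a lower bound is
all that is needed: high thresholds make objections rare. -/
theorem le_gcd (E : Era G S J a b)
    {k : ℕ} (h1 : a ≤ fs k) (h2 : fs k + 36 ≤ b) {v : V} (hv : S.Active a v)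
    (hk : 2 ^ J ∣ k) :
    2 ^ J ≤ (st G S ω (fs k + 30) v).clock.gcd (st G S ω (fs k + 30) v).modulus := by
  have hg := E.good ω (fs k + 30) v (by omega) (by omega) hv
  have hM := E.modulus ω (fs k + 30) v (by omega) (by omega) hv
  rw [hg.gcd_eq, tau_fs k 30 (by norm_num)]
  obtain ⟨j, hj⟩ := hg.modulus
  rw [hj] at hM ⊢
  have hJj := (Nat.pow_le_pow_iff_right (by norm_num : 1 < 2)).1 hM
  exact Nat.le_of_dvd (Nat.gcd_pos_of_pos_right _ (by positivity))
    (Nat.dvd_gcd hk (pow_dvd_pow 2 hJj))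

/-- A conflict can only survive or arise from a simultaneous start. -/
theorem conf_end (E : Era G S J a b) {k : ℕ} (h1 : a ≤ fs k) (h2 : fs k + 36 ≤ b) {w : V}
    (hc : Conf G S ω (fs (k + 1)) w) :
    Conf G S ω (fs k + 28) w ∨ ¬ Obj G S ω k w := by
  obtain ⟨hw, u, hwu, hu⟩ := hc
  have e : fs (k + 1) ≤ b ∧ a ≤ fs (k + 1) := by unfold fs at *; omega
  have hwa := (E.active _ e.2 e.1 w).1 hw.1
  have hua := (E.active _ e.2 e.1 u).1 hu.1
  rcases (E.mem_end h1 h2 hwa).1 hw with h3 | h3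
  · rcases (E.mem_end h1 h2 hua).1 hu with h4 | h4
    · exact Or.inl ⟨h3, u, hwu, h4⟩
    · exact absurd h3 (h4.1 w hwu.symm)
  · exact Or.inr h3.2

theorem conf_of_not_bout (E : Era G S J a b)
    {t : ℕ} (h1 : a ≤ t) (h2 : t < b) (hp : isBout (ph t) = false)
    (h35 : ph t ≠ 35) {v : V} (h : Conf G S ω (t + 1) v) : Conf G S ω t v := by
  obtain ⟨hv, u, hvu, hu⟩ := h
  exact ⟨(E.mem_of_not_bout h1 h2 hp h35).1 hv, u, hvu, (E.mem_of_not_bout h1 h2 hp h35).1 hu⟩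

theorem conf_of_bout (E : Era G S J a b)
    {t : ℕ} (h1 : a ≤ t) (h2 : t < b) (hp : isBout (ph t) = true) {v : V}
    (h : Conf G S ω (t + 1) v) : Conf G S ω t v ∧
      (coin ω t v = true ∨ ∀ u, G.Adj v u → Mem G S ω t u → coin ω t u = false) := by
  obtain ⟨hv, u, hvu, hu⟩ := h
  have hv' := (E.mem_bout h1 h2 hp).1 hv
  exact ⟨⟨hv'.1, u, hvu, ((E.mem_bout h1 h2 hp).1 hu).1⟩, hv'.2⟩

/-- A member that tosses heads until all its rivals have tossed tails wins. -/
theorem wins (E : Era G S J a b) {k h : ℕ} (h1 : a ≤ fs k) (h2 : fs (k + h) ≤ b) {v : V}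
    (hv : Mem G S ω (fs k) v)
    (hc : ∀ t, fs k ≤ t → t < fs (k + h) → isBout (ph t) = true → coin ω t v = true)
    (hr : ∀ u, G.Adj v u → Mem G S ω (fs k) u →
      ∃ t, fs k ≤ t ∧ t < fs (k + h) ∧ isBout (ph t) = true ∧ coin ω t u = false) :
    rulerMIS.StableMIS G S ω (fs (k + h)) v := by
  have key : ∀ t, fs k ≤ t → t ≤ fs (k + h) → Mem G S ω t v ∧ ∀ u, G.Adj v u → Mem G S ω t u →
      Mem G S ω (fs k) u ∧ ∀ r, fs k ≤ r → r < t → isBout (ph r) = true → coin ω r u = true := by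
    intro t ht
    induction t, ht using Nat.le_induction with
    | base => exact fun _ => ⟨hv, fun u _ hu => ⟨hu, fun r h1 h2 => absurd h1 (by omega)⟩⟩
    | succ t ht ih =>
      intro htb
      obtain ⟨i1, i2⟩ := ih (by omega)
      cases hp : isBout (ph t)
      · have hlast : ∀ u, Mem G S ω t u → ∀ r, fs k ≤ r → r < t + 1 → isBout (ph r) = true →
            (∀ r, fs k ≤ r → r < t → isBout (ph r) = true → coin ω r u = true) →
            coin ω r u = true := by
          intro u _ r r1 r2 r3 hh
          rcases Nat.lt_succ_iff_lt_or_eq.1 r2 with r2 | rfl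
          · exact hh r r1 r2 r3
          · rw [hp] at r3
            exact absurd r3 (by decide)
        by_cases h35 : ph t = 35
        · refine ⟨E.mem_of_mem_end (by omega) (by omega) h35 i1, fun u hvu hu => ?_⟩
          by_cases hut : Mem G S ω t u
          · exact ⟨(i2 u hvu hut).1, fun r r1 r2 r3 => hlast u hut r r1 r2 r3 (i2 u hvu hut).2⟩
          -- A neighbour that becomes a member at this frame end is impossible: it would be blocked
          -- by `v`, which has been a member since before phase 28.
          · exfalso
            have hua := (E.active (t + 1) (by omega) (by omega) u).1 hu.1
            have hva := (E.active t (by omega) (by omega) v).1 i1.1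
            have hat := (E.active t (by omega) (by omega) u).2 hua
            have hm := hu.2
            have hum : (st G S ω t u).member = false := by
              by_contra hne
              exact hut ⟨hat, by simpa using hne⟩
            rw [member_succ hat (E.good ω t u (by omega) (by omega) hua)
              (E.synced ω t u (by omega) (by omega) hua), hum] at hm
            have := E.blocked ω t v u (by omega) (by omega) (by omega) hvu.symm hva hua i1.2
            rw [hum] at this
            simp [h35, this.resolve_left (by decide)] at hm
        · refine ⟨(E.mem_of_not_bout (by omega) (by omega) hp h35).2 i1, fun u hvu hu => ?_⟩
          have hut := (E.mem_of_not_bout (by omega) (by omega) hp h35).1 hu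
          exact ⟨(i2 u hvu hut).1, fun r r1 r2 r3 => hlast u hut r r1 r2 r3 (i2 u hvu hut).2⟩
      · have hcv := hc t ht (by omega) hp
        refine ⟨(E.mem_bout (by omega) (by omega) hp).2 ⟨i1, Or.inl hcv⟩, fun u hvu hu => ?_⟩
        obtain ⟨hut, hor⟩ := (E.mem_bout (by omega) (by omega) hp).1 hu
        refine ⟨(i2 u hvu hut).1, fun r r1 r2 r3 => ?_⟩
        rcases Nat.lt_succ_iff_lt_or_eq.1 r2 with r2 | rfl
        · exact (i2 u hvu hut).2 r r1 r2 r3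
        -- A surviving rival tossed heads, since with tails it would have heard `v`, whose coin is
        -- heads in every bout.
        · rcases hor with hor | hor
          · exact hor
          · have := hor v hvu.symm i1
            rw [hcv] at this
            exact absurd this (by decide)
  obtain ⟨k1, k2⟩ := key (fs (k + h)) (by unfold fs; omega) le_rfl
  refine stableMIS_iff_mem.2 ⟨k1, fun u hvu hu => ?_⟩
  obtain ⟨t, t1, t2, t3, t4⟩ := hr u hvu (k2 u hvu hu).1
  have := (k2 u hvu hu).2 t t1 t2 t3
  rw [t4] at this
  exact absurd this (by decide)

theorem stable_mono (E : Era G S J a b) {t t' : ℕ} (h1 : a ≤ t) (h2 : t ≤ t') (h3 : t' ≤ b) {v : V}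
    (h : rulerMIS.StableMIS G S ω t v) : rulerMIS.StableMIS G S ω t' v := by
  induction t', h2 using Nat.le_induction with
  | base => exact h
  | succ t' h2 ih => exact E.stable ω t' v (by omega) (by omega) (ih (by omega))

end Era

end RulerMIS

/-! ### Indicators of propositions. -/

/-- The indicator of a proposition. -/
noncomputable def ind (p : Prop) : ℝ := open Classical in if p then 1 else 0

theorem ind_of {p : Prop} (h : p) : ind p = 1 := if_pos h

theorem ind_of_not {p : Prop} (h : ¬ p) : ind p = 0 := if_neg h

theorem ind_nonneg (p : Prop) : 0 ≤ ind p := by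
  by_cases h : p <;> simp [ind, h]

theorem ind_le_one (p : Prop) : ind p ≤ 1 := by
  by_cases h : p <;> simp [ind, h]

theorem ind_mono {p q : Prop} (h : p → q) : ind p ≤ ind q := by
  by_cases hp : p
  · rw [ind_of hp, ind_of (h hp)]
  · rw [ind_of_not hp]
    exact ind_nonneg q

theorem ind_congr {p q : Prop} (h : p ↔ q) : ind p = ind q := by rw [propext h]

theorem ind_and (p q : Prop) : ind (p ∧ q) = ind p * ind q := by
  by_cases hp : p <;> by_cases hq : q <;> simp [ind, hp, hq]

theorem ind_not (p : Prop) : ind (¬ p) = 1 - ind p := by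
  by_cases hp : p <;> simp [ind, hp]

theorem ind_or_le (p q : Prop) : ind (p ∨ q) ≤ ind p + ind q := by
  by_cases hp : p <;> by_cases hq : q <;> simp [ind, hp, hq]

theorem ind_exists_le {α : Type*} (s : Finset α) (p : α → Prop) :
    ind (∃ x ∈ s, p x) ≤ ∑ x ∈ s, ind (p x) := by
  by_cases h : ∃ x ∈ s, p x
  · obtain ⟨x, hx, hp⟩ := h
    rw [ind_of ⟨x, hx, hp⟩, ← ind_of hp]
    exact Finset.single_le_sum (f := fun x => ind (p x)) (fun y _ => ind_nonneg _) hx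
  · rw [ind_of_not h]
    exact Finset.sum_nonneg fun x _ => ind_nonneg _

/-! ### Averages over finitely many fair coins. -/

section Averages

variable {ι : Type*}

/-- The sample that agrees with `η` on `F` and consists of tails elsewhere. -/
noncomputable def pad (F : Finset ι) (η : F → Bool) : ι → Bool :=
  open Classical in fun i => if h : i ∈ F then η ⟨i, h⟩ else false

open scoped BigOperators Classical in
/-- The average over all tosses of the coins in `F`. -/
noncomputable def Ex (F : Finset ι) (f : (ι → Bool) → ℝ) : ℝ := 𝔼 η : F → Bool, f (pad F η)

/-- The sample that agrees with `ω` on `P` and with `ω'` elsewhere. -/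
noncomputable def merge (P : Set ι) (ω ω' : ι → Bool) : ι → Bool :=
  open Classical in fun i => if i ∈ P then ω i else ω' i

/-- The value of `f` is determined by the coins in `P`. -/
def Dep {β : Type*} (P : Set ι) (f : (ι → Bool) → β) : Prop :=
  ∀ ω ω', (∀ i ∈ P, ω i = ω' i) → f ω = f ω'

variable {F : Finset ι} {P : Set ι} {f g : (ι → Bool) → ℝ}

theorem merge_of_mem {ω ω' : ι → Bool} {i : ι} (h : i ∈ P) : merge P ω ω' i = ω i := if_pos h

theorem merge_of_notMem {ω ω' : ι → Bool} {i : ι} (h : i ∉ P) : merge P ω ω' i = ω' i := if_neg h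

theorem Dep.merge_eq {β : Type*} {f : (ι → Bool) → β} (hf : Dep P f) (ω ω' : ι → Bool) :
    f (merge P ω ω') = f ω := hf _ _ fun _ hi => merge_of_mem hi

theorem Dep.merge_eq_right {β : Type*} {f : (ι → Bool) → β} {Q : Set ι} (hf : Dep Q f)
    (hQ : Disjoint P Q) (ω ω' : ι → Bool) : f (merge P ω ω') = f ω' :=
  hf _ _ fun _ hi => merge_of_notMem fun h => Set.disjoint_left.1 hQ h hi

theorem Dep.mono {β : Type*} {f : (ι → Bool) → β} {Q : Set ι} (hf : Dep P f) (h : P ⊆ Q) :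
    Dep Q f := fun ω ω' hω => hf ω ω' fun i hi => hω i (h hi)

theorem Ex_add : Ex F (fun ω => f ω + g ω) = Ex F f + Ex F g := Finset.expect_add_distrib _ _ _

theorem Ex_sub : Ex F (fun ω => f ω - g ω) = Ex F f - Ex F g := Finset.expect_sub_distrib _ _ _

theorem Ex_const (c : ℝ) : Ex F (fun _ => c) = c := by
  classical
  exact Finset.expect_const Finset.univ_nonempty c

theorem Ex_mul_left (c : ℝ) : Ex F (fun ω => c * f ω) = c * Ex F f :=
  (Finset.mul_expect _ _ _).symm

theorem Ex_mul_right (c : ℝ) : Ex F (fun ω => f ω * c) = Ex F f * c :=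
  (Finset.expect_mul _ _ _).symm

theorem Ex_mono (h : ∀ ω, f ω ≤ g ω) : Ex F f ≤ Ex F g :=
  Finset.expect_le_expect fun _ _ => h _

theorem Ex_nonneg (h : ∀ ω, 0 ≤ f ω) : 0 ≤ Ex F f := Finset.expect_nonneg fun _ _ => h _

theorem Ex_sum {α : Type*} (s : Finset α) (f : α → (ι → Bool) → ℝ) :
    Ex F (fun ω => ∑ x ∈ s, f x ω) = ∑ x ∈ s, Ex F (f x) := Finset.expect_sum_comm _ _ _

/-- The coins in `P` can be tossed first. -/
theorem Ex_merge (P : Set ι) (f : (ι → Bool) → ℝ) :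
    Ex F f = Ex F fun ω => Ex F fun ω' => f (merge P ω ω') := by
  classical
  let m : (F → Bool) → (F → Bool) → F → Bool := fun η η' i => if i.1 ∈ P then η i else η' i
  have hm : ∀ η η', merge P (pad F η) (pad F η') = pad F (m η η') := by
    intro η η'
    funext i
    by_cases hP : i ∈ P <;> by_cases hF : i ∈ F <;> simp [merge, pad, m, hP, hF]
  -- Exchanging the coordinates outside `P` between two independent samples is an involution, hence
  -- preserves the average over pairs; its first component is the merged sample.
  let e : Equiv.Perm ((F → Bool) × (F → Bool)) := Function.Involutive.toPerm
    (fun p => (m p.1 p.2, m p.2 p.1)) (by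
      rintro ⟨η, η'⟩
      ext i <;> by_cases hP : i.1 ∈ P <;> simp [m, hP])
  have h1 : Ex F (fun ω => Ex F fun ω' => f (merge P ω ω')) =
      Finset.expect Finset.univ fun p : (F → Bool) × (F → Bool) => f (pad F (e p).1) := by
    rw [← Finset.univ_product_univ, Finset.expect_product]
    simp only [Ex, hm]
    rfl
  have h2 : Ex F f =
      Finset.expect Finset.univ fun p : (F → Bool) × (F → Bool) => f (pad F p.1) := by
    rw [← Finset.univ_product_univ, Finset.expect_product]
    simp only [Ex, Finset.expect_const Finset.univ_nonempty]
  rw [h1, h2]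
  exact (Fintype.expect_equiv e _ _ fun _ => rfl).symm

/-- Independence of functions of disjoint sets of coins: toss the coins in `P` first. -/
theorem Ex_mul_of_dep {Q : Set ι} (hf : Dep P f) (hg : Dep Q g) (h : Disjoint P Q) :
    Ex F (fun ω => f ω * g ω) = Ex F f * Ex F g := by
  rw [Ex_merge P]
  simp only [hf.merge_eq, hg.merge_eq_right h, Ex_mul_left, Ex_mul_right]

/-- If `f` depends on the coins in `P` only, then `g` can be replaced by its average over the
remaining coins. -/
theorem Ex_mul_le {c : (ι → Bool) → ℝ} (hf : Dep P f) (h0 : ∀ ω, 0 ≤ f ω)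
    (h : ∀ ω, 0 < f ω → Ex F (fun ω' => g (merge P ω ω')) ≤ c ω) :
    Ex F (fun ω => f ω * g ω) ≤ Ex F fun ω => f ω * c ω := by
  rw [Ex_merge P]
  simp only [hf.merge_eq, Ex_mul_left]
  refine Ex_mono fun ω => ?_
  rcases (h0 ω).eq_or_lt with h1 | h1
  · rw [← h1, zero_mul, zero_mul]
  · exact mul_le_mul_of_nonneg_left (h ω h1) h1.le

theorem le_Ex_mul {c : (ι → Bool) → ℝ} (hf : Dep P f) (h0 : ∀ ω, 0 ≤ f ω)
    (h : ∀ ω, 0 < f ω → c ω ≤ Ex F (fun ω' => g (merge P ω ω'))) :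
    (Ex F fun ω => f ω * c ω) ≤ Ex F fun ω => f ω * g ω := by
  rw [Ex_merge P (fun ω => f ω * g ω)]
  simp only [hf.merge_eq, Ex_mul_left]
  refine Ex_mono fun ω => ?_
  rcases (h0 ω).eq_or_lt with h1 | h1
  · rw [← h1, zero_mul, zero_mul]
  · exact mul_le_mul_of_nonneg_left (h ω h1) h1.le

theorem Ex_mul_le_const {c : ℝ} (hf : Dep P f) (h0 : ∀ ω, 0 ≤ f ω)
    (h : ∀ ω, 0 < f ω → Ex F (fun ω' => g (merge P ω ω')) ≤ c) :
    Ex F (fun ω => f ω * g ω) ≤ c * Ex F f := by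
  refine (Ex_mul_le hf h0 h).trans_eq ?_
  rw [Ex_mul_right, mul_comm]

theorem Ex_coin {i : ι} (hi : i ∈ F) (b : Bool) : Ex F (fun ω => ind (ω i = b)) = 1 / 2 := by
  classical
  have hflip : Ex F (fun ω => ind (ω i = b)) = Ex F (fun ω => ind (ω i = !b)) := by
    -- Flipping the single coin `i` exchanges the two outcomes.
    refine Fintype.expect_equiv (Function.Involutive.toPerm
      (fun η : F → Bool => Function.update η ⟨i, hi⟩ (!(η ⟨i, hi⟩))) ?_) _ _ fun η => ?_
    · intro η
      simp
    · refine ind_congr ?_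
      have h1 : pad F η i = η ⟨i, hi⟩ := dif_pos hi
      have h2 : pad F (Function.update η ⟨i, hi⟩ (!(η ⟨i, hi⟩))) i = !(η ⟨i, hi⟩) :=
        (dif_pos hi).trans (Function.update_self _ _ _)
      refine (Eq.congr_left h1).trans (Iff.trans ?_ (Eq.congr_left h2).symm)
      exact (Bool.not_inj_iff).symm
  have hsum : Ex F (fun ω => ind (ω i = b) + ind (ω i = !b)) = 1 := by
    refine (congrArg (Ex F) (funext fun ω => ?_)).trans (Ex_const 1)
    cases ω i <;> cases b <;> simp [ind]
  rw [Ex_add, ← hflip] at hsum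
  linarith

theorem dep_ind_coin (i : ι) (b : Bool) : Dep {i} (fun ω : ι → Bool => ind (ω i = b)) :=
  fun ω ω' h => by simp only [h i rfl]

/-- The probability of a block of heads. -/
theorem Ex_heads (B : Finset ι) (hB : B ⊆ F) :
    Ex F (fun ω => ind (∀ i ∈ B, ω i = true)) = (1 / 2) ^ B.card := by
  classical
  induction B using Finset.induction_on with
  | empty => simpa [ind] using Ex_const (F := F) 1
  | insert i B hi ih =>
    rw [Finset.card_insert_of_notMem hi, pow_succ', ← ih fun j hj => hB (Finset.mem_insert_of_mem hj),
      ← Ex_coin (F := F) (hB (Finset.mem_insert_self i B)) true,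
      ← Ex_mul_of_dep (P := {i}) (Q := B) (dep_ind_coin i true) ?_ ?_]
    · simp only [← ind_and, Finset.forall_mem_insert]
    · intro ω ω' h
      exact ind_congr (forall₂_congr fun j hj => by rw [h j hj])
    · simpa using hi

/-- The probability that none of several disjoint blocks consists of heads only. -/
theorem Ex_no_heads {α : Type*} (X : Finset α) (B : α → Finset ι) (hB : ∀ x ∈ X, B x ⊆ F)
    (hd : ∀ x ∈ X, ∀ y ∈ X, x ≠ y → Disjoint (B x) (B y)) :
    Ex F (fun ω => ind (∀ x ∈ X, ¬ ∀ i ∈ B x, ω i = true)) =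
      ∏ x ∈ X, (1 - (1 / 2) ^ (B x).card) := by
  classical
  induction X using Finset.induction_on with
  | empty => simpa [ind] using Ex_const (F := F) 1
  | insert x X hx ih =>
    rw [Finset.prod_insert hx, ← ih (fun y hy => hB y (Finset.mem_insert_of_mem hy))
      (fun y hy z hz => hd y (Finset.mem_insert_of_mem hy) z (Finset.mem_insert_of_mem hz)),
      ← Ex_heads (F := F) (B x) (hB x (Finset.mem_insert_self x X))]
    have h1 : (1 : ℝ) - Ex F (fun ω => ind (∀ i ∈ B x, ω i = true)) =
        Ex F (fun ω => ind (¬ ∀ i ∈ B x, ω i = true)) := by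
      simp only [ind_not, Ex_sub, Ex_const]
    rw [h1, ← Ex_mul_of_dep (P := B x) (Q := ⋃ y ∈ X, (B y : Set ι)) ?_ ?_ ?_]
    · simp only [← ind_and, Finset.forall_mem_insert]
    · intro ω ω' h
      exact ind_congr (not_congr (forall₂_congr fun j hj => by rw [h j hj]))
    · intro ω ω' h
      refine ind_congr (forall₂_congr fun y hy => not_congr (forall₂_congr fun j hj => ?_))
      rw [h j (Set.mem_biUnion hy hj)]
    · rw [Set.disjoint_iUnion₂_right]
      intro y hy
      exact Finset.disjoint_coe.2 (hd x (Finset.mem_insert_self x X) y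
        (Finset.mem_insert_of_mem hy) fun h => hx (h ▸ hy))

/-- Of two coins, the first one does not lose against the second one. -/
theorem Ex_duel {i j : ι} (hi : i ∈ F) (hj : j ∈ F) (hij : i ≠ j) :
    Ex F (fun ω => ind (¬ (ω i = false ∧ ω j = true))) = 3 / 4 := by
  simp only [ind_not, Ex_sub, Ex_const, ind_and]
  rw [Ex_mul_of_dep (dep_ind_coin i false) (dep_ind_coin j true) (by simpa using hij),
    Ex_coin hi, Ex_coin hj]
  norm_num

/-- The block `B` consists of heads, but none of the blocks `C x` does. -/
theorem le_Ex_contest {α : Type*} (X : Finset α) (B : Finset ι) (C : α → Finset ι) (l : ℕ)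
    (hB : B ⊆ F) (hC : ∀ x ∈ X, C x ⊆ F) (hBl : B.card = l) (hCl : ∀ x ∈ X, (C x).card = l)
    (hd : ∀ x ∈ X, Disjoint B (C x)) :
    (1 / 2) ^ l * (1 - X.card * (1 / 2) ^ l) ≤
      Ex F (fun ω => ind ((∀ i ∈ B, ω i = true) ∧ ∀ x ∈ X, ¬ ∀ i ∈ C x, ω i = true)) := by
  classical
  -- A Bonferroni bound: from the event that `B` is all heads, subtract for each `x` the event that
  -- `C x` is all heads as well.
  have h1 : ∀ ω : ι → Bool, ind (∀ i ∈ B, ω i = true) -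
      ∑ x ∈ X, ind (∀ i ∈ B ∪ C x, ω i = true) ≤
      ind ((∀ i ∈ B, ω i = true) ∧ ∀ x ∈ X, ¬ ∀ i ∈ C x, ω i = true) := by
    intro ω
    by_cases hb : ∀ i ∈ B, ω i = true
    · have h2 := ind_exists_le X fun x => ∀ i ∈ B ∪ C x, ω i = true
      rw [ind_of hb]
      by_cases hx : ∀ x ∈ X, ¬ ∀ i ∈ C x, ω i = true
      · rw [ind_of ⟨hb, hx⟩]
        have := Finset.sum_nonneg (s := X) fun x _ => ind_nonneg (∀ i ∈ B ∪ C x, ω i = true)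
        linarith
      · push Not at hx
        obtain ⟨x, hx, hx'⟩ := hx
        rw [ind_of ⟨x, hx, fun i hi => (Finset.mem_union.1 hi).elim (hb i) (hx' i)⟩] at h2
        have := ind_nonneg ((∀ i ∈ B, ω i = true) ∧ ∀ x ∈ X, ¬ ∀ i ∈ C x, ω i = true)
        linarith
    · rw [ind_of_not hb]
      have := Finset.sum_nonneg (s := X) fun x _ => ind_nonneg (∀ i ∈ B ∪ C x, ω i = true)
      have := ind_nonneg ((∀ i ∈ B, ω i = true) ∧ ∀ x ∈ X, ¬ ∀ i ∈ C x, ω i = true)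
      linarith
  refine le_trans (le_of_eq ?_) (Ex_mono h1)
  rw [Ex_sub, Ex_heads B hB, Ex_sum, hBl, Finset.sum_congr rfl fun x hx => by
    rw [Ex_heads (B ∪ C x) (Finset.union_subset hB (hC x hx)),
      Finset.card_union_of_disjoint (hd x hx), hBl, hCl x hx]]
  rw [Finset.sum_const, nsmul_eq_mul, pow_add]
  ring

end Averages

/-! ### The expected number of conflicts. -/

namespace RulerMIS

variable {V : Type} {G : SimpleGraph V} {S : Schedule V}

/-- The sample given by a table of coins. -/
def sample (ω : ℕ × V → Bool) : rulerMIS.Sample V := fun p _ => ω p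

/-- The coins tossed before round `t`. -/
def before (V : Type) (t : ℕ) : Set (ℕ × V) := {p | p.1 < t}

theorem before_subset {t t' : ℕ} (h : t ≤ t') : before V t ⊆ before V t' :=
  fun _ hp => lt_of_lt_of_le hp h

/-- Causality: the coins of round `t` first act on the states of round `t + 1`. Everything visible
at round `t` is therefore independent of the coins tossed from then on. -/
theorem st_congr {ω ω' : rulerMIS.Sample V} {t : ℕ} (h : ∀ p : ℕ × V, p.1 < t → ω p = ω' p) :
    st G S ω t = st G S ω' t := by
  induction t with
  | zero => rfl
  | succ t ih =>
    have h1 := ih fun p hp => h p (by omega)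
    have h2 : ∀ v, ω (t, v) = ω' (t, v) := fun v => h (t, v) (Nat.lt_succ_self t)
    have h3 : ∀ v, coin ω t v = coin ω' t v := fun v => congrFun (h2 v) (0 : Fin 1)
    funext v
    by_cases hv : S.Active t v
    · have h4 : ear G S ω t v = ear G S ω' t v := by
        rw [Bool.eq_iff_iff, ear_iff, ear_iff]
        simp only [Hrs, Bps, h1, h3]
      rw [st_succ hv, st_succ hv, h1, h3, h4]
    · rw [st_succ_of_not hv, st_succ_of_not hv]

theorem dep_st (t : ℕ) : Dep (before V t) fun ω => st G S (sample ω) t :=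
  fun _ _ h => st_congr fun p hp => funext fun _ => h p hp

theorem dep_mem (t : ℕ) (v : V) : Dep (before V t) fun ω => Mem G S (sample ω) t v :=
  fun ω ω' h => by
    have := dep_st (G := G) (S := S) t ω ω' h
    simp only [Mem, this]

theorem dep_conf (t : ℕ) (v : V) : Dep (before V t) fun ω => Conf G S (sample ω) t v :=
  fun ω ω' h => by simp only [Conf, fun u => dep_mem (G := G) (S := S) t u ω ω' h]

theorem dep_stable (t : ℕ) (v : V) :
    Dep (before V t) fun ω => rulerMIS.Stable G S (sample ω) t v := fun ω ω' h => by
  simp only [Algorithm.Stable, stableMIS_iff_mem, fun u => dep_mem (G := G) (S := S) t u ω ω' h]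

theorem Dep_ind {ι : Type*} {P : Set ι} {p : (ι → Bool) → Prop} (h : Dep P p) :
    Dep P fun ω => ind (p ω) := fun ω ω' hω => congrArg ind (h ω ω' hω)

theorem Dep_mul {ι : Type*} {P : Set ι} {f g : (ι → Bool) → ℝ} (hf : Dep P f) (hg : Dep P g) :
    Dep P fun ω => f ω * g ω := fun ω ω' h => congrArg₂ (· * ·) (hf ω ω' h) (hg ω ω' h)

/-- The coins tossed before round `N`. -/
def coins (V : Type) [Fintype V] (N : ℕ) : Finset (ℕ × V) := Finset.range N ×ˢ Finset.univ

theorem mem_coins [Fintype V] {N : ℕ} {p : ℕ × V} : p ∈ coins V N ↔ p.1 < N := by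
  simp [coins]

open Classical in
/-- The closed neighbourhood of a node. -/
noncomputable def nb [Fintype V] (G : SimpleGraph V) (v : V) : Finset V :=
  Finset.univ.filter fun w => v = w ∨ G.Adj v w

theorem mem_nb [Fintype V] {v w : V} : w ∈ nb G v ↔ v = w ∨ G.Adj v w := by simp [nb]

theorem self_mem_nb [Fintype V] (v : V) : v ∈ nb G v := mem_nb.2 (Or.inl rfl)

theorem mem_nb_comm [Fintype V] {v w : V} : w ∈ nb G v ↔ v ∈ nb G w := by
  rw [mem_nb, mem_nb, eq_comm, G.adj_comm]

/-- The coins of `v` in the headers of frames `k, …, k + g - 1`. -/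
def headers (k g : ℕ) (v : V) : Finset (ℕ × V) :=
  (Finset.range g).map ⟨fun i => (fs (k + i), v), fun i j h => by
    have : fs (k + i) = fs (k + j) := congrArg Prod.fst h
    unfold fs at this
    omega⟩

theorem mem_headers {k g : ℕ} {v : V} {p : ℕ × V} :
    p ∈ headers k g v ↔ ∃ i < g, (fs (k + i), v) = p := by
  simp only [headers, Finset.mem_map, Finset.mem_range]
  rfl

theorem card_headers (k g : ℕ) (v : V) : (headers k g v).card = g := by simp [headers]

theorem forall_headers {k g : ℕ} {v : V} {p : ℕ × V → Prop} :
    (∀ i ∈ headers k g v, p i) ↔ ∀ i < g, p (fs (k + i), v) := by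
  simp only [headers, Finset.forall_mem_map, Finset.mem_range]
  rfl

namespace Era

variable [Fintype V] {J a b N : ℕ} {W : (ℕ × V → Bool) → ℝ}

/-- In every round in which members toss coins, conflicts are resolved with probability at least
one fourth. -/
theorem conf_bout_le (E : Era G S J a b) {t : ℕ} (h1 : a ≤ t) (h2 : t < b) (hN : t < N)
    (hp : isBout (ph t) = true) (hW : Dep (before V t) W) (h0 : ∀ ω, 0 ≤ W ω) (w : V) :
    Ex (coins V N) (fun ω => W ω * ind (Conf G S (sample ω) (t + 1) w)) ≤
      3 / 4 * Ex (coins V N) fun ω => W ω * ind (Conf G S (sample ω) t w) := by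
  have hle : ∀ ω, W ω * ind (Conf G S (sample ω) (t + 1) w) ≤
      (W ω * ind (Conf G S (sample ω) t w)) * ind (ω (t, w) = true ∨
        ∀ u, G.Adj w u → Mem G S (sample ω) t u → ω (t, u) = false) := by
    intro ω
    rw [mul_assoc, ← ind_and]
    exact mul_le_mul_of_nonneg_left (ind_mono (E.conf_of_bout h1 h2 hp)) (h0 ω)
  refine (Ex_mono hle).trans (Ex_mul_le_const (P := before V t)
    (Dep_mul hW (Dep_ind (dep_conf t w))) (fun ω => mul_nonneg (h0 ω) (ind_nonneg _)) ?_)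
  intro ω hω
  have hc : Conf G S (sample ω) t w := by
    by_contra hc
    rw [ind_of_not hc, mul_zero] at hω
    exact hω.false
  -- Once the past is fixed, so is a rival `u`. The fresh coins remove `w` if it tosses tails
  -- against heads of `u`.
  obtain ⟨-, u, hwu, hu⟩ := hc
  have hne : ((t, w) : ℕ × V) ≠ (t, u) := fun h => hwu.ne (congrArg Prod.snd h)
  refine (Ex_mono fun ω' => ind_mono ?_).trans_eq
    (Ex_duel (F := coins V N) (mem_coins.2 hN) (mem_coins.2 hN) hne)
  have hm : ∀ z, merge (before V t) ω ω' (t, z) = ω' (t, z) := fun z =>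
    merge_of_notMem (lt_irrefl t)
  rintro h ⟨h3, h4⟩
  rw [hm] at h
  rcases h with h | h
  · rw [h3] at h
    exact absurd h (by decide)
  · have h5 := h u hwu (by rwa [(dep_mem t u).merge_eq])
    rw [hm, h4] at h5
    exact absurd h5 (by decide)

theorem conf_idle_le (E : Era G S J a b) {t : ℕ} (h1 : a ≤ t) (h2 : t < b)
    (hp : isBout (ph t) = false) (h35 : ph t ≠ 35) (h0 : ∀ ω, 0 ≤ W ω) (w : V) :
    Ex (coins V N) (fun ω => W ω * ind (Conf G S (sample ω) (t + 1) w)) ≤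
      Ex (coins V N) fun ω => W ω * ind (Conf G S (sample ω) t w) :=
  Ex_mono fun ω => mul_le_mul_of_nonneg_left
    (ind_mono (E.conf_of_not_bout h1 h2 hp h35)) (h0 ω)

/-- Conflicts rarely survive a frame. -/
theorem conf_frame_le (E : Era G S J a b) {k : ℕ} (h1 : a ≤ fs k) (h2 : fs k + 36 ≤ b)
    (hN : fs k + 36 ≤ N) (hW : Dep (before V (fs k)) W) (h0 : ∀ ω, 0 ≤ W ω) (w : V) :
    Ex (coins V N) (fun ω => W ω * ind (Conf G S (sample ω) (fs k + 28) w)) ≤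
      (3 / 4) ^ 12 * Ex (coins V N) fun ω => W ω * ind (Conf G S (sample ω) (fs k) w) := by
  have h3 : ∀ i ≤ 4, Ex (coins V N) (fun ω => W ω * ind (Conf G S (sample ω) (fs k + i) w)) ≤
      Ex (coins V N) fun ω => W ω * ind (Conf G S (sample ω) (fs k) w) := by
    intro i hi
    induction i with
    | zero => exact le_rfl
    | succ i ih =>
      have hp := ph_fs k i (by omega)
      exact (E.conf_idle_le (t := fs k + i) (by omega) (by omega)
        (by rw [hp]; simp [isBout]; omega) (by omega) h0 w).trans (ih (by omega))
  have h4 : ∀ i ≤ 12, Ex (coins V N)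
      (fun ω => W ω * ind (Conf G S (sample ω) (fs k + 4 + 2 * i) w)) ≤
      (3 / 4) ^ i * Ex (coins V N) fun ω => W ω * ind (Conf G S (sample ω) (fs k) w) := by
    intro i hi
    induction i with
    | zero => simpa using h3 4 le_rfl
    | succ i ih =>
      have hp := ph_fs k (4 + 2 * i) (by omega)
      have hp' := ph_fs k (4 + 2 * i + 1) (by omega)
      rw [← add_assoc] at hp
      rw [← add_assoc, ← add_assoc] at hp'
      have h5 := E.conf_idle_le (N := N) (t := fs k + 4 + 2 * i + 1) (by omega) (by omega)
        (by rw [hp']; simp [isBout]; omega) (by omega) h0 w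
      have h6 := E.conf_bout_le (N := N) (t := fs k + 4 + 2 * i) (by omega) (by omega) (by omega)
        (by rw [hp]; simp [isBout]; omega) (hW.mono (before_subset (by omega))) h0 w
      have h7 := ih (by omega)
      rw [show fs k + 4 + 2 * (i + 1) = fs k + 4 + 2 * i + 1 + 1 by ring, pow_succ]
      linarith
  exact h4 12 le_rfl

end Era

/-- By Bernoulli, `(1 - q) ^ n * (1 + n * q) ≤ (1 - q ^ 2) ^ n ≤ 1`. The bound is uniform in `n`,
which is why no process has to know its degree. -/
theorem mul_one_sub_pow_le {q : ℝ} (h0 : 0 < q) (h1 : q ≤ 1) (n : ℕ) :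
    n * (1 - q) ^ n ≤ 1 / q := by
  have h2 : (1 - q) ^ n * (1 + n * q) ≤ 1 := by
    calc (1 - q) ^ n * (1 + n * q) ≤ (1 - q) ^ n * (1 + q) ^ n :=
          mul_le_mul_of_nonneg_left (one_add_mul_le_pow (by linarith) n)
            (pow_nonneg (by linarith) n)
      _ = (1 - q ^ 2) ^ n := by rw [← mul_pow]; ring
      _ ≤ 1 := pow_le_one₀ (by nlinarith) (by nlinarith)
  have h3 : 0 ≤ (1 - q) ^ n := pow_nonneg (by linarith) n
  rw [le_div_iff₀ h0]
  nlinarith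

/-- The participating nodes in the closed neighbourhood of `v`. -/
noncomputable def act [Fintype V] (G : SimpleGraph V) (S : Schedule V) (a : ℕ) (v : V) :
    Finset V := open Classical in (nb G v).filter (S.Active a)

theorem mem_act [Fintype V] {a : ℕ} {v w : V} :
    w ∈ act G S a v ↔ w ∈ nb G v ∧ S.Active a w := by simp [act]

theorem act_subset [Fintype V] (a : ℕ) (v : V) : act G S a v ⊆ nb G v :=
  fun _ h => (mem_act.1 h).1

namespace Era

variable [Fintype V] {J a b N : ℕ} {W : (ℕ × V → Bool) → ℝ}

/-- A neighbour of `v` that starts finds nobody in the neighbourhood of `v` objecting. -/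
theorem tails_of_not_obj (E : Era G S J a b) {ω : rulerMIS.Sample V} {k g : ℕ} (h1 : a ≤ fs k)
    (h2 : fs (k + g) + 36 ≤ b) (hg : g = (k + g).gcd (2 ^ J)) (hk : ¬ 2 ^ J ∣ k + g) {v w : V}
    (hv : S.Active a v) (hw : w ∈ act G S a v) (hobj : ¬ Obj G S ω (k + g) w) :
    ∀ z ∈ act G S a v, ¬ ∀ i < g, coin ω (fs (k + 1 + i)) z = true := by
  intro z hz hheads
  have hle : fs k ≤ fs (k + g) := by unfold fs; omega
  have hza := (mem_act.1 hz).2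
  refine hobj ⟨v, z, mem_nb.1 (mem_nb_comm.1 (mem_act.1 hw).1), mem_nb.1 (mem_act.1 hz).1,
    (E.active _ (by omega) (by omega) v).2 hv, (E.active _ (by omega) (by omega) z).2 hza, ?_⟩
  have h3 := E.streak_of_heads h1 h2 hza hheads
  rw [draws, decide_eq_true_eq, E.gcd_eq (by omega) h2 hza hk, ← hg]
  exact h3

/-- The expected number of conflicts in the neighbourhood of `v`, from frame to frame. -/
theorem conf_sum_le (E : Era G S J a b) {k g s : ℕ} (h1 : a ≤ fs k)
    (h2 : fs (k + g) + 36 ≤ b) (hN : fs (k + g) + 36 ≤ N) (hg : g = (k + g).gcd (2 ^ J))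
    (hk : ¬ 2 ^ J ∣ k + g) {v : V} (hv : S.Active a v) (hs : s ≤ fs (k + 1))
    (hW : Dep (before V s) W) (h0 : ∀ ω, 0 ≤ W ω) :
    Ex (coins V N) (fun ω => W ω * ∑ w ∈ act G S a v, ind (Conf G S (sample ω) (fs (k + g + 1)) w))
      ≤ (3 / 4) ^ 12 * Ex (coins V N) (fun ω => W ω *
        ∑ w ∈ act G S a v, ind (Conf G S (sample ω) (fs (k + g)) w)) +
        2 ^ g * Ex (coins V N) W := by
  have hgpos : 0 < g := by
    rw [hg]
    exact Nat.gcd_pos_of_pos_right _ (by positivity)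
  have hle : fs (k + 1) ≤ fs (k + g) := by unfold fs; omega
  have hle' : fs k ≤ fs (k + g) := by unfold fs; omega
  set A := act G S a v with hA
  -- A single event `Q`, that nobody near `v` has a run of heads, is necessary for a start anywhere
  -- near `v`. This is the purpose of relaying objections to distance two.
  set Q : (ℕ × V → Bool) → Prop := fun ω => ∀ z ∈ A, ¬ ∀ i ∈ headers (k + 1) g z, ω i = true
    with hQ
  have key : ∀ ω, W ω * ∑ w ∈ A, ind (Conf G S (sample ω) (fs (k + g + 1)) w) ≤
      (∑ w ∈ A, W ω * ind (Conf G S (sample ω) (fs (k + g) + 28) w)) +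
        A.card * (W ω * ind (Q ω)) := by
    intro ω
    rw [← Finset.mul_sum, mul_left_comm, ← mul_add]
    refine mul_le_mul_of_nonneg_left ?_ (h0 ω)
    rw [← nsmul_eq_mul, ← Finset.sum_const, ← Finset.sum_add_distrib]
    refine Finset.sum_le_sum fun w hw => ?_
    refine le_trans (ind_mono fun hc => ?_) (ind_or_le _ _)
    refine (E.conf_end (by omega) h2 hc).imp id fun hobj => ?_
    have := E.tails_of_not_obj h1 h2 hg hk hv hw hobj
    intro z hz
    rw [forall_headers]
    exact this z hz
  have hpr : Ex (coins V N) (fun ω => W ω * ind (Q ω)) =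
      Ex (coins V N) W * (1 - (1 / 2) ^ g) ^ A.card := by
    have hQE : Ex (coins V N) (fun ω => ind (Q ω)) = (1 - (1 / 2) ^ g) ^ A.card := by
      rw [hQ, Ex_no_heads]
      · simp [card_headers]
      · intro z _ p hp
        obtain ⟨i, hi, rfl⟩ := mem_headers.1 hp
        refine mem_coins.2 ?_
        change fs (k + 1 + i) < N
        unfold fs at *
        omega
      · intro z _ z' _ hne
        rw [Finset.disjoint_left]
        intro p hp hp'
        obtain ⟨i, hi, rfl⟩ := mem_headers.1 hp
        obtain ⟨j, hj, h⟩ := mem_headers.1 hp'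
        exact hne (congrArg Prod.snd h).symm
    rw [← hQE]
    -- The relevant headers belong to frames from `k + 1` on, after all coins that determine `W`.
    refine Ex_mul_of_dep (Q := {p | s ≤ p.1}) hW (fun ω ω' h => ind_congr ?_) ?_
    · refine forall₂_congr fun z hz => not_congr (forall₂_congr fun p hp => ?_)
      obtain ⟨i, hi, rfl⟩ := mem_headers.1 hp
      rw [h]
      change s ≤ fs (k + 1 + i)
      unfold fs at *
      omega
    · rw [Set.disjoint_left]
      intro p hp hp'
      exact absurd (show p.1 < s from hp) (not_lt.2 hp')
  have hx := mul_one_sub_pow_le (q := (1 / 2) ^ g) (by positivity)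
    (pow_le_one₀ (by norm_num) (by norm_num)) A.card
  rw [one_div_pow, one_div_one_div] at hx
  have hWn : 0 ≤ Ex (coins V N) W := Ex_nonneg h0
  calc _ ≤ _ := Ex_mono key
    _ = (∑ w ∈ A, Ex (coins V N) fun ω => W ω * ind (Conf G S (sample ω) (fs (k + g) + 28) w)) +
        (A.card * (1 - (1 / 2) ^ g) ^ A.card) * Ex (coins V N) W := by
      rw [Ex_add, Ex_sum, Ex_mul_left, hpr]
      ring
    _ ≤ (∑ w ∈ A, (3 / 4) ^ 12 * Ex (coins V N)
          fun ω => W ω * ind (Conf G S (sample ω) (fs (k + g)) w)) +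
        2 ^ g * Ex (coins V N) W := by
      refine add_le_add (Finset.sum_le_sum fun w _ => ?_) ?_
      · exact E.conf_frame_le (by omega) h2 hN (hW.mono (before_subset (by omega))) h0 w
      · rw [one_div_pow]
        exact mul_le_mul_of_nonneg_right hx hWn
    _ = _ := by
      simp only [Finset.mul_sum, Ex_sum]

end Era

end RulerMIS

/-! ### From few conflicts to few unstable non-members. -/

namespace RulerMIS

variable {V : Type} {G : SimpleGraph V} {S : Schedule V}

theorem fs_mono {k l : ℕ} (h : k ≤ l) : fs k ≤ fs l := by
  unfold fs
  omega

/-- The participating node `v` is not stable. -/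
def Uns (G : SimpleGraph V) (S : Schedule V) (ω : rulerMIS.Sample V) (t : ℕ) (v : V) : Prop :=
  S.Active t v ∧ ¬ rulerMIS.Stable G S ω t v

theorem dep_uns (t : ℕ) (v : V) : Dep (before V t) fun ω => Uns G S (sample ω) t v :=
  fun ω ω' h => by simp only [Uns, dep_stable (G := G) (S := S) t v ω ω' h]

namespace Era

variable {J a b N d : ℕ} {W : (ℕ × V → Bool) → ℝ}

theorem uns_mono (E : Era G S J a b) {ω : rulerMIS.Sample V} {t t' : ℕ} (h1 : a ≤ t) (h2 : t ≤ t')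
    (h3 : t' ≤ b) {v : V} (h : Uns G S ω t' v) : Uns G S ω t v :=
  ⟨(E.active_iff (by omega) h3 h1 (by omega)).1 h.1, fun hs => h.2 <|
    hs.imp (E.stable_mono h1 h2 h3) fun ⟨u, hu, hs⟩ => ⟨u, hu, E.stable_mono h1 h2 h3 hs⟩⟩

variable [Fintype V]

/-- The budget `3 * 2 ^ j` is halved in every frame, `j` being one less than the number of frames
left until the next one after the coming multiple of `2 ^ J`. The start is covered by the degree
bound, as the budget then exceeds `2 ^ 2 ^ J`. The weight `W` carries information from the beginning
of the period, such as instability and degree of `v`. -/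
theorem conf_iter (E : Era G S J a b) {k : ℕ} (h1 : a ≤ fs (k * 2 ^ J))
    (h2 : fs ((k + 1) * 2 ^ J + 1) ≤ b) (hN : fs ((k + 1) * 2 ^ J + 1) ≤ N)
    (hcard : ∀ v, (nb G v).card ≤ d + 1) (hd : (d + 2) ^ 5 ≤ 2 ^ 2 ^ J) {v : V}
    (hv : S.Active a v) (hW : Dep (before V (fs (k * 2 ^ J + 1))) W) (h0 : ∀ ω, 0 ≤ W ω)
    {i j : ℕ} (hij : i + j + 1 = 2 ^ J) :
    Ex (coins V N) (fun ω => W ω *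
      ∑ w ∈ act G S a v, ind (Conf G S (sample ω) (fs (k * 2 ^ J + 1 + i)) w)) ≤
        3 * 2 ^ j * Ex (coins V N) W := by
  have hWn : 0 ≤ Ex (coins V N) W := Ex_nonneg h0
  induction i generalizing j with
  | zero =>
    have hc : ((act G S a v).card : ℝ) ≤ 3 * 2 ^ j := by
      have h3 : (act G S a v).card ≤ 2 ^ 2 ^ J := by
        refine (Finset.card_le_card (act_subset a v)).trans ((hcard v).trans (le_trans ?_ hd))
        exact (by omega : d + 1 ≤ d + 2).trans (Nat.le_self_pow (by norm_num) _)
      rw [← hij, zero_add, pow_succ] at h3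
      have h4 : ((act G S a v).card : ℝ) ≤ 2 ^ j * 2 := by exact_mod_cast h3
      have : (0 : ℝ) ≤ 2 ^ j := by positivity
      linarith
    refine le_trans (Ex_mono (g := fun ω => W ω * (act G S a v).card) fun ω =>
      mul_le_mul_of_nonneg_left ?_ (h0 ω)) ?_
    · calc _ ≤ ∑ _w ∈ act G S a v, (1 : ℝ) := Finset.sum_le_sum fun w _ => ind_le_one _
        _ = _ := by simp
    · rw [Ex_mul_right, mul_comm]
      exact mul_le_mul_of_nonneg_right hc hWn
  | succ i ih =>
    have h3 := ih (j := j + 1) (by omega)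
    set q := k * 2 ^ J with hq
    have hq' : (k + 1) * 2 ^ J = q + 2 ^ J := by ring
    rw [hq'] at h2 hN
    set g := (q + 1 + i).gcd (2 ^ J) with hg
    have hg1 : g ∣ q + 1 + i := Nat.gcd_dvd_left _ _
    have hg2 : g ∣ 2 ^ J := Nat.gcd_dvd_right _ _
    -- The power of two `g` divides the distances of this frame to both neighbouring multiples of `2
    -- ^ J`. By the first bound the `g` relevant coins come after those that determine `W`; by the
    -- second, `hg4`, the new conflicts fit into the budget.
    have hg3 : g ≤ i + 1 := by
      refine Nat.le_of_dvd (by omega) ((Nat.dvd_add_right (hg2.mul_left k)).1 ?_)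
      rwa [← hq, ← add_assoc, add_right_comm]
    have hg4 : g ≤ j + 1 := by
      refine Nat.le_of_dvd (by omega) ((Nat.dvd_add_right hg1).1 ?_)
      rw [show q + 1 + i + (j + 1) = q + 2 ^ J by omega]
      exact dvd_add (hg2.mul_left k) hg2
    have hnd : ¬ 2 ^ J ∣ q + 1 + i := by
      intro h
      have : 2 ^ J ∣ i + 1 := by
        refine (Nat.dvd_add_right (dvd_mul_left (2 ^ J) k)).1 ?_
        rwa [← hq, ← add_assoc, add_right_comm]
      exact absurd (Nat.le_of_dvd (by omega) this) (by omega)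
    have he : q + 1 + i - g + g = q + 1 + i := by omega
    have hfs : fs (q + 1 + i) + 36 ≤ fs (q + 2 ^ J + 1) := by unfold fs; omega
    have hfs' : fs q ≤ fs (q + 1 + i - g) := by unfold fs; omega
    have hfs'' : fs (q + 1) ≤ fs (q + 1 + i - g + 1) := by unfold fs; omega
    have h4 := E.conf_sum_le (N := N) (k := q + 1 + i - g) (g := g) (s := fs (q + 1))
      (h1.trans hfs') (by rw [he]; omega) (by rw [he]; omega) (by rw [he]) (by rwa [he]) hv
      hfs'' hW h0
    rw [he] at h4
    rw [show q + 1 + (i + 1) = q + 1 + i + 1 by ring]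
    have h5 : (2 : ℝ) ^ g ≤ 2 ^ (j + 1) := pow_le_pow_right₀ (by norm_num) hg4
    have h6 := mul_le_mul_of_nonneg_right h5 hWn
    have h7 : (0 : ℝ) ≤ 2 ^ j * Ex (coins V N) W := by positivity
    rw [pow_succ] at h3 h6
    -- The numerical fact is `6 * (3/4) ^ 12 + 2 ≤ 3`.
    norm_num at h3 h4 h6 ⊢
    nlinarith

/-- An objection in a frame that is a multiple of `2 ^ J` needs a long run of heads. -/
theorem obj_le (E : Era G S J a b) {k : ℕ} (h1 : a ≤ fs (k * 2 ^ J))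
    (h2 : fs ((k + 1) * 2 ^ J + 1) ≤ b) (ω : ℕ × V → Bool) (v : V) :
    ind (Obj G S (sample ω) ((k + 1) * 2 ^ J) v) ≤ ∑ u ∈ nb G v, ∑ z ∈ nb G u,
      ind (∀ p ∈ headers (k * 2 ^ J + 1) (2 ^ J) z, ω p = true) := by
  refine le_trans (ind_mono ?_) ((ind_exists_le (nb G v) fun u => ∃ z ∈ nb G u,
    ∀ p ∈ headers (k * 2 ^ J + 1) (2 ^ J) z, ω p = true).trans
      (Finset.sum_le_sum fun u _ => ind_exists_le _ _))
  rintro ⟨u, z, hu, hz, -, hza, hdr⟩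
  have e : (k + 1) * 2 ^ J = k * 2 ^ J + 2 ^ J := by ring
  have hle : fs ((k + 1) * 2 ^ J) + 36 = fs ((k + 1) * 2 ^ J + 1) := by unfold fs; omega
  have hle' : fs (k * 2 ^ J) ≤ fs ((k + 1) * 2 ^ J) := 
    fs_mono (Nat.mul_le_mul_right _ (Nat.le_succ k))
  have hza' := (E.active _ (by omega) (by omega) z).1 hza
  rw [draws, decide_eq_true_eq] at hdr
  have h3 := (E.le_gcd (ω := sample ω) (by omega) (by omega) hza' (dvd_mul_left _ _)).trans hdr
  rw [e] at h3 hle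
  refine ⟨u, mem_nb.2 hu, z, mem_nb.2 hz, forall_headers.2 ?_⟩
  exact E.heads_of_streak h1 (by rw [hle, ← e]; exact h2) hza' h3

/-- An unstable node becomes a member with probability at least three fourths. -/
theorem not_mem_le (E : Era G S J a b) {k : ℕ} (h1 : a ≤ fs (k * 2 ^ J))
    (h2 : fs ((k + 1) * 2 ^ J + 1) ≤ b) (hN : fs ((k + 1) * 2 ^ J + 1) ≤ N)
    (hcard : ∀ v, (nb G v).card ≤ d + 1) (hd : (d + 2) ^ 5 ≤ 2 ^ 2 ^ J) {v : V}
    (hv : S.Active a v) (hW : Dep (before V (fs (k * 2 ^ J + 1))) W) (h0 : ∀ ω, 0 ≤ W ω) :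
    Ex (coins V N) (fun ω => W ω * ind (Uns G S (sample ω) (fs ((k + 1) * 2 ^ J + 1)) v ∧
      ¬ Mem G S (sample ω) (fs ((k + 1) * 2 ^ J + 1)) v)) ≤ 1 / 4 * Ex (coins V N) W := by
  set K := (k + 1) * 2 ^ J with hK
  have hpos : 0 < 2 ^ J := by positivity
  have e : K = k * 2 ^ J + 2 ^ J := by rw [hK]; ring
  have hfs : fs K + 36 = fs (K + 1) := by unfold fs; omega
  have haK : a ≤ fs K := h1.trans (by unfold fs; omega)
  have hWn : 0 ≤ Ex (coins V N) W := Ex_nonneg h0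
  set H : V → (ℕ × V → Bool) → Prop := fun z ω =>
    ∀ p ∈ headers (k * 2 ^ J + 1) (2 ^ J) z, ω p = true with hH
  have key : ∀ ω, W ω * ind (Uns G S (sample ω) (fs (K + 1)) v ∧ ¬ Mem G S (sample ω) (fs (K + 1)) v)
      ≤ (∑ w ∈ act G S a v, W ω * ind (Conf G S (sample ω) (fs K + 28) w)) +
        ∑ u ∈ nb G v, ∑ z ∈ nb G u, W ω * ind (H z ω) := by
    intro ω
    simp only [← Finset.mul_sum]
    rw [← mul_add]
    refine mul_le_mul_of_nonneg_left ?_ (h0 ω)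
    refine le_trans (le_trans (ind_mono ?_) (ind_or_le _ _)) (add_le_add (ind_exists_le _ _)
      (E.obj_le h1 h2 ω v))
    rintro ⟨⟨-, hs⟩, hm⟩
    rw [E.mem_end haK (by omega) hv] at hm
    push Not at hm
    obtain ⟨hm1, hm2⟩ := hm
    -- A member neighbour without conflict would make `v` stable; without any member neighbour, only
    -- an objection keeps `v` from starting.
    by_cases hn : ∃ u, G.Adj v u ∧ Mem G S (sample ω) (fs K + 28) u
    · left
      obtain ⟨u, hvu, hu⟩ := hn
      refine ⟨u, mem_act.2 ⟨mem_nb.2 (Or.inr hvu), (E.active _ (by omega) (by omega) u).1 hu.1⟩,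
        hu, ?_⟩
      by_contra hc
      push Not at hc
      exact hs (Or.inr ⟨u, hvu, E.stable_mono (by omega) (by omega) h2
        (stableMIS_iff_mem.2 ⟨hu, hc⟩)⟩)
    · right
      push Not at hn
      exact hm2 hn
  -- At `j = 0` the budget is 3, and the bouts of frame `K` leave `3 * (3/4) ^ 12 ≤ 1/8` of it.
  have hc : ∑ w ∈ act G S a v, Ex (coins V N)
      (fun ω => W ω * ind (Conf G S (sample ω) (fs K + 28) w)) ≤ 1 / 8 * Ex (coins V N) W := by
    have h3 := E.conf_iter h1 h2 hN hcard hd hv hW h0 (i := 2 ^ J - 1) (j := 0) (by omega)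
    rw [show k * 2 ^ J + 1 + (2 ^ J - 1) = K by omega] at h3
    simp only [Finset.mul_sum, Ex_sum] at h3
    refine le_trans (Finset.sum_le_sum fun w _ => E.conf_frame_le haK (by omega) (by omega)
      (hW.mono (before_subset (by unfold fs; omega))) h0 w) ?_
    rw [← Finset.mul_sum]
    norm_num at h3 ⊢
    linarith
  have ho : ∑ u ∈ nb G v, ∑ z ∈ nb G u, Ex (coins V N) (fun ω => W ω * ind (H z ω)) ≤
      1 / 8 * Ex (coins V N) W := by
    have h3 : ∀ z, Ex (coins V N) (fun ω => W ω * ind (H z ω)) =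
        Ex (coins V N) W * (1 / 2) ^ 2 ^ J := by
      intro z
      have h4 := Ex_heads (F := coins V N) (headers (k * 2 ^ J + 1) (2 ^ J) z) ?_
      · rw [card_headers] at h4
        rw [← h4]
        refine Ex_mul_of_dep (Q := {p | fs (k * 2 ^ J + 1) ≤ p.1}) hW (fun ω ω' h => ind_congr ?_) ?_
        · refine forall₂_congr fun p hp => ?_
          obtain ⟨i, hi, rfl⟩ := mem_headers.1 hp
          rw [h]
          change fs (k * 2 ^ J + 1) ≤ fs (k * 2 ^ J + 1 + i)
          unfold fs
          omega
        · rw [Set.disjoint_left]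
          intro p hp hp'
          exact absurd (show p.1 < _ from hp) (not_lt.2 hp')
      · intro p hp
        obtain ⟨i, hi, rfl⟩ := mem_headers.1 hp
        refine mem_coins.2 ?_
        change fs (k * 2 ^ J + 1 + i) < N
        unfold fs at *
        omega
    simp only [h3, Finset.sum_const, nsmul_eq_mul]
    have h5 : (∑ u ∈ nb G v, ((nb G u).card : ℝ)) ≤ (d + 1) * (d + 1) := by
      calc (∑ u ∈ nb G v, ((nb G u).card : ℝ)) ≤ ∑ _u ∈ nb G v, ((d : ℝ) + 1) :=
            Finset.sum_le_sum fun u _ => by exact_mod_cast hcard u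
        _ = (nb G v).card * ((d : ℝ) + 1) := by rw [Finset.sum_const, nsmul_eq_mul]
        _ ≤ _ := by
          refine mul_le_mul_of_nonneg_right ?_ (by positivity)
          exact_mod_cast hcard v
    -- There are at most `(d + 1) ^ 2` walks to possible objectors. The exponent 5 in `hd` leaves
    -- `(d + 2) ^ 3 ≥ 8` to spare.
    have h6 : ((d : ℝ) + 1) * (d + 1) * (1 / 2) ^ 2 ^ J ≤ 1 / 8 := by
      have h7 : ((d : ℝ) + 2) ^ 5 ≤ 2 ^ 2 ^ J := by exact_mod_cast hd
      have h8 : (8 : ℝ) * ((d + 1) * (d + 1)) ≤ (d + 2) ^ 5 := by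
        have : (0 : ℝ) ≤ d := Nat.cast_nonneg d
        have h9 : (2 : ℝ) ^ 3 ≤ (d + 2) ^ 3 := pow_le_pow_left₀ (by norm_num) (by linarith) 3
        calc (8 : ℝ) * ((d + 1) * (d + 1)) ≤ (d + 2) ^ 3 * ((d + 2) * (d + 2)) := by
              refine mul_le_mul (by linarith) (by nlinarith) (by positivity) (by positivity)
          _ = _ := by ring
      rw [one_div_pow, mul_one_div, div_le_div_iff₀ (by positivity) (by norm_num)]
      linarith
    rw [← Finset.sum_mul, mul_left_comm, mul_comm (1 / 8 : ℝ)]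
    refine mul_le_mul_of_nonneg_left (le_trans ?_ h6) hWn
    exact mul_le_mul_of_nonneg_right h5 (by positivity)
  refine (Ex_mono key).trans ?_
  rw [Ex_add, Ex_sum, Ex_sum]
  simp only [Ex_sum]
  linarith

end Era

end RulerMIS

/-! ### The potential and the probability of winning. -/

namespace RulerMIS

variable {V : Type} {G : SimpleGraph V} {S : Schedule V}

theorem ph_bout {k j : ℕ} (hj : j < 12) :
    isBout (ph (fs k + 4 + 2 * j)) = true := by
  have := ph_fs k (4 + 2 * j) (by omega)
  rw [← add_assoc] at this
  rw [this]
  simp [isBout]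
  omega

/-- The coins of `v` in the bouts of frames `k, …, k + h - 1`. -/
def bouts (k h : ℕ) (v : V) : Finset (ℕ × V) :=
  (Finset.univ : Finset (Fin h × Fin 12)).map
    ⟨fun p => (fs (k + p.1) + 4 + 2 * p.2, v), fun p q hpq => by
      have h1 : fs (k + p.1) + 4 + 2 * p.2 = fs (k + q.1) + 4 + 2 * q.2 := congrArg Prod.fst hpq
      have h2 := p.2.2
      have h3 := q.2.2
      unfold fs at h1
      exact Prod.ext (Fin.ext (by omega)) (Fin.ext (by omega))⟩

theorem mem_bouts {k h : ℕ} {v : V} {p : ℕ × V} :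
    p ∈ bouts k h v ↔ fs k ≤ p.1 ∧ p.1 < fs (k + h) ∧ isBout (ph p.1) = true ∧ p.2 = v := by
  simp only [bouts, Finset.mem_map, Finset.mem_univ, true_and]
  constructor
  · rintro ⟨⟨i, j⟩, rfl⟩
    have hi := i.2
    have hj := j.2
    refine ⟨(?_ : fs k ≤ fs (k + i) + 4 + 2 * j), (?_ : fs (k + i) + 4 + 2 * j < fs (k + h)),
      ph_bout hj, rfl⟩ <;> unfold fs <;> omega
  · rcases p with ⟨t, w⟩
    rintro ⟨h1, h2, h3, rfl⟩
    simp only at h1 h2 h3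
    simp only [isBout, Bool.and_eq_true, decide_eq_true_eq] at h3
    unfold ph at h3
    unfold fs at h1 h2
    refine ⟨(⟨(t - 74) / 36 - k, by omega⟩, ⟨((t - 74) % 36 - 4) / 2, by omega⟩), ?_⟩
    refine Prod.ext ?_ rfl
    change fs (k + ((t - 74) / 36 - k)) + 4 + 2 * (((t - 74) % 36 - 4) / 2) = t
    unfold fs
    omega

theorem card_bouts (k h : ℕ) (v : V) : (bouts k h v).card = 12 * h := by
  simp [bouts, mul_comm]

variable [Fintype V]

open Classical in
/-- The number of unstable nodes in the closed neighbourhood of `v`. -/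
noncomputable def deg (G : SimpleGraph V) (S : Schedule V) (ω : rulerMIS.Sample V) (t : ℕ) (v : V) :
    ℕ := ((nb G v).filter (Uns G S ω t)).card

/-- The number of ordered pairs of unstable nodes that are equal or adjacent. -/
noncomputable def pot (G : SimpleGraph V) (S : Schedule V) (ω : rulerMIS.Sample V) (t : ℕ) : ℝ :=
  ∑ v, ind (Uns G S ω t v) * deg G S ω t v

theorem deg_eq_sum (ω : rulerMIS.Sample V) (t : ℕ) (v : V) :
    (deg G S ω t v : ℝ) = ∑ w ∈ nb G v, ind (Uns G S ω t w) := by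
  classical
  rw [deg, Finset.card_filter, Nat.cast_sum]
  exact Finset.sum_congr rfl fun w _ => by by_cases h : Uns G S ω t w <;> simp [ind, h]

theorem deg_le_card (ω : rulerMIS.Sample V) (t : ℕ) (v : V) : deg G S ω t v ≤ (nb G v).card := by
  classical
  exact Finset.card_le_card (Finset.filter_subset _ _)

theorem deg_pos {ω : rulerMIS.Sample V} {t : ℕ} {v : V} (h : Uns G S ω t v) :
    0 < deg G S ω t v := by
  classical
  exact Finset.card_pos.2 ⟨v, Finset.mem_filter.2 ⟨self_mem_nb v, h⟩⟩

theorem dep_deg (t : ℕ) (v : V) : Dep (before V t) fun ω => deg G S (sample ω) t v :=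
  fun ω ω' h => by
    classical
    exact congrArg Finset.card (Finset.filter_congr fun u _ =>
      iff_of_eq (dep_uns (G := G) (S := S) t u ω ω' h))

theorem pot_nonneg (ω : rulerMIS.Sample V) (t : ℕ) : 0 ≤ pot G S ω t :=
  Finset.sum_nonneg fun _ _ => mul_nonneg (ind_nonneg _) (Nat.cast_nonneg _)

theorem pot_le (ω : rulerMIS.Sample V) (t : ℕ) : pot G S ω t ≤ (Fintype.card V : ℝ) ^ 2 := by
  rw [sq]
  calc pot G S ω t ≤ ∑ _v : V, (Fintype.card V : ℝ) := by
        refine Finset.sum_le_sum fun v _ => ?_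
        have h1 : (deg G S ω t v : ℝ) ≤ Fintype.card V := by
          exact_mod_cast (deg_le_card ω t v).trans (Finset.card_le_univ _)
        calc _ ≤ 1 * (deg G S ω t v : ℝ) :=
              mul_le_mul_of_nonneg_right (ind_le_one _) (Nat.cast_nonneg _)
          _ ≤ _ := by rwa [one_mul]
    _ = _ := by rw [Finset.sum_const, nsmul_eq_mul, Finset.card_univ]

theorem one_le_pot {ω : rulerMIS.Sample V} {t : ℕ} (h : ¬ rulerMIS.AllStable G S ω t) :
    1 ≤ pot G S ω t := by
  unfold Algorithm.AllStable at h
  push Not at h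
  obtain ⟨v, hv⟩ := h
  have h1 : Uns G S ω t v := hv
  have h2 : (1 : ℝ) ≤ deg G S ω t v := by exact_mod_cast deg_pos h1
  refine le_trans ?_ (Finset.single_le_sum (f := fun v => ind (Uns G S ω t v) * deg G S ω t v)
    (fun _ _ => mul_nonneg (ind_nonneg _) (Nat.cast_nonneg _)) (Finset.mem_univ v))
  rw [ind_of h1, one_mul]
  exact h2

/-- The number of frames that `v` needs to win with respect to `w`. -/
noncomputable def span (G : SimpleGraph V) (S : Schedule V) (ω : rulerMIS.Sample V) (t : ℕ)
    (v w : V) : ℕ := Nat.clog (2 ^ 12) (2 * (deg G S ω t v + deg G S ω t w))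

open Classical in
/-- The members near `v` or `w`, except for `v`. -/
noncomputable def rivals (G : SimpleGraph V) (S : Schedule V) (ω : rulerMIS.Sample V) (t : ℕ)
    (v w : V) : Finset V := ((nb G v ∪ nb G w).filter (Mem G S ω t)).erase v

/-- From frame `k` on, `v` tosses heads until all members near `v` or `w` have tossed tails. -/
def Win (G : SimpleGraph V) (S : Schedule V) (ω : ℕ × V → Bool) (k : ℕ) (v w : V) : Prop :=
  (∀ p ∈ bouts k (span G S (sample ω) (fs k) v w) v, ω p = true) ∧
    ∀ x ∈ rivals G S (sample ω) (fs k) v w,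
      ¬ ∀ p ∈ bouts k (span G S (sample ω) (fs k) v w) x, ω p = true

theorem mem_rivals {ω : rulerMIS.Sample V} {t : ℕ} {v w x : V} :
    x ∈ rivals G S ω t v w ↔ x ≠ v ∧ (x ∈ nb G v ∨ x ∈ nb G w) ∧ Mem G S ω t x := by
  simp [rivals]

/-- A stable member would make `w` stable, and a member cannot owe its stability to a member
neighbour. So rivals near unstable nodes are unstable and are counted by the degrees. -/
theorem uns_of_mem {ω : rulerMIS.Sample V} {t : ℕ} {v w : V} (hw : Uns G S ω t w)
    (hvw : v ∈ nb G w) (hv : Mem G S ω t v) : Uns G S ω t v := by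
  refine ⟨hv.1, fun hs => ?_⟩
  rcases hs with hs | ⟨u, hvu, hs⟩
  · rcases mem_nb.1 hvw with rfl | hvw
    · exact hw.2 (Or.inl hs)
    · exact hw.2 (Or.inr ⟨v, hvw, hs⟩)
  · exact (stableMIS_iff_mem.1 hs).2 v hvu.symm hv

theorem card_rivals_le {ω : rulerMIS.Sample V} {t : ℕ} {v w : V} (hv : Uns G S ω t v)
    (hw : Uns G S ω t w) : (rivals G S ω t v w).card ≤ deg G S ω t v + deg G S ω t w := by
  classical
  refine le_trans (Finset.card_le_card ?_) (Finset.card_union_le _ _)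
  intro x hx
  obtain ⟨-, hx, hm⟩ := mem_rivals.1 hx
  rw [Finset.mem_union, Finset.mem_filter, Finset.mem_filter]
  exact hx.imp (fun h => ⟨h, uns_of_mem hv h hm⟩) fun h => ⟨h, uns_of_mem hw h hm⟩

namespace Era

variable {J a b N d : ℕ}

theorem span_le (hcard : ∀ v, (nb G v).card ≤ d + 1) (hd : (d + 2) ^ 5 ≤ 2 ^ 2 ^ J)
    (ω : rulerMIS.Sample V) (t : ℕ) (v w : V) : span G S ω t v w ≤ 2 ^ J := by
  refine Nat.clog_le_of_le_pow ?_
  have h1 := (deg_le_card (G := G) (S := S) ω t v).trans (hcard v)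
  have h2 := (deg_le_card (G := G) (S := S) ω t w).trans (hcard w)
  have h3 : 4 * (d + 1) ≤ (d + 2) ^ 5 := by
    have : 2 ^ 4 ≤ (d + 2) ^ 4 := Nat.pow_le_pow_left (by omega) 4
    calc 4 * (d + 1) ≤ (d + 2) ^ 4 * (d + 2) := Nat.mul_le_mul (by omega) (by omega)
      _ = _ := by ring
  have h4 : 2 ^ 2 ^ J ≤ (2 ^ 12) ^ 2 ^ J := Nat.pow_le_pow_left (by norm_num) _
  omega

theorem stable_of_win (E : Era G S J a b) {ω : ℕ × V → Bool} {k : ℕ} {v w : V} (h1 : a ≤ fs k)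
    (h2 : fs (k + span G S (sample ω) (fs k) v w) ≤ b) (hv : Mem G S (sample ω) (fs k) v)
    (hwin : Win G S ω k v w) :
    rulerMIS.StableMIS G S (sample ω) (fs (k + span G S (sample ω) (fs k) v w)) v := by
  refine E.wins h1 h2 hv (fun t t1 t2 t3 => hwin.1 (t, v) (mem_bouts.2 ⟨t1, t2, t3, rfl⟩))
    fun u hvu hu => ?_
  have h3 := hwin.2 u (mem_rivals.2 ⟨hvu.ne', Or.inl (mem_nb.2 (Or.inr hvu)), hu⟩)
  push Not at h3
  obtain ⟨⟨t, x⟩, hp, hc⟩ := h3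
  obtain ⟨t1, t2, t3, t4⟩ := mem_bouts.1 hp
  simp only at t1 t2 t3 t4
  subst t4
  exact ⟨t, t1, t2, t3, (Bool.not_eq_true _).mp hc⟩

/-- The probability of winning is inversely proportional to the degrees. -/
theorem le_win {ω : ℕ × V → Bool} {k : ℕ} {v w : V}
    (hcard : ∀ v, (nb G v).card ≤ d + 1) (hd : (d + 2) ^ 5 ≤ 2 ^ 2 ^ J)
    (hN : fs (k + 2 ^ J) ≤ N) (hv : Uns G S (sample ω) (fs k) v) (hw : Uns G S (sample ω) (fs k) w) :
    1 / 16384 * (1 / ((deg G S (sample ω) (fs k) v : ℝ) + deg G S (sample ω) (fs k) w)) ≤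
      Ex (coins V N) fun ω' => ind (Win G S (merge (before V (fs k)) ω ω') k v w) := by
  classical
  set h := span G S (sample ω) (fs k) v w with hh
  set X := rivals G S (sample ω) (fs k) v w with hX
  set D := deg G S (sample ω) (fs k) v + deg G S (sample ω) (fs k) w with hD
  have hspan : h ≤ 2 ^ J := span_le hcard hd _ _ _ _
  have hm : ∀ ω', Win G S (merge (before V (fs k)) ω ω') k v w ↔
      ((∀ p ∈ bouts k h v, ω' p = true) ∧ ∀ x ∈ X, ¬ ∀ p ∈ bouts k h x, ω' p = true) := by
    intro ω'
    have e1 : span G S (sample (merge (before V (fs k)) ω ω')) (fs k) v w = h := by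
      rw [hh, span, span, (dep_deg (fs k) v).merge_eq, (dep_deg (fs k) w).merge_eq]
    have e2 : rivals G S (sample (merge (before V (fs k)) ω ω')) (fs k) v w = X := by
      ext x
      rw [hX, mem_rivals, mem_rivals, (dep_mem (fs k) x).merge_eq]
    have e3 : ∀ x, ∀ p ∈ bouts k h x, merge (before V (fs k)) ω ω' p = ω' p := fun x p hp =>
      merge_of_notMem (not_lt.2 (mem_bouts.1 hp).1)
    rw [Win, e1, e2]
    exact and_congr (forall₂_congr fun p hp => by rw [e3 v p hp])
      (forall₂_congr fun x _ => not_congr (forall₂_congr fun p hp => by rw [e3 x p hp]))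
  have hsub : ∀ x, bouts k h x ⊆ coins V N := by
    intro x p hp
    have := (mem_bouts.1 hp).2.1
    exact mem_coins.2 (this.trans_le ((fs_mono (Nat.add_le_add_left hspan k)).trans hN))
  simp only [hm]
  refine le_trans ?_ (le_Ex_contest X (bouts k h v) (bouts k h) (12 * h) (hsub v)
    (fun x _ => hsub x) (card_bouts _ _ _) (fun x _ => card_bouts _ _ _) ?_)
  · have hDpos : 0 < D := Nat.add_pos_left (deg_pos hv) _
    -- With `h1` and `h2`, the `12 * h` coins put `2 ^ (12 * h)` between `2 * D` and `8192 * D`: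
    -- each rival survives with probability at most `1 / (2 * D)`, and `v` tosses only heads with
    -- probability at least `1 / (8192 * D)`. This is the origin of 16384.
    have h1 : 2 * D ≤ (2 ^ 12) ^ h := Nat.le_pow_clog (by norm_num) _
    have h2 : (2 ^ 12) ^ h ≤ 2 ^ 12 * (2 * D) := by
      have h3 : (2 ^ 12) ^ (h - 1) < 2 * D := Nat.pow_pred_clog_lt_self (by norm_num) (by omega)
      have h4 : 0 < h := Nat.clog_pos (by norm_num) (by omega)
      calc (2 ^ 12) ^ h = 2 ^ 12 * (2 ^ 12) ^ (h - 1) := by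
            rw [← pow_succ', Nat.sub_add_cancel h4]
        _ ≤ _ := Nat.mul_le_mul_left _ h3.le
    have hXD : X.card ≤ D := card_rivals_le hv hw
    have hDr : (0 : ℝ) < D := by exact_mod_cast hDpos
    have h1' : 2 * (D : ℝ) ≤ 2 ^ (12 * h) := by rw [pow_mul]; exact_mod_cast h1
    have h2' : (2 : ℝ) ^ (12 * h) ≤ 8192 * D := by
      have : ((2 ^ 12) ^ h : ℝ) ≤ 2 ^ 12 * (2 * D) := by exact_mod_cast h2
      rw [pow_mul]
      linarith
    have hX' : (X.card : ℝ) ≤ D := by exact_mod_cast hXD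
    have hp : (0 : ℝ) < 2 ^ (12 * h) := by positivity
    have h5 : (1 : ℝ) / 2 ≤ 1 - X.card * (1 / 2) ^ (12 * h) := by
      rw [one_div_pow, mul_one_div]
      have : (X.card : ℝ) / 2 ^ (12 * h) ≤ 1 / 2 := by
        rw [div_le_div_iff₀ hp (by norm_num)]
        linarith
      linarith
    have hcast : (deg G S (sample ω) (fs k) v : ℝ) + deg G S (sample ω) (fs k) w = D := by
      rw [hD]; push_cast; rfl
    rw [hcast]
    calc 1 / 16384 * (1 / (D : ℝ)) = 1 / (8192 * D) * (1 / 2) := by field_simp; norm_num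
      _ ≤ 1 / 2 ^ (12 * h) * (1 / 2) := by gcongr
      _ = (1 / 2) ^ (12 * h) * (1 / 2) := by rw [one_div_pow]
      _ ≤ _ := mul_le_mul_of_nonneg_left h5 (by positivity)
  · intro x hx
    rw [Finset.disjoint_left]
    intro p hp hp'
    exact (mem_rivals.1 hx).1 ((mem_bouts.1 hp').2.2.2.symm.trans (mem_bouts.1 hp).2.2.2)

end Era

end RulerMIS

/-! ### Contraction of the potential. -/

namespace RulerMIS

variable {V : Type} {G : SimpleGraph V} {S : Schedule V} [Fintype V]

/-- The number of ordered pairs as in `pot` whose first entry is not a member. -/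
noncomputable def lag (G : SimpleGraph V) (S : Schedule V) (ω : rulerMIS.Sample V) (t : ℕ) : ℝ :=
  ∑ v, ind (Uns G S ω t v ∧ ¬ Mem G S ω t v) * deg G S ω t v

/-- The weight of the pair `(v, w)` in the analysis of a step of the algorithm. -/
noncomputable def gain (G : SimpleGraph V) (S : Schedule V) (ω : rulerMIS.Sample V) (t : ℕ)
    (v w : V) : ℝ :=
  ind (Uns G S ω t w ∧ Uns G S ω t v ∧ Mem G S ω t v) * deg G S ω t w

theorem ind_mul_deg (ω : rulerMIS.Sample V) (t : ℕ) (w : V) :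
    ind (Uns G S ω t w) * deg G S ω t w =
      ∑ v ∈ nb G w, ind (Uns G S ω t w ∧ Uns G S ω t v) := by
  simp only [ind_and, deg_eq_sum, Finset.mul_sum]

theorem sum_nb_comm (f : V → V → ℝ) : ∑ w, ∑ v ∈ nb G w, f w v = ∑ w, ∑ v ∈ nb G w, f v w :=
  Finset.sum_comm' fun x y => by simp [mem_nb_comm]

/-- The weights `D w / (D v + D w)` and `D v / (D v + D w)` add up to 1 and are exchanged by
swapping the pair, so each accounts for half of the potential. Pairs in which `v` is not a member
contribute at most `lag`. -/
theorem pot_half_le (ω : rulerMIS.Sample V) (t : ℕ) :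
    pot G S ω t / 2 - lag G S ω t ≤ ∑ w, ∑ v ∈ nb G w, gain G S ω t v w *
      (1 / ((deg G S ω t v : ℝ) + deg G S ω t w)) := by
  set D : V → ℝ := fun v => deg G S ω t v with hD
  have hD0 : ∀ v, 0 ≤ D v := fun v => Nat.cast_nonneg _
  set B : V → V → ℝ := fun w v => ind (Uns G S ω t w ∧ Uns G S ω t v) with hB
  have hBc : ∀ w v, B w v = B v w := fun w v => ind_congr and_comm
  have h1 : pot G S ω t = ∑ w, ∑ v ∈ nb G w, B w v :=
    Finset.sum_congr rfl fun w _ => ind_mul_deg ω t w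
  have h2 : ∑ w, ∑ v ∈ nb G w, B w v = ∑ w, ∑ v ∈ nb G w, B w v * (D w / (D v + D w)) +
      ∑ w, ∑ v ∈ nb G w, B w v * (D v / (D v + D w)) := by
    simp only [← Finset.sum_add_distrib, ← mul_add]
    refine Finset.sum_congr rfl fun w _ => Finset.sum_congr rfl fun v _ => ?_
    by_cases h : Uns G S ω t w ∧ Uns G S ω t v
    · have hw : 0 < D w := Nat.cast_pos.2 (deg_pos h.1)
      rw [← add_div, add_comm (D w), div_self (by linarith [hD0 v]), mul_one]
    · rw [hB]
      simp only [ind_of_not h, zero_mul]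
  have h3 : ∑ w, ∑ v ∈ nb G w, B w v * (D v / (D v + D w)) =
      ∑ w, ∑ v ∈ nb G w, B w v * (D w / (D v + D w)) := by
    rw [sum_nb_comm]
    simp only [hBc, add_comm]
  have h4 : lag G S ω t = ∑ w, ∑ v ∈ nb G w,
      ind (Uns G S ω t w ∧ Uns G S ω t v ∧ ¬ Mem G S ω t v) := by
    rw [sum_nb_comm, lag]
    refine Finset.sum_congr rfl fun v _ => ?_
    rw [deg_eq_sum, Finset.mul_sum]
    refine Finset.sum_congr rfl fun w _ => ?_
    rw [← ind_and]
    exact ind_congr (by tauto)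
  have h5 : ∑ w, ∑ v ∈ nb G w, B w v * (D w / (D v + D w)) ≤
      ∑ w, ∑ v ∈ nb G w, gain G S ω t v w * (1 / (D v + D w)) + lag G S ω t := by
    rw [h4]
    simp only [← Finset.sum_add_distrib]
    refine Finset.sum_le_sum fun w _ => Finset.sum_le_sum fun v _ => ?_
    have h6 : D w / (D v + D w) ≤ 1 := div_le_one_of_le₀ (by linarith [hD0 v])
      (add_nonneg (hD0 v) (hD0 w))
    have h7 : 0 ≤ D w / (D v + D w) := div_nonneg (hD0 w) (add_nonneg (hD0 v) (hD0 w))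
    rw [gain, mul_assoc, mul_one_div]
    change _ ≤ _ * (D w / (D v + D w)) + _
    by_cases hu : Uns G S ω t w ∧ Uns G S ω t v
    · by_cases hm : Mem G S ω t v <;> simp [hB, ind, hu, hm, h6]
    · have : ¬ (Uns G S ω t w ∧ Uns G S ω t v ∧ Mem G S ω t v) := fun h => hu ⟨h.1, h.2.1⟩
      simp only [hB, ind_of_not hu, ind_of_not this, zero_mul, zero_add]
      exact ind_nonneg _
  linarith

namespace Era

variable {J a b N d : ℕ}

theorem deg_mono (E : Era G S J a b) {ω : rulerMIS.Sample V} {t t' : ℕ} (h1 : a ≤ t) (h2 : t ≤ t')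
    (h3 : t' ≤ b) (v : V) : deg G S ω t' v ≤ deg G S ω t v := by
  classical
  exact Finset.card_le_card (Finset.monotone_filter_right _ fun u _ hu => E.uns_mono h1 h2 h3 hu)

theorem pot_mono (E : Era G S J a b) {ω : rulerMIS.Sample V} {t t' : ℕ} (h1 : a ≤ t) (h2 : t ≤ t')
    (h3 : t' ≤ b) : pot G S ω t' ≤ pot G S ω t := by
  refine Finset.sum_le_sum fun v _ => mul_le_mul (ind_mono (E.uns_mono h1 h2 h3)) ?_
    (Nat.cast_nonneg _) (ind_nonneg _)
  exact_mod_cast E.deg_mono h1 h2 h3 v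

/-- Winning makes the neighbours of the winner stable. -/
theorem pot_step (E : Era G S J a b) {ω : ℕ × V → Bool} {k : ℕ} (h1 : a ≤ fs k)
    (h2 : fs (k + 2 ^ J) ≤ b) (hcard : ∀ v, (nb G v).card ≤ d + 1)
    (hd : (d + 2) ^ 5 ≤ 2 ^ 2 ^ J) :
    pot G S (sample ω) (fs (k + 2 ^ J)) ≤ pot G S (sample ω) (fs k) -
      ∑ w, ∑ v ∈ nb G w, gain G S (sample ω) (fs k) v w * ind (Win G S ω k v w) := by
  set s := fs k with hs
  set s' := fs (k + 2 ^ J) with hs'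
  have hss : s ≤ s' := fs_mono (Nat.le_add_right _ _)
  have hmono := fun v => E.uns_mono (ω := sample ω) (v := v) h1 hss h2
  rw [pot, pot, ← Finset.sum_sub_distrib]
  refine Finset.sum_le_sum fun w _ => ?_
  have hD : (deg G S (sample ω) s' w : ℝ) ≤ deg G S (sample ω) s w := by
    exact_mod_cast E.deg_mono h1 hss h2 w
  have hD0 : (0 : ℝ) ≤ deg G S (sample ω) s w := Nat.cast_nonneg _
  have hwin : ∀ v ∈ nb G w, (Uns G S (sample ω) s w ∧ Uns G S (sample ω) s v ∧
      Mem G S (sample ω) s v) ∧ Win G S ω k v w → ¬ Uns G S (sample ω) s' w := by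
    rintro v hv ⟨⟨hw, -, hm⟩, hwin⟩ hw'
    have hsp := span_le (S := S) hcard hd (sample ω) (fs k) v w
    have hle : fs (k + span G S (sample ω) (fs k) v w) ≤ s' :=
      fs_mono (Nat.add_le_add_left hsp _)
    have h3 := E.stable_of_win h1 (hle.trans h2) hm hwin
    have h4 := E.stable_mono (h1.trans (fs_mono (Nat.le_add_right _ _))) hle h2 h3
    rcases mem_nb.1 hv with rfl | hwv
    · exact hw'.2 (Or.inl h4)
    · exact hw'.2 (Or.inr ⟨v, hwv, h4⟩)
  -- At most one member near `w` wins with respect to `w`: two winners would be rivals of each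
  -- other, and over the shorter of the two spans both would have tossed only heads. This is why
  -- rivals near `w` are included.
  have hone : ∑ v ∈ nb G w, ind ((Uns G S (sample ω) s w ∧ Uns G S (sample ω) s v ∧
      Mem G S (sample ω) s v) ∧ Win G S ω k v w) ≤
      ind (Uns G S (sample ω) s w) - ind (Uns G S (sample ω) s' w) := by
    by_cases hex : ∃ v ∈ nb G w, (Uns G S (sample ω) s w ∧ Uns G S (sample ω) s v ∧
        Mem G S (sample ω) s v) ∧ Win G S ω k v w
    · obtain ⟨v, hv, hA⟩ := hex
      rw [ind_of hA.1.1, ind_of_not (hwin v hv hA), sub_zero, Finset.sum_eq_single v]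
      · exact ind_le_one _
      · rintro v' hv' hne
        refine ind_of_not fun hA' => ?_
        have hr : v' ∈ rivals G S (sample ω) s v w := mem_rivals.2 ⟨hne, Or.inr hv', hA'.1.2.2⟩
        have hr' : v ∈ rivals G S (sample ω) s v' w :=
          mem_rivals.2 ⟨hne.symm, Or.inr hv, hA.1.2.2⟩
        have n1 := hA.2.2 v' hr
        have n2 := hA'.2.2 v hr'
        rcases le_total (span G S (sample ω) (fs k) v w) (span G S (sample ω) (fs k) v' w)
          with hle | hle
        · refine n1 fun p hp => hA'.2.1 p ?_
          rw [mem_bouts] at hp ⊢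
          exact ⟨hp.1, hp.2.1.trans_le (fs_mono (Nat.add_le_add_left hle _)), hp.2.2⟩
        · refine n2 fun p hp => hA.2.1 p ?_
          rw [mem_bouts] at hp ⊢
          exact ⟨hp.1, hp.2.1.trans_le (fs_mono (Nat.add_le_add_left hle _)), hp.2.2⟩
      · exact fun h => absurd hv h
    · push Not at hex
      rw [Finset.sum_eq_zero fun v hv => ind_of_not fun hA => hex v hv hA.1 hA.2]
      exact sub_nonneg.2 (ind_mono (hmono w))
  have hsum : ∑ v ∈ nb G w, gain G S (sample ω) s v w * ind (Win G S ω k v w) =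
      deg G S (sample ω) s w * ∑ v ∈ nb G w, ind ((Uns G S (sample ω) s w ∧
        Uns G S (sample ω) s v ∧ Mem G S (sample ω) s v) ∧ Win G S ω k v w) := by
    rw [Finset.mul_sum]
    refine Finset.sum_congr rfl fun v _ => ?_
    rw [gain, ind_and (_ ∧ _ ∧ _)]
    ring
  rw [hsum]
  have h5 := mul_le_mul_of_nonneg_left hone hD0
  have h6 := mul_le_mul_of_nonneg_left hD (ind_nonneg (Uns G S (sample ω) s' w))
  linarith

theorem Ex_pot_step (E : Era G S J a b) {k : ℕ} (h1 : a ≤ fs k)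
    (h2 : fs (k + 2 ^ J) ≤ b) (hN : fs (k + 2 ^ J) ≤ N) (hcard : ∀ v, (nb G v).card ≤ d + 1)
    (hd : (d + 2) ^ 5 ≤ 2 ^ 2 ^ J) :
    Ex (coins V N) (fun ω => pot G S (sample ω) (fs (k + 2 ^ J))) ≤
      Ex (coins V N) (fun ω => pot G S (sample ω) (fs k)) -
        1 / 16384 * (Ex (coins V N) (fun ω => pot G S (sample ω) (fs k)) / 2 -
          Ex (coins V N) fun ω => lag G S (sample ω) (fs k)) := by
  have hstep := Ex_mono (F := coins V N) fun ω => E.pot_step (ω := ω) h1 h2 hcard hd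
  rw [Ex_sub, Ex_sum] at hstep
  simp only [Ex_sum] at hstep
  have hpair : ∀ v w, 1 / 16384 * Ex (coins V N) (fun ω => gain G S (sample ω) (fs k) v w *
      (1 / ((deg G S (sample ω) (fs k) v : ℝ) + deg G S (sample ω) (fs k) w))) ≤
      Ex (coins V N) fun ω => gain G S (sample ω) (fs k) v w * ind (Win G S ω k v w) := by
    intro v w
    have h3 := le_Ex_mul (F := coins V N) (P := before V (fs k))
      (f := fun ω => gain G S (sample ω) (fs k) v w) (g := fun ω => ind (Win G S ω k v w))
      (c := fun ω => 1 / 16384 *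
        (1 / ((deg G S (sample ω) (fs k) v : ℝ) + deg G S (sample ω) (fs k) w))) ?_ ?_ ?_
    · simp only [mul_left_comm _ (1 / 16384 : ℝ), Ex_mul_left] at h3
      exact h3
    · intro ω ω' h
      simp only [gain, dep_uns (G := G) (S := S) (fs k) v ω ω' h,
        dep_uns (G := G) (S := S) (fs k) w ω ω' h, dep_mem (G := G) (S := S) (fs k) v ω ω' h,
        dep_deg (G := G) (S := S) (fs k) w ω ω' h]
    · exact fun ω => mul_nonneg (ind_nonneg _) (Nat.cast_nonneg _)
    · intro ω hω
      have hA : Uns G S (sample ω) (fs k) w ∧ Uns G S (sample ω) (fs k) v ∧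
          Mem G S (sample ω) (fs k) v := by
        by_contra hA
        rw [gain, ind_of_not hA, zero_mul] at hω
        exact hω.false
      exact le_win hcard hd hN hA.2.1 hA.1
  have hhalf := Ex_mono (F := coins V N) fun ω => pot_half_le (G := G) (S := S) (sample ω) (fs k)
  simp only [div_eq_mul_inv, Ex_sub, Ex_mul_right] at hhalf
  simp only [← div_eq_mul_inv] at hhalf
  simp only [Ex_sum] at hhalf
  have hall : 1 / 16384 * ∑ w, ∑ v ∈ nb G w, Ex (coins V N)
      (fun ω => gain G S (sample ω) (fs k) v w *
        (1 / ((deg G S (sample ω) (fs k) v : ℝ) + deg G S (sample ω) (fs k) w))) ≤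
      ∑ w, ∑ v ∈ nb G w, Ex (coins V N)
        fun ω => gain G S (sample ω) (fs k) v w * ind (Win G S ω k v w) := by
    simp only [Finset.mul_sum]
    exact Finset.sum_le_sum fun w _ => Finset.sum_le_sum fun v _ => hpair v w
  linarith

theorem Ex_lag_le (E : Era G S J a b) {k : ℕ} (h1 : a ≤ fs (k * 2 ^ J))
    (h2 : fs ((k + 1) * 2 ^ J + 1) ≤ b) (hN : fs ((k + 1) * 2 ^ J + 1) ≤ N)
    (hcard : ∀ v, (nb G v).card ≤ d + 1) (hd : (d + 2) ^ 5 ≤ 2 ^ 2 ^ J) :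
    Ex (coins V N) (fun ω => lag G S (sample ω) (fs ((k + 1) * 2 ^ J + 1))) ≤
      1 / 4 * Ex (coins V N) fun ω => pot G S (sample ω) (fs (k * 2 ^ J + 1)) := by
  simp only [lag, pot, Ex_sum, Finset.mul_sum]
  refine Finset.sum_le_sum fun v _ => ?_
  have ha : a ≤ fs (k * 2 ^ J + 1) := h1.trans (by unfold fs; omega)
  have hss : fs (k * 2 ^ J + 1) ≤ fs ((k + 1) * 2 ^ J + 1) := 
    fs_mono (Nat.add_le_add_right (Nat.mul_le_mul_right _ (Nat.le_succ k)) _)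
  set W : (ℕ × V → Bool) → ℝ := fun ω => ind (Uns G S (sample ω) (fs (k * 2 ^ J + 1)) v) *
    deg G S (sample ω) (fs (k * 2 ^ J + 1)) v with hW
  have h0 : ∀ ω, 0 ≤ W ω := fun ω => mul_nonneg (ind_nonneg _) (Nat.cast_nonneg _)
  have hle : ∀ ω, ind (Uns G S (sample ω) (fs ((k + 1) * 2 ^ J + 1)) v ∧
      ¬ Mem G S (sample ω) (fs ((k + 1) * 2 ^ J + 1)) v) *
        (deg G S (sample ω) (fs ((k + 1) * 2 ^ J + 1)) v : ℝ) ≤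
      W ω * ind (Uns G S (sample ω) (fs ((k + 1) * 2 ^ J + 1)) v ∧
        ¬ Mem G S (sample ω) (fs ((k + 1) * 2 ^ J + 1)) v) := by
    intro ω
    by_cases hu : Uns G S (sample ω) (fs ((k + 1) * 2 ^ J + 1)) v ∧
      ¬ Mem G S (sample ω) (fs ((k + 1) * 2 ^ J + 1)) v
    · rw [hW]
      simp only
      rw [ind_of hu, ind_of (E.uns_mono ha hss h2 hu.1), one_mul, one_mul, mul_one]
      exact_mod_cast E.deg_mono ha hss h2 v
    · rw [ind_of_not hu, zero_mul, mul_zero]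
  refine (Ex_mono hle).trans ?_
  by_cases hv : S.Active a v
  · refine E.not_mem_le h1 h2 hN hcard hd hv (fun ω ω' h => ?_) h0
    simp only [hW, dep_uns (G := G) (S := S) _ v ω ω' h, dep_deg (G := G) (S := S) _ v ω ω' h]
  · have hz : ∀ ω, W ω = 0 := fun ω => by
      rw [hW]
      simp only
      rw [ind_of_not fun hu => hv ((E.active _ ha (hss.trans h2) v).1 hu.1), zero_mul]
    simp only [hz, zero_mul, Ex_const]
    exact mul_nonneg (by norm_num) (Ex_nonneg h0)

/-- The potential contracts. -/
theorem Ex_pot_le (E : Era G S J a b) {k : ℕ} (h1 : a ≤ fs (k * 2 ^ J))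
    (h2 : fs ((k + 2) * 2 ^ J + 1) ≤ b) (hN : fs ((k + 2) * 2 ^ J + 1) ≤ N)
    (hcard : ∀ v, (nb G v).card ≤ d + 1) (hd : (d + 2) ^ 5 ≤ 2 ^ 2 ^ J) :
    Ex (coins V N) (fun ω => pot G S (sample ω) (fs ((k + 2) * 2 ^ J + 1))) ≤
      (1 - 1 / 65536) * Ex (coins V N) fun ω => pot G S (sample ω) (fs (k * 2 ^ J + 1)) := by
  have hss : fs (k * 2 ^ J + 1) ≤ fs ((k + 1) * 2 ^ J + 1) := 
    fs_mono (Nat.add_le_add_right (Nat.mul_le_mul_right _ (Nat.le_succ k)) _)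
  have hss' : fs ((k + 1) * 2 ^ J + 1) ≤ fs ((k + 2) * 2 ^ J + 1) := 
    fs_mono (Nat.add_le_add_right (Nat.mul_le_mul_right _ (Nat.le_succ (k + 1))) _)
  have ha : a ≤ fs (k * 2 ^ J + 1) := h1.trans (by unfold fs; omega)
  have e : (k + 2) * 2 ^ J + 1 = (k + 1) * 2 ^ J + 1 + 2 ^ J := by ring
  have h3 := E.Ex_lag_le h1 (hss'.trans h2) (hss'.trans hN) hcard hd
  have h4 := E.Ex_pot_step (N := N) (k := (k + 1) * 2 ^ J + 1) (ha.trans hss) (by rwa [← e])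
    (by rwa [← e]) hcard hd
  rw [← e] at h4
  have h5 := Ex_mono (F := coins V N) fun ω =>
    E.pot_mono (ω := sample ω) ha hss (hss'.trans h2)
  -- With `P` the expected potential at the start and `P'` after one period, the bound is `P' - (P'
  -- / 2 - P / 4) / 16384`, and `P' ≤ P` turns it into `(1 - 1 / 65536) * P`.
  linarith

end Era

end RulerMIS

/-! ### Transfer to the infinite product measure. -/

theorem coin_prob (x : Fin 1 → Bool) :
    (PMF.uniformOfFintype (Fin 1 → Bool)).toMeasure.real {x} = 1 / 2 := by
  rw [Measure.real, PMF.toMeasure_apply_singleton _ _ (measurableSet_singleton x),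
    PMF.uniformOfFintype_apply]
  simp

/-- Probabilities of events that are determined by finitely many coins. -/
theorem infinitePi_real_eq_Ex {ι : Type*} (F : Finset ι) (A : Set (ι → Fin 1 → Bool))
    (hA : ∀ ω ω' : ι → Fin 1 → Bool, (∀ i ∈ F, ω i = ω' i) → ω ∈ A → ω' ∈ A) :
    (Measure.infinitePi fun _ : ι => (PMF.uniformOfFintype (Fin 1 → Bool)).toMeasure).real A =
      Ex F fun ω => ind ((fun i _ => ω i) ∈ A) := by
  classical
  let μ : F → Measure (Fin 1 → Bool) := fun _ => (PMF.uniformOfFintype (Fin 1 → Bool)).toMeasure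
  let e : (F → Fin 1 → Bool) ≃ (F → Bool) := Equiv.piCongrRight fun _ => Equiv.funUnique _ _
  let B : Set (F → Fin 1 → Bool) := {x | (fun i _ => pad F (e x) i) ∈ A}
  have hpre : A = F.restrict ⁻¹' B := by
    have key : ∀ ω : ι → Fin 1 → Bool, ∀ i ∈ F,
        ω i = fun _ => pad F (e (F.restrict ω)) i := by
      intro ω i hi
      funext j
      rw [pad, dif_pos hi, Subsingleton.elim j 0]
      rfl
    ext ω
    exact ⟨hA _ _ (key ω), hA _ _ fun i hi => (key ω i hi).symm⟩
  have hB : MeasurableSet B := B.toFinite.measurableSet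
  have h1 : (Measure.infinitePi fun _ : ι =>
      (PMF.uniformOfFintype (Fin 1 → Bool)).toMeasure).real A = (Measure.pi μ).real B := by
    have hmap : (Measure.infinitePi fun _ : ι =>
        (PMF.uniformOfFintype (Fin 1 → Bool)).toMeasure).map F.restrict = Measure.pi μ :=
      Measure.infinitePi_map_restrict _
    rw [← hmap, map_measureReal_apply (Finset.measurable_restrict F) hB, ← hpre]
  have h2 : (Measure.pi μ).real B = ∑ x : F → Fin 1 → Bool, ind (x ∈ B) * (1 / 2) ^ F.card := by
    have h3 := sum_measureReal_singleton (μ := Measure.pi μ) B.toFinset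
    rw [Set.coe_toFinset] at h3
    rw [← h3, ← Finset.sum_filter_add_sum_filter_not Finset.univ (fun x => x ∈ B),
      Finset.sum_eq_zero (s := Finset.univ.filter fun x => ¬ x ∈ B), add_zero]
    · refine Finset.sum_congr (by ext; simp) fun x hx => ?_
      rw [ind_of (by simpa using hx), one_mul, Measure.real, Measure.pi_singleton,
        ENNReal.toReal_prod]
      refine (Finset.prod_congr rfl fun i _ => coin_prob (x i)).trans ?_
      simp
    · intro x hx
      rw [ind_of_not (Finset.mem_filter.1 hx).2, zero_mul]
  rw [h1, h2, Ex, Finset.expect_eq_sum_div_card, ← Finset.sum_mul, ← e.sum_comp]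
  simp only [Finset.card_univ, Fintype.card_fun, Fintype.card_bool, Fintype.card_coe]
  rw [one_div_pow, mul_one_div]
  push_cast
  rfl

namespace RulerMIS

variable {V : Type} {G : SimpleGraph V} {S : Schedule V}

theorem allStable_of_agree {ω ω' : rulerMIS.Sample V} {t : ℕ}
    (h : ∀ p : ℕ × V, p.1 < t → ω p = ω' p) (hω : rulerMIS.AllStable G S ω t) :
    rulerMIS.AllStable G S ω' t := by
  intro v hv
  have h1 := st_congr (G := G) (S := S) h
  have h2 := hω v hv
  simp only [Algorithm.Stable, stableMIS_iff_mem, Mem, h1] at h2 ⊢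
  exact h2

variable [Fintype V]

instance : IsProbabilityMeasure (rulerMIS.coinMeasure V) := by
  unfold Algorithm.coinMeasure
  infer_instance

/-- Probabilities of events that are determined by the coins of the first `N` rounds. -/
theorem prob_eq {N : ℕ} (A : Set (rulerMIS.Sample V))
    (hA : ∀ ω ω' : rulerMIS.Sample V, (∀ p : ℕ × V, p.1 < N → ω p = ω' p) → ω ∈ A → ω' ∈ A) :
    (rulerMIS.coinMeasure V).real A = Ex (coins V N) fun ω => ind (sample ω ∈ A) :=
  infinitePi_real_eq_Ex (coins V N) A fun ω ω' h =>
    hA ω ω' fun p hp => h p (mem_coins.2 hp)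

theorem prob_not_allStable (t : ℕ) :
    (rulerMIS.coinMeasure V).real {ω | ¬ rulerMIS.AllStable G S ω t} =
      1 - (rulerMIS.coinMeasure V).real {ω | rulerMIS.AllStable G S ω t} := by
  rw [prob_eq (N := t) {ω | rulerMIS.AllStable G S ω t} fun ω ω' h => allStable_of_agree h,
    prob_eq (N := t) {ω | ¬ rulerMIS.AllStable G S ω t} fun ω ω' h hω hω' =>
      hω (allStable_of_agree (fun p hp => (h p hp).symm) hω'),
    ← Ex_const (F := coins V t) 1, ← Ex_sub]
  exact congrArg _ (funext fun ω => ind_not _)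

/-- The probability of stability in a long era. -/
theorem Era.le_prob {J a b d : ℕ} (E : Era G S J a b) {k m : ℕ} (h1 : a ≤ fs (k * 2 ^ J))
    (h2 : fs ((k + 2 * m) * 2 ^ J + 1) ≤ b) (hcard : ∀ v, (nb G v).card ≤ d + 1)
    (hd : (d + 2) ^ 5 ≤ 2 ^ 2 ^ J) :
    1 - (Fintype.card V : ℝ) ^ 2 * (1 - 1 / 65536) ^ m ≤
      (rulerMIS.coinMeasure V).real {ω | rulerMIS.AllStable G S ω b} := by
  have hiter : ∀ i ≤ m, Ex (coins V b)
      (fun ω => pot G S (sample ω) (fs ((k + 2 * i) * 2 ^ J + 1))) ≤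
      (Fintype.card V : ℝ) ^ 2 * (1 - 1 / 65536) ^ i := by
    intro i hi
    induction i with
    | zero => simpa using Ex_mono (F := coins V b) (fun ω => pot_le (G := G) (S := S) (sample ω) _)
        |>.trans_eq (Ex_const _)
    | succ i ih =>
      have h3 : fs ((k + 2 * i + 2) * 2 ^ J + 1) ≤ b :=
        (fs_mono (Nat.add_le_add_right (Nat.mul_le_mul_right _ (by omega)) _)).trans h2
      have h4 := E.Ex_pot_le (N := b) (k := k + 2 * i)
        (h1.trans (fs_mono (Nat.mul_le_mul_right _ (by omega)))) h3 h3 hcard hd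
      rw [show k + 2 * (i + 1) = k + 2 * i + 2 by ring, pow_succ' _ i]
      refine h4.trans ?_
      have := mul_le_mul_of_nonneg_left (ih (by omega)) (by norm_num : (0 : ℝ) ≤ 1 - 1 / 65536)
      linarith
  rw [prob_eq (N := b)]
  · have hfa : a ≤ fs ((k + 2 * m) * 2 ^ J + 1) := h1.trans (fs_mono
      ((Nat.mul_le_mul_right _ (Nat.le_add_right k _)).trans (Nat.le_succ _)))
    -- Markov's inequality for a potential that is at least 1 as long as some node is unstable.
    have h3 : ∀ ω, 1 - pot G S (sample ω) (fs ((k + 2 * m) * 2 ^ J + 1)) ≤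
        ind (sample ω ∈ {ω | rulerMIS.AllStable G S ω b}) := by
      intro ω
      by_cases hω : rulerMIS.AllStable G S (sample ω) b
      · have h4 : ind (sample ω ∈ {ω | rulerMIS.AllStable G S ω b}) = 1 := ind_of hω
        linarith [pot_nonneg (G := G) (S := S) (sample ω) (fs ((k + 2 * m) * 2 ^ J + 1))]
      · have h4 := (one_le_pot hω).trans (E.pot_mono hfa h2 le_rfl)
        linarith [ind_nonneg (sample ω ∈ {ω | rulerMIS.AllStable G S ω b})]
    have h5 := Ex_mono (F := coins V b) h3
    rw [Ex_sub, Ex_const] at h5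
    linarith [hiter m le_rfl]
  · exact fun ω ω' h => allStable_of_agree h

end RulerMIS

/-! ### Choice of constants and conclusion. -/

namespace RulerMIS

theorem exists_pow_two {n : ℕ} (hn : 2 ≤ n) : ∃ l, n ≤ 2 ^ l ∧ 2 ^ l ≤ 2 * n := by
  refine ⟨Nat.clog 2 n, Nat.le_pow_clog Nat.one_lt_two n, ?_⟩
  have h1 : 0 < Nat.clog 2 n := Nat.clog_pos Nat.one_lt_two hn
  obtain ⟨l, hl⟩ : ∃ l, Nat.clog 2 n = l + 1 := ⟨_, (Nat.sub_add_cancel h1).symm⟩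
  have h2 := Nat.pow_pred_clog_lt_self (x := n) Nat.one_lt_two hn
  rw [hl, Nat.pred_succ] at h2
  rw [hl, pow_succ']
  exact Nat.mul_le_mul_left _ h2.le

/-- A number of frames that suffices for maximum degree `d`. -/
theorem exists_scale (d : ℕ) : ∃ J : ℕ, (d + 2) ^ 5 ≤ 2 ^ 2 ^ J ∧
    (2 : ℝ) ^ J ≤ 30 * Real.log (d + 2) ∧ (matureAge J : ℝ) ≤ 5000 * Real.log (d + 2) := by
  obtain ⟨l, h1, h2⟩ := exists_pow_two (n := d + 2) (by omega)
  have h3 : l ≠ 0 := by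
    rintro rfl
    rw [pow_zero] at h1
    omega
  -- Since `2 ^ l ≥ d + 2`, the fifth power is at most `2 ^ (5 * l)`; rounding `5 * l` up to a power
  -- of two at most doubles it.
  obtain ⟨J, h4, h5⟩ := exists_pow_two (n := 5 * l) (by omega)
  have hlog2 := Real.log_two_gt_d9
  have h7 : Real.log 2 ≤ Real.log (d + 2) :=
    Real.log_le_log (by norm_num) (by linarith [Nat.cast_nonneg (α := ℝ) d])
  have h8 : (l : ℝ) * Real.log 2 ≤ Real.log 2 + Real.log (d + 2) := by
    have h2' : (2 : ℝ) ^ l ≤ 2 * (d + 2) := by exact_mod_cast h2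
    rw [← Real.log_pow, ← Real.log_mul (by norm_num) (by positivity)]
    exact Real.log_le_log (by positivity) h2'
  have h9 : (l : ℝ) ≤ 3 * Real.log (d + 2) := by
    have hl0 : (0 : ℝ) ≤ l := Nat.cast_nonneg l
    nlinarith
  have h10 : (2 : ℝ) ^ J ≤ 2 * (5 * l) := by exact_mod_cast h5
  refine ⟨J, ?_, by linarith, ?_⟩
  · calc (d + 2) ^ 5 ≤ (2 ^ l) ^ 5 := Nat.pow_le_pow_left h1 5
      _ = 2 ^ (5 * l) := by rw [← pow_mul, mul_comm]
      _ ≤ _ := Nat.pow_le_pow_right (by norm_num) h4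
  · unfold matureAge
    push_cast
    rw [pow_add]
    linarith

variable {V : Type} {G : SimpleGraph V} {S : Schedule V}

theorem allStable_of_le {δ t T T' : ℕ} (hS : S.IsSimple G δ) (hδ : 74 ≤ δ) (hq : ∀ T, S.Quiet t T)
    {ω : rulerMIS.Sample V} (hT : T ≤ T') (h : rulerMIS.AllStable G S ω (t + T)) :
    rulerMIS.AllStable G S ω (t + T') := by
  induction T', hT using Nat.le_induction with
  | base => exact h
  | succ r _ ih =>
    have hact : ∀ v, S.Active (t + r + 1) v ↔ S.Active (t + r) v := fun v => by
      rw [hq (r + 1) (t + r + 1) (by omega) (by omega), hq (r + 1) (t + r) (by omega) (by omega)]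
    intro v hv
    have hv' := (hact v).1 hv
    exact stabilityPersists hS hδ ω (t + r) v hv' (ih v hv') hv fun u _ hu => (hact u).2 hu.1

variable [Fintype V]

theorem card_nb_le [DecidableRel G.Adj] (v : V) : (nb G v).card ≤ G.maxDegree + 1 := by
  classical
  have h : nb G v ⊆ insert v (G.neighborFinset v) := by
    intro w hw
    rw [Finset.mem_insert, SimpleGraph.mem_neighborFinset]
    exact (mem_nb.1 hw).imp Eq.symm id
  refine (Finset.card_le_card h).trans ((Finset.card_insert_le _ _).trans ?_)
  exact Nat.add_le_add_right (G.degree_le_maxDegree v) 1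

/-- The probability of stability at the end of a long quiet period. -/
theorem le_prob_of_quiet [DecidableRel G.Adj] {δ J t T m : ℕ} (hS : S.IsSimple G δ)
    (hJ : matureAge J ≤ δ) (hd : (G.maxDegree + 2) ^ 5 ≤ 2 ^ 2 ^ J) (hq : S.Quiet t T)
    (hT : matureAge J + 110 + 36 * 2 ^ J + 72 * 2 ^ J * m ≤ T) :
    1 - (Fintype.card V : ℝ) ^ 2 * (1 - 1 / 65536) ^ m ≤
      (rulerMIS.coinMeasure V).real {ω | rulerMIS.AllStable G S ω (t + T)} := by
  have E := era_of_quiet hS hJ hq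
  set L := 2 ^ J with hL
  set A := t + matureAge J with hA
  have hpos : 0 < 36 * L := by positivity
  -- The period chosen starts after the era has begun, at the cost of at most `36 * L` rounds up to
  -- a constant.
  set k := A / (36 * L) + 1 with hk
  have h1 : 36 * L * k = 36 * L * (A / (36 * L)) + 36 * L := by rw [hk]; ring
  have h2 := Nat.div_add_mod A (36 * L)
  have h3 := Nat.mod_lt A hpos
  have e1 : fs (k * L) = 74 + 36 * L * k := by unfold fs; ring
  have e2 : fs ((k + 2 * m) * L + 1) = 110 + 36 * L * k + 72 * L * m := by unfold fs; ring
  refine E.le_prob (k := k) (m := m) ?_ ?_ card_nb_le hd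
  · rw [← hL, e1]
    omega
  · rw [← hL, e2]
    omega

/-- Eventually, nothing happens any more. -/
theorem exists_quiet (S : Schedule V) : ∃ t, ∀ T, S.Quiet t T := by
  have h : ∀ v, ∃ t, ∀ s, t ≤ s → (S.Active s v ↔ S.Active t v) := by
    intro v
    by_cases hw : ∃ s : ℕ, S.wake v ≤ (s : ℕ∞)
    · obtain ⟨r, hr⟩ := hw
      by_cases hc : ∃ s : ℕ, S.crash v ≤ (s : ℕ∞)
      · obtain ⟨r', hr'⟩ := hc
        refine ⟨r', fun s hs => iff_of_false (fun h => ?_) fun h => absurd h.2 (not_lt.2 hr')⟩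
        exact absurd h.2 (not_lt.2 (hr'.trans (by exact_mod_cast hs)))
      · push Not at hc
        exact ⟨r, fun s hs => iff_of_true ⟨hr.trans (by exact_mod_cast hs), hc s⟩ ⟨hr, hc r⟩⟩
    · push Not at hw
      exact ⟨0, fun s _ => iff_of_false (fun h => absurd h.1 (not_le.2 (hw s)))
        fun h => absurd h.1 (not_le.2 (hw 0))⟩
  choose f hf using h
  refine ⟨Finset.univ.sup f, fun T s h1 _ v => ?_⟩
  have h2 : f v ≤ Finset.univ.sup f := Finset.le_sup (Finset.mem_univ v)
  rw [hf v s (h2.trans h1), hf v _ h2]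

/-- After the last wake-up and crash, the event of never reaching stability has probability at most
`n ^ 2 * (1 - 1 / 65536) ^ m` for every `m`, hence zero; stability once reached then persists. -/
theorem isLasVegas [DecidableRel G.Adj] {δ J : ℕ} (hS : S.IsSimple G δ)
    (hJ : matureAge J ≤ δ) (hd : (G.maxDegree + 2) ^ 5 ≤ 2 ^ 2 ^ J) :
    rulerMIS.IsLasVegas G S := by
  have hδ : 74 ≤ δ := le_trans (by unfold matureAge; omega) hJ
  refine ⟨?_, stabilityPersists hS hδ⟩
  obtain ⟨t, hq⟩ := exists_quiet S
  set bad : Set (rulerMIS.Sample V) := {ω | ∀ T, ¬ rulerMIS.AllStable G S ω (t + T)} with hbad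
  have hle : ∀ m : ℕ, (rulerMIS.coinMeasure V).real bad ≤
      (Fintype.card V : ℝ) ^ 2 * (1 - 1 / 65536) ^ m := by
    intro m
    set T := matureAge J + 110 + 36 * 2 ^ J + 72 * 2 ^ J * m with hT
    have h1 := le_prob_of_quiet hS hJ hd (hq T) hT.ge
    have h2 : (rulerMIS.coinMeasure V).real bad ≤
        (rulerMIS.coinMeasure V).real {ω | ¬ rulerMIS.AllStable G S ω (t + T)} :=
      measureReal_mono fun ω hω => hω T
    rw [prob_not_allStable] at h2
    linarith
  have hzero : (rulerMIS.coinMeasure V).real bad = 0 := by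
    refine le_antisymm ?_ measureReal_nonneg
    have hlim := (tendsto_pow_atTop_nhds_zero_of_lt_one (r := (1 - 1 / 65536 : ℝ)) (by norm_num)
      (by norm_num)).const_mul ((Fintype.card V : ℝ) ^ 2)
    rw [mul_zero] at hlim
    exact ge_of_tendsto' hlim hle
  rw [measureReal_eq_zero_iff] at hzero
  rw [ae_iff]
  refine measure_mono_null (t := bad) ?_ hzero
  intro ω hω T hT
  refine hω ⟨t + T, fun s hs => ?_⟩
  obtain ⟨r, rfl⟩ := Nat.exists_eq_add_of_le hs
  rw [add_assoc]
  exact allStable_of_le hS hδ hq (Nat.le_add_right T r) hT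

theorem quadratic_bound {c l L M : ℝ} (hl : 0.69 ≤ l) (hc : 1 ≤ c) (hL : L ≤ 60 * l)
    (hM : M ≤ 10000 * l) {m : ℝ} (hm0 : 0 ≤ m) (hm : m ≤ 65536 * (c + 2) * l + 1) :
    M + 110 + 36 * L + 72 * L * m ≤ 300000000 * (c + 2) * l ^ 2 := by
  have h1 : 72 * L * m ≤ 72 * (60 * l) * (65536 * (c + 2) * l + 1) := by
    have := mul_le_mul_of_nonneg_right hL hm0
    have := mul_le_mul_of_nonneg_left hm (by linarith : 0 ≤ 72 * (60 * l))
    nlinarith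
  have h2 : l ≤ 2 * l ^ 2 := by nlinarith
  have h3 : 1 ≤ 3 * l ^ 2 := by nlinarith
  have h4 : l ^ 2 ≤ (c + 2) * l ^ 2 := by nlinarith
  nlinarith

/-- By `1 - x ≤ exp (-x)`, the contractions contribute the exponent `-(c + 2) * log n`, of which `2
* log n` pays for the initial potential. -/
theorem sq_mul_pow_le {n m : ℕ} (hn : 0 < n) {c : ℝ}
    (hm : 65536 * (c + 2) * Real.log n ≤ m) :
    (n : ℝ) ^ 2 * (1 - 1 / 65536) ^ m ≤ (n : ℝ) ^ (-c) := by
  have hn' : (0 : ℝ) < n := by exact_mod_cast hn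
  have h1 : (1 - 1 / 65536 : ℝ) ^ m ≤ Real.exp (-(1 / 65536) * m) := by
    rw [mul_comm, Real.exp_nat_mul]
    exact pow_le_pow_left₀ (by norm_num) (by
      have := Real.add_one_le_exp (-(1 / 65536) : ℝ)
      linarith) m
  have h2 : (n : ℝ) ^ 2 = Real.exp (Real.log n * 2) := by
    rw [Real.exp_mul, Real.exp_log hn']
    norm_num
  calc (n : ℝ) ^ 2 * (1 - 1 / 65536) ^ m
      ≤ Real.exp (Real.log n * 2) * Real.exp (-(1 / 65536) * m) := by
        rw [h2]
        exact mul_le_mul_of_nonneg_left h1 (Real.exp_nonneg _)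
    _ = Real.exp (Real.log n * 2 + -(1 / 65536) * m) := (Real.exp_add _ _).symm
    _ ≤ Real.exp (Real.log n * -c) := Real.exp_le_exp.2 (by linarith)
    _ = _ := (Real.rpow_def_of_pos hn' _).symm

theorem le_prob_of_log_sq_le [DecidableRel G.Adj] {δ J t T : ℕ} (hS : S.IsSimple G δ)
    (hJ : matureAge J ≤ δ) (hd : (G.maxDegree + 2) ^ 5 ≤ 2 ^ 2 ^ J)
    (hJL : (2 : ℝ) ^ J ≤ 30 * Real.log (G.maxDegree + 2))
    (hJM : (matureAge J : ℝ) ≤ 5000 * Real.log (G.maxDegree + 2)) (hq : S.Quiet t T)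
    {c : ℝ} (hc : 1 ≤ c)
    (hT : 300000000 * (c + 2) * Real.log (Fintype.card V) ^ 2 ≤ T) :
    1 - (Fintype.card V : ℝ) ^ (-c) ≤
      (rulerMIS.coinMeasure V).real {ω | rulerMIS.AllStable G S ω (t + T)} := by
  -- For at most one node the logarithm vanishes and `T` may be 0. The empty graph is always stable,
  -- and for one node the claimed bound is 0.
  rcases Nat.lt_or_ge (Fintype.card V) 2 with hn | hn
  · rcases Nat.eq_zero_or_pos (Fintype.card V) with h0 | h0
    · have hE := Fintype.card_eq_zero_iff.1 h0
      have : {ω | rulerMIS.AllStable G S ω (t + T)} = Set.univ :=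
        Set.eq_univ_of_forall fun ω v => hE.elim v
      rw [this, probReal_univ]
      linarith [Real.rpow_nonneg (Nat.cast_nonneg (α := ℝ) (Fintype.card V)) (-c)]
    · rw [show Fintype.card V = 1 by omega, Nat.cast_one, Real.one_rpow, sub_self]
      exact measureReal_nonneg
  · set n := Fintype.card V with hn'
    have hn2 : (2 : ℝ) ≤ n := by exact_mod_cast hn
    have hl2 : Real.log 2 ≤ Real.log n := Real.log_le_log (by norm_num) hn2
    have hlog2 := Real.log_two_gt_d9
    -- Here `d_max + 2 ≤ n + 1 ≤ n ^ 2`. It turns the bound of order log n log d_max into log² n.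
    have hdeg : Real.log (G.maxDegree + 2) ≤ 2 * Real.log n := by
      have hne : Nonempty V := Fintype.card_pos_iff.1 (by omega)
      have h1 : G.maxDegree < n := G.maxDegree_lt_card_verts
      have h2 : (G.maxDegree : ℝ) + 1 ≤ n := by exact_mod_cast h1
      have h3 : Real.log (G.maxDegree + 2) ≤ Real.log ((n : ℝ) ^ 2) :=
        Real.log_le_log (by positivity) (by nlinarith)
      rwa [Real.log_pow, Nat.cast_two] at h3
    have hpos : 0 ≤ 65536 * (c + 2) * Real.log n :=
      mul_nonneg (by linarith) (by linarith)
    set m := ⌈65536 * (c + 2) * Real.log n⌉₊ with hm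
    have hm1 : 65536 * (c + 2) * Real.log n ≤ m := Nat.le_ceil _
    have hm2 : (m : ℝ) ≤ 65536 * (c + 2) * Real.log n + 1 := (Nat.ceil_lt_add_one hpos).le
    have hq' := quadratic_bound (L := 2 ^ J) (M := matureAge J) (l := Real.log n) (by linarith) hc
      (by linarith) (by linarith) (Nat.cast_nonneg m) hm2
    have hT' : matureAge J + 110 + 36 * 2 ^ J + 72 * 2 ^ J * m ≤ T := by
      have := hq'.trans hT
      exact_mod_cast this
    have h1 := le_prob_of_quiet hS hJ hd hq hT'
    have h2 := sq_mul_pow_le (n := n) (by omega) hm1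
    linarith

end RulerMIS

end Beeping

theorem mainTheorem6 :
    ∃ (A : Beeping.Algorithm) (a : ℝ), 0 < a ∧
      (∀ (V : Type) [Fintype V] (G : SimpleGraph V) [DecidableRel G.Adj]
        (S : Beeping.Schedule V) (δ : ℕ),
        a * Real.log (G.maxDegree + 2) ≤ δ → S.IsSimple G δ → A.IsLasVegas G S) ∧
      ∀ c : ℝ, 1 ≤ c → ∃ K : ℝ, 0 < K ∧
        ∀ (V : Type) [Fintype V] (G : SimpleGraph V) [DecidableRel G.Adj]
          (S : Beeping.Schedule V) (δ : ℕ),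
          a * Real.log (G.maxDegree + 2) ≤ δ → S.IsSimple G δ →
          ∀ t T : ℕ, K * Real.log (Fintype.card V) ^ 2 ≤ T → S.Quiet t T →
            1 - (Fintype.card V : ℝ) ^ (-c) ≤
              (A.coinMeasure V).real {ω | A.AllStable G S ω (t + T)} := by
  refine ⟨Beeping.rulerMIS, 5000, by norm_num, ?_, fun c hc =>
    ⟨300000000 * (c + 2), by linarith, ?_⟩⟩
  · intro V _ G _ S δ hδ hS
    obtain ⟨J, hd, -, hJM⟩ := Beeping.RulerMIS.exists_scale G.maxDegree
    exact Beeping.RulerMIS.isLasVegas hS (by exact_mod_cast hJM.trans hδ) hd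
  · intro V _ G _ S δ hδ hS t T hT hq
    obtain ⟨J, hd, hJL, hJM⟩ := Beeping.RulerMIS.exists_scale G.maxDegree
    exact Beeping.RulerMIS.le_prob_of_log_sq_le hS (by exact_mod_cast hJM.trans hδ) hd hJL hJM hq
      hc hT
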